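/- Let $F$ be a non-Archimedean local field with ring of integers $\mathfrak o$, residual degree $q$, normalized valuation $\mathrm{val}$ and absolute value $|x|=q^{-\mathrm{val}(x)}$. Let $G=\mathrm{GL}_n(F)$, $K=\mathrm{GL}_n(\mathfrak o)$, let $B\subset G$ be the upper triangular Borel subgroup with modular character $\delta$, and $N\subset B$ the upper triangular unipotent subgroup. Let $\psi$ be a continuous unitary character of $F$ with conductor $\mathfrak o$, viewed as a character of $N$ through the sum of the $(j,j+1)$-entries. A Whittaker measure is a Radon measure on $N\backslash G$ valued in the line bundle $\mathcal L_\psi$ whose sections are the functions $\Phi$ with $\Phi(ug)=\psi(u)\Phi(g)$ for $u\in N$, that is, a continuous linear functional on compactly supported continuous sections of the dual bundle $\mathcal L_{\psi^{-1}}$. Every Schwartz measure $\Phi$ on $\mathrm{Mat}_n(F)$ (a locally constant, compactly supported function times an additive Haar measure) has a twisted push-forward, the Whittaker measure $f\mapsto\int_G f\,\Phi$. Fix a Haar measure $dg$ on $G$. For $z\in(\mathbb C^\times)^n$ let $\chi$ be the unramified character $\chi(b)=\prod_j z_j^{\mathrm{val}(b_{jj})}$ of $B$, $\check\chi=\mathrm{diag}(z_1,\dots,z_n)$,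 $\pi_\chi$ the principal series obtained from $\chi$ by normalized induction, $v_\chi$ its unramified vector, $v_\chi(bk)=\chi(b)\delta(b)^{1/2}$ for $b\in B,k\in K$, and $L(\pi_\chi,\mathrm{Std},s)=\det(1-q^{-s}\check\chi)^{-1}$. The Satake transform of a compactly supported $K$-bi-invariant function $h$ on $G$ is the function $\check\chi\mapsto\check h(\check\chi)$ with $\int_G h(g)\,\pi_\chi(g)v_\chi\,dg=\check h(\check\chi)\,v_\chi$. (1) For every $i\ge 0$ there is a unique $h_{\mathrm{Sym}^i}$ in the unramified Hecke algebra $\mathcal H(G,K)$ whose Satake transform is the trace of the $i$-th symmetric power of the standard representation of $\mathrm{GL}_n(\mathbb C)$. (2) Let $\varphi_0$ be the product of any Haar ($G$-invariant) measure on $N\backslash G$ with the Whittaker function that equals $1$ on $K$ and vanishes off $NK$. Then for a suitable choice of additive Haar measure on $\mathrm{Mat}_n(F)$, the twisted push-forward $\varphi$ of the product of this Haar measure with the characteristic function of $\mathrm{Mat}_n(\mathfrak o)$ is a $K$-invariant Whittaker measure such that, for every $i\ge 0$, the restriction of $\varphi$ to $\{g:\mathrm{val}(\det g)=i\}$ equals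 $$q^{-i\cdot\frac{n+1}{2}}\;h_{\mathrm{Sym}^i}\star\varphi_0,\qquad (h\star\varphi)(x)=\int_G h(g)\,\varphi(xg^{-1})\,dg,$$ and, for every $i<0$, the restriction of $\varphi$ to $\{g:\mathrm{val}(\det g)=i\}$ is zero. (3) (Godement--Jacquet.) Let $M_\chi(g)=\mathrm{vol}(K)^{-1}\int_K v_\chi(kg)\,v_{\chi^{-1}}(k)\,dk$ be the unramified matrix coefficient of $\pi_\chi$, with $M_\chi(1)=1$, and let $\rho$ be any additive Haar measure on $\mathrm{Mat}_n(F)$. For all $z\in(\mathbb C^\times)^n$ and $s\in\mathbb C$ with $|z_j|\,q^{-(\mathrm{Re}\,s+\frac{n+1}{2})}<1$ for all $j$, the zeta integral below converges absolutely and $$\int_{G\cap \mathrm{Mat}_n(\mathfrak o)} M_\chi(g)\,|\det g|^s\,d\rho(g)=\rho(K)\cdot L\!\left(\pi_\chi,\mathrm{Std},s+\tfrac{n+1}{2}\right).$$ -/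

import Mathlib

open MeasureTheory ValuativeRel
open scoped Pointwise

set_option linter.unusedSectionVars false

namespace WhittakerStd

noncomputable section

/-! ### The local field -/

section Field

variable (F : Type*) [Field F] [ValuativeRel F] [TopologicalSpace F]
  [IsNonarchimedeanLocalField F]

/-- The residual degree `q`. -/
def resCard : ℕ := Nat.card 𝓀[F]

variable {F}

/-- The normalized additive valuation, with the junk value `val 0 = 0`. -/
def val (x : F) : ℤ :=
  -WithZero.log (IsNonarchimedeanLocalField.valueGroupWithZeroIsoInt F (valuation F x))

open Classical in
/-- The normalized absolute value `|x| = q ^ (-val x)`, with `|0| = 0`. -/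
def absF (x : F) : ℝ := if x = 0 then 0 else (resCard F : ℝ) ^ (-val x)

/-- The conductor of the additive character `ψ` is the ring of integers. -/
def HasIntegralConductor (ψ : AddChar F Circle) : Prop :=
  ∀ x : F, (∀ y ∈ 𝒪[F], ψ (x * y) = 1) ↔ x ∈ 𝒪[F]

lemma val_mul {x y : F} (hx : x ≠ 0) (hy : y ≠ 0) : val (x * y) = val x + val y := by
  unfold val
  rw [map_mul, map_mul, WithZero.log_mul]
  · ring
  · simpa using hx
  · simpa using hy

lemma val_eq_zero {x y : F} (hx : x ∈ 𝒪[F]) (hy : y ∈ 𝒪[F]) (hxy : x * y = 1) : val x = 0 := by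
  have h1 : valuation F x ≤ 1 := hx
  have h2 : valuation F y ≤ 1 := hy
  have h3 : valuation F x * valuation F y = 1 := by rw [← map_mul, hxy, map_one]
  have h4 : valuation F x = 1 := by
    refine le_antisymm h1 ?_
    rw [← h3]
    exact mul_le_of_le_one_right' h2
  unfold val
  rw [h4, map_one, WithZero.log_one, neg_zero]

variable (F) in
lemma isOpen_integers : IsOpen {x : F | x ∈ 𝒪[F]} := by
  rw [isOpen_iff_mem_nhds]
  intro x hx
  refine (IsValuativeTopology.mem_nhds_iff').2 ⟨1, fun z hz => ?_⟩
  have hz' : z - x ∈ 𝒪[F] := le_of_lt (by simpa using hz : valuation F (z - x) < 1)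
  have := add_mem hz' hx
  simpa using this

variable (F) in
lemma isOpen_ne_zero : IsOpen {x : F | x ≠ 0} := by
  rw [isOpen_iff_mem_nhds]
  intro x hx
  have h := (valuation F).locally_const (x := x) (by simpa using hx)
  filter_upwards [h] with y hy h0
  change valuation F y = valuation F x at hy
  rw [h0, map_zero] at hy
  exact hx (by simpa using hy.symm)

end Field

/-! ### The groups -/

section Groups

variable (F : Type*) [Field F] [ValuativeRel F] [TopologicalSpace F]
  [IsNonarchimedeanLocalField F] (n : ℕ)

/-- `Mat_n(F)`. -/
abbrev Mat := Matrix (Fin n) (Fin n) F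

/-- `G = GL_n(F)`. -/
abbrev G := GL (Fin n) F

instance : MeasurableSpace (Mat F n) := borel _

instance : BorelSpace (Mat F n) := ⟨rfl⟩

/-- `K = GL_n(𝒪)`. -/
def K : Subgroup (G F n) where
  carrier := {g | (∀ i j, g.val i j ∈ 𝒪[F]) ∧ ∀ i j, g⁻¹.val i j ∈ 𝒪[F]}
  mul_mem' := by
    rintro a b ⟨ha, ha'⟩ ⟨hb, hb'⟩
    refine ⟨fun i j => ?_, fun i j => ?_⟩
    · rw [Units.val_mul, Matrix.mul_apply]
      exact sum_mem fun k _ => mul_mem (ha i k) (hb k j)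
    · rw [mul_inv_rev, Units.val_mul, Matrix.mul_apply]
      exact sum_mem fun k _ => mul_mem (hb' i k) (ha' k j)
  one_mem' := by
    have h : ∀ i j, (1 : Mat F n) i j ∈ 𝒪[F] := by
      intro i j
      rw [Matrix.one_apply]
      split_ifs
      exacts [one_mem _, zero_mem _]
    exact ⟨by simpa using h, by simpa using h⟩
  inv_mem' := by
    rintro a ⟨ha, ha'⟩
    exact ⟨ha', by simpa using ha⟩

variable {F n} in
/-- Upper triangular matrices. -/
def IsUpper (b : Mat F n) : Prop := ∀ i j, j < i → b i j = 0

variable {F n} in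
lemma IsUpper.mul_diag {a b : Mat F n} (ha : IsUpper a) (hb : IsUpper b) (i : Fin n) :
    (a * b) i i = a i i * b i i := by
  rw [Matrix.mul_apply, Finset.sum_eq_single i]
  · intro k _ hk
    rcases lt_or_gt_of_ne hk with h | h
    · rw [ha i k h, zero_mul]
    · rw [hb k i h, mul_zero]
  · simp

variable {F n} in
lemma IsUpper.mul {a b : Mat F n} (ha : IsUpper a) (hb : IsUpper b) : IsUpper (a * b) := by
  intro i j hij
  rw [Matrix.mul_apply]
  refine Finset.sum_eq_zero fun k _ => ?_
  rcases lt_or_ge k i with h | h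
  · rw [ha i k h, zero_mul]
  · rw [hb k j (hij.trans_le h), mul_zero]

variable {F n} in
lemma IsUpper.inv {b : G F n} (hb : IsUpper b.val) : IsUpper b⁻¹.val := by
  have : Invertible b.val := b.invertible
  have h := Matrix.blockTriangular_inv_of_blockTriangular (M := b.val) (b := id)
    (fun i j hij => hb i j hij)
  intro i j hij
  rw [Matrix.coe_units_inv]
  exact h hij

/-- `N`, the upper triangular unipotent matrices. -/
def N : Subgroup (G F n) where
  carrier := {u | IsUpper u.val ∧ ∀ i, u.val i i = 1}
  mul_mem' := by
    rintro a b ⟨ha, ha'⟩ ⟨hb, hb'⟩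
    refine ⟨ha.mul hb, fun i => ?_⟩
    rw [Units.val_mul, ha.mul_diag hb, ha', hb', one_mul]
  one_mem' := ⟨fun i j hij => by simp [hij.ne'], fun i => by simp⟩
  inv_mem' := by
    rintro a ⟨ha, ha'⟩
    refine ⟨ha.inv, fun i => ?_⟩
    have h := ha.mul_diag ha.inv i
    rw [← Units.val_mul, mul_inv_cancel, ha', one_mul] at h
    simpa using h.symm

/-- The quotient `N \ G`, with the quotient topology and its Borel sets. -/
def NQuot : Type _ := Quotient (QuotientGroup.rightRel (N F n))

instance : TopologicalSpace (NQuot F n) :=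
  inferInstanceAs (TopologicalSpace (Quotient (QuotientGroup.rightRel (N F n))))

instance : MeasurableSpace (NQuot F n) := borel _

instance : BorelSpace (NQuot F n) := ⟨rfl⟩

variable {F n}

/-- The class `N g`. -/
def NQuot.mk (g : G F n) : NQuot F n := Quotient.mk (QuotientGroup.rightRel (N F n)) g

/-- The right action of `g` on `N \ G`: `N x ↦ N x g`. -/
def NQuot.translate (g : G F n) : NQuot F n → NQuot F n :=
  Quotient.map (· * g) fun a b h => by
    have h' : b * a⁻¹ ∈ N F n := QuotientGroup.rightRel_apply.1 h
    exact QuotientGroup.rightRel_apply.2 (by simpa [mul_assoc] using h')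

/-- The measure `ν` on `N \ G` is nonzero and invariant under the right action of `G`. -/
def IsInvariantQuot (ν : Measure (NQuot F n)) : Prop :=
  ν ≠ 0 ∧ ∀ g : G F n, ν.map (NQuot.translate g) = ν

/-- `val (det g)`. -/
def valDet (g : G F n) : ℤ := val g.val.det

lemma det_ne_zero (g : G F n) : g.val.det ≠ 0 :=
  ((Matrix.isUnit_iff_isUnit_det g.val).1 g.isUnit).ne_zero

lemma valDet_mul (g h : G F n) : valDet (g * h) = valDet g + valDet h := by
  unfold valDet
  rw [Units.val_mul, Matrix.det_mul, val_mul (det_ne_zero g) (det_ne_zero h)]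

lemma det_mem_integers {X : Mat F n} (hX : ∀ i j, X i j ∈ 𝒪[F]) : X.det ∈ 𝒪[F] := by
  rw [Matrix.det_apply]
  refine sum_mem fun σ _ => ?_
  have h : ∏ i, X (σ i) i ∈ 𝒪[F] := prod_mem fun i _ => hX _ _
  rcases Int.units_eq_one_or (Equiv.Perm.sign σ) with h1 | h1 <;> rw [h1]
  · simpa using h
  · simpa using h

lemma valDet_of_mem_K {k : G F n} (hk : k ∈ K F n) : valDet k = 0 := by
  refine val_eq_zero (det_mem_integers hk.1) (det_mem_integers hk.2) ?_
  rw [← Matrix.det_mul, ← Units.val_mul, mul_inv_cancel, Units.val_one, Matrix.det_one]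

lemma valDet_of_mem_N {u : G F n} (hu : u ∈ N F n) : valDet u = 0 := by
  have h : u.val.det = 1 := by
    rw [Matrix.det_of_isUpperTriangular (fun i j hij => hu.1 i j hij)]
    simp [hu.2]
  unfold valDet
  rw [h]
  exact val_eq_zero (one_mem _) (one_mem _) (one_mul 1)

variable (F n) in
lemma isOpen_K : IsOpen (K F n : Set (G F n)) := by
  have h : (K F n : Set (G F n)) =
      (⋂ i, ⋂ j, {g : G F n | g.val i j ∈ 𝒪[F]}) ∩ ⋂ i, ⋂ j, {g : G F n | g⁻¹.val i j ∈ 𝒪[F]} := by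
    ext g
    simp [K]
  rw [h]
  refine IsOpen.inter ?_ ?_ <;>
    refine isOpen_iInter_of_finite fun i => isOpen_iInter_of_finite fun j => ?_
  · exact (isOpen_integers F).preimage (Units.continuous_val.matrix_elem i j)
  · exact (isOpen_integers F).preimage
      ((Units.continuous_val.comp continuous_inv).matrix_elem i j)

/-- A right `K`-invariant function on `G` is continuous. -/
lemma continuous_of_K_invariant {Y : Type*} [TopologicalSpace Y] {f : G F n → Y}
    (hf : ∀ g, ∀ k ∈ K F n, f (g * k) = f g) : Continuous f := by
  refine IsLocallyConstant.continuous ((IsLocallyConstant.iff_exists_open f).2 fun g => ?_)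
  refine ⟨(g * ·) '' (K F n : Set (G F n)), (isOpenMap_mul_left g) _ (isOpen_K F n),
    ⟨1, one_mem _, mul_one g⟩, ?_⟩
  rintro _ ⟨k, hk, rfl⟩
  exact hf g k hk

variable (F n) in
lemma isOpenEmbedding_val : Topology.IsOpenEmbedding (Units.val : G F n → Mat F n) := by
  refine ⟨Units.isEmbedding_val_mk' (M := Mat F n) (f := fun X => X⁻¹) ?_
    fun u => (Matrix.coe_units_inv u).symm, ?_⟩
  · have h : ∀ X : Mat F n, X⁻¹ = (X.det)⁻¹ • X.adjugate := fun X => by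
      rw [Matrix.inv_def, Ring.inverse_eq_inv']
    rw [funext h]
    have h1 : ContinuousOn (fun X : Mat F n => X.det) {X | IsUnit X} :=
      (continuous_id (X := Mat F n)).matrix_det.continuousOn
    have h2 : ContinuousOn (fun X : Mat F n => X.adjugate) {X | IsUnit X} :=
      (continuous_id (X := Mat F n)).matrix_adjugate.continuousOn
    exact (h1.inv₀ fun X hX => ((Matrix.isUnit_iff_isUnit_det X).1 hX).ne_zero).smul h2
  · have h : Set.range (Units.val : G F n → Mat F n) = Matrix.det ⁻¹' {x : F | x ≠ 0} := by
      ext X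
      change IsUnit X ↔ _
      rw [Matrix.isUnit_iff_isUnit_det, isUnit_iff_ne_zero]
      rfl
    rw [h]
    exact (isOpen_ne_zero F).preimage (continuous_id (X := Mat F n)).matrix_det

instance : BorelSpace (G F n) where
  measurable_eq := by
    change MeasurableSpace.comap Units.val (borel (Mat F n)) = _
    rw [← borel_comap, (isOpenEmbedding_val F n).isInducing.eq_induced]

end Groups

/-! ### Whittaker measures -/

section Whittaker

variable {F : Type*} [Field F] [ValuativeRel F] [TopologicalSpace F]
  [IsNonarchimedeanLocalField F] {n : ℕ}

/-- The sum of the entries just above the diagonal. -/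
def superdiagSum (X : Mat F n) : F := ∑ i : Fin n, ∑ j : Fin n, if (i : ℕ) + 1 = (j : ℕ) then X i j else 0

/-- The character `ψ` of `N`: `ψ` of the sum of the `(i, i+1)`-entries (on all of `Mat_n`, as a
function; it is only used on `N`). -/
def psiN (ψ : AddChar F Circle) (X : Mat F n) : ℂ := ψ (superdiagSum X)

lemma superdiagSum_mul {u v : G F n} (hu : u ∈ N F n) (hv : v ∈ N F n) :
    superdiagSum (u * v).val = superdiagSum u.val + superdiagSum v.val := by
  unfold superdiagSum
  rw [← Finset.sum_add_distrib]
  refine Finset.sum_congr rfl fun i _ => ?_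
  rw [← Finset.sum_add_distrib]
  refine Finset.sum_congr rfl fun j _ => ?_
  split_ifs with h
  · have hij : i ≠ j := by
      rintro rfl
      omega
    rw [Units.val_mul, Matrix.mul_apply, Fintype.sum_eq_add i j hij]
    · rw [hu.2, hv.2, one_mul, mul_one, add_comm]
    · rintro k ⟨hki, hkj⟩
      rcases lt_or_gt_of_ne hki with h1 | h1
      · rw [hu.1 i k h1, zero_mul]
      · have h2 : j < k := by
          have h3 : (k : ℕ) ≠ j := fun h => hkj (Fin.ext h)
          have h4 : (i : ℕ) < k := h1
          exact Fin.lt_def.2 (by omega)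
        rw [hv.1 k j h2, mul_zero]
  · simp

lemma psiN_mul (ψ : AddChar F Circle) {u v : G F n} (hu : u ∈ N F n) (hv : v ∈ N F n) :
    psiN ψ (u * v).val = psiN ψ u.val * psiN ψ v.val := by
  unfold psiN
  rw [superdiagSum_mul hu hv, AddChar.map_add_eq_mul, Circle.coe_mul]

lemma norm_psiN (ψ : AddChar F Circle) (X : Mat F n) : ‖psiN ψ X‖ = 1 := Circle.norm_coe _

lemma psiN_ne_zero (ψ : AddChar F Circle) (X : Mat F n) : psiN ψ X ≠ 0 := Circle.coe_ne_zero _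

lemma psiN_of_integral {ψ : AddChar F Circle} (hψ : HasIntegralConductor ψ) {X : Mat F n}
    (hX : ∀ i j, X i j ∈ 𝒪[F]) : psiN ψ X = 1 := by
  have h : superdiagSum X ∈ 𝒪[F] := by
    refine sum_mem fun i _ => sum_mem fun j _ => ?_
    split_ifs
    exacts [hX i j, zero_mem _]
  have h1 := (hψ _).2 h 1 (one_mem _)
  rw [mul_one] at h1
  unfold psiN
  rw [h1, Circle.coe_one]

/-- The function `f` on `G` is supported in `N C`. -/
def SupportedMod (C : Set (G F n)) (f : G F n → ℂ) : Prop :=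
  ∀ g, f g ≠ 0 → ∃ u ∈ N F n, ∃ c ∈ C, g = u * c

lemma SupportedMod.mono {C D : Set (G F n)} (h : C ⊆ D) {f : G F n → ℂ} (hf : SupportedMod C f) :
    SupportedMod D f := by
  intro g hg
  obtain ⟨u, hu, c, hc, rfl⟩ := hf g hg
  exact ⟨u, hu, c, h hc, rfl⟩

/-- The continuous sections, compactly supported on `N \ G`, of the line bundle `𝓛_{ψ⁻¹}`, the
dual of `𝓛_ψ`: continuous functions `f` on `G` with `f (u g) = ψ(u)⁻¹ f(g)` for `u ∈ N`, whose
support is compact modulo `N`. -/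
def Sec (ψ : AddChar F Circle) (n : ℕ) : Submodule ℂ (G F n → ℂ) where
  carrier := {f | Continuous f ∧ (∀ u ∈ N F n, ∀ g, f (u * g) = (psiN ψ u.val)⁻¹ * f g) ∧
    ∃ C, IsCompact C ∧ SupportedMod C f}
  add_mem' := by
    rintro f g ⟨hf, hf', C, hC, hfC⟩ ⟨hg, hg', D, hD, hgD⟩
    refine ⟨hf.add hg, fun u hu x => ?_, C ∪ D, hC.union hD, fun x hx => ?_⟩
    · simp only [Pi.add_apply, hf' u hu, hg' u hu, mul_add]
    · by_cases h : f x = 0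
      · exact hgD.mono Set.subset_union_right x (by simpa [h] using hx)
      · exact hfC.mono Set.subset_union_left x h
  zero_mem' := ⟨continuous_const, by simp, ∅, isCompact_empty, fun x hx => absurd rfl hx⟩
  smul_mem' := by
    rintro c f ⟨hf, hf', C, hC, hfC⟩
    refine ⟨hf.const_smul c, fun u hu x => ?_, C, hC, fun x hx => hfC x fun h => ?_⟩
    · simp only [Pi.smul_apply, hf' u hu, smul_eq_mul]
      ring
    · exact hx (by simp [h])

variable {ψ : AddChar F Circle}

lemma Sec.bounded (f : Sec ψ n) : ∃ B, 0 ≤ B ∧ ∀ g, ‖f.1 g‖ ≤ B := by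
  obtain ⟨f, hf, hf', C, hC, hfC⟩ := f
  obtain ⟨B, hB⟩ := hC.exists_bound_of_continuousOn hf.continuousOn
  refine ⟨max B 0, le_max_right _ _, fun g => ?_⟩
  by_cases h : f g = 0
  · simp [h]
  · obtain ⟨u, hu, c, hc, rfl⟩ := hfC g h
    change ‖f (u * c)‖ ≤ _
    rw [hf' u hu, norm_mul, norm_inv, norm_psiN, inv_one, one_mul]
    exact (hB c hc).trans (le_max_left _ _)

lemma SupportedMod.translate {C : Set (G F n)} {f : G F n → ℂ} (hf : SupportedMod C f)
    {D : Set (G F n)} {g : G F n} (hg : g ∈ D) : SupportedMod (C * D⁻¹) fun x => f (x * g) := by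
  intro x hx
  obtain ⟨u, hu, c, hc, h⟩ := hf _ hx
  exact ⟨u, hu, c * g⁻¹, Set.mul_mem_mul hc (Set.inv_mem_inv.2 hg),
    by rw [← mul_assoc, ← h, mul_inv_cancel_right]⟩

/-- Right translation of sections: `x ↦ f (x g)`. -/
def Sec.translate (g : G F n) : Sec ψ n →ₗ[ℂ] Sec ψ n where
  toFun f := ⟨fun x => f.1 (x * g), f.2.1.comp (continuous_mul_const g),
    fun u hu x => by
      change f.1 (u * x * g) = _
      rw [mul_assoc, f.2.2.1 u hu], by
      obtain ⟨C, hC, hfC⟩ := f.2.2.2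
      exact ⟨C * {g}⁻¹, hC.mul isCompact_singleton.inv, hfC.translate rfl⟩⟩
  map_add' _ _ := rfl
  map_smul' _ _ := rfl

/-- Multiplication of sections by the characteristic function of `{g | val (det g) = i}`. -/
def Sec.cut (i : ℤ) : Sec ψ n →ₗ[ℂ] Sec ψ n where
  toFun f := ⟨fun x => if valDet x = i then f.1 x else 0, by
      have h : Continuous fun x : G F n => if valDet x = i then (1 : ℂ) else 0 :=
        continuous_of_K_invariant fun g k hk => by
          rw [valDet_mul, valDet_of_mem_K hk, add_zero]
      refine (h.mul f.2.1).congr fun x => ?_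
      change (if _ then (1 : ℂ) else 0) * f.1 x = if _ then f.1 x else 0
      split_ifs <;> simp,
    fun u hu x => by
      change (if valDet (u * x) = i then f.1 (u * x) else 0) =
        (psiN ψ u.val)⁻¹ * if valDet x = i then f.1 x else 0
      rw [valDet_mul, valDet_of_mem_N hu, zero_add, f.2.2.1 u hu]
      split_ifs <;> simp, by
      obtain ⟨C, hC, hfC⟩ := f.2.2.2
      exact ⟨C, hC, fun x hx => hfC x fun h => hx (by simp [h])⟩⟩
  map_add' f g := by
    ext x
    change (if _ then f.1 x + g.1 x else 0) = (if _ then f.1 x else 0) + if _ then g.1 x else 0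
    split_ifs <;> simp
  map_smul' c f := by
    ext x
    change (if _ then c * f.1 x else 0) = c * if _ then f.1 x else 0
    split_ifs <;> simp

/-- The space `𝓜(N,ψ \ G)` of Whittaker measures, i.e. (Radon) measures on `N \ G` valued in
`𝓛_ψ`: linear functionals on the compactly supported continuous sections of the dual line bundle
which, on the sections supported in a given compact set, are bounded for the supremum norm. -/
def WMeas (ψ : AddChar F Circle) (n : ℕ) : Submodule ℂ (Sec ψ n →ₗ[ℂ] ℂ) where
  carrier := {φ | ∀ C : Set (G F n), IsCompact C → ∃ M : ℝ, ∀ f : Sec ψ n, SupportedMod C f.1 →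
    ∀ B : ℝ, 0 ≤ B → (∀ g, ‖f.1 g‖ ≤ B) → ‖φ f‖ ≤ M * B}
  add_mem' := by
    intro φ φ' h h' C hC
    obtain ⟨M, hM⟩ := h C hC
    obtain ⟨M', hM'⟩ := h' C hC
    refine ⟨M + M', fun f hf B hB0 hB => ?_⟩
    rw [add_mul]
    exact (norm_add_le _ _).trans (add_le_add (hM f hf B hB0 hB) (hM' f hf B hB0 hB))
  zero_mem' := fun C _ => ⟨0, fun f _ B _ _ => by simp⟩
  smul_mem' := by
    intro c φ h C hC
    obtain ⟨M, hM⟩ := h C hC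
    refine ⟨‖c‖ * M, fun f hf B hB0 hB => ?_⟩
    rw [LinearMap.smul_apply, norm_smul, mul_assoc]
    exact mul_le_mul_of_nonneg_left (hM f hf B hB0 hB) (norm_nonneg c)

/-- Right translation of Whittaker measures: formally `φ(x g⁻¹)`, the push-forward of `φ` under
`x ↦ x g`. -/
def WMeas.translate (g : G F n) (φ : WMeas ψ n) : WMeas ψ n :=
  ⟨φ.1 ∘ₗ Sec.translate g, fun C hC => by
    obtain ⟨M, hM⟩ := φ.2 (C * {g}⁻¹) (hC.mul isCompact_singleton.inv)
    exact ⟨M, fun f hf B hB0 hB => hM (Sec.translate g f) (hf.translate (Set.mem_singleton g)) B hB0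
      fun x => hB _⟩⟩

/-- The restriction of a Whittaker measure to the open and closed set `{g | val (det g) = i}`
(viewed again as a measure on all of `N \ G`). -/
def WMeas.restrict (i : ℤ) (φ : WMeas ψ n) : WMeas ψ n :=
  ⟨φ.1 ∘ₗ Sec.cut i, fun C hC => by
    obtain ⟨M, hM⟩ := φ.2 C hC
    refine ⟨M, fun f hf B hB0 hB => hM _ (fun x hx => hf x fun h => hx ?_) B hB0 fun x => ?_⟩
    · change (if _ then f.1 x else 0) = 0
      simp [h]
    · change ‖if _ then f.1 x else 0‖ ≤ B
      split_ifs
      exacts [hB x, by simpa using hB0]⟩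

/-! ### The Hecke algebra and its action -/

variable (F n) in
/-- The unramified Hecke algebra `𝓗(G, K)`, as a space of functions: compactly supported
`K`-bi-invariant functions on `G`. -/
def Hecke : Submodule ℂ (G F n → ℂ) where
  carrier := {h | (∀ g, ∀ k ∈ K F n, ∀ k' ∈ K F n, h (k * g * k') = h g) ∧ HasCompactSupport h}
  add_mem' := by
    rintro a b ⟨ha, ha'⟩ ⟨hb, hb'⟩
    exact ⟨fun g k hk k' hk' => by simp [ha g k hk k' hk', hb g k hk k' hk'], ha'.add hb'⟩
  zero_mem' := ⟨fun _ _ _ _ _ => rfl, HasCompactSupport.zero⟩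
  smul_mem' := by
    rintro c a ⟨ha, ha'⟩
    exact ⟨fun g k hk k' hk' => by simp [ha g k hk k' hk'], ha'.smul_left (f := fun _ => c)⟩

lemma Hecke.continuous (h : Hecke F n) : Continuous h.1 :=
  continuous_of_K_invariant fun g k hk => by simpa using h.2.1 g 1 (one_mem _) k hk

lemma continuous_translate (φ : WMeas ψ n) (f : Sec ψ n) :
    Continuous fun g : G F n => φ.1 (Sec.translate g f) := by
  have : LocallyCompactSpace (Mat F n) := inferInstanceAs (LocallyCompactSpace (Fin n → Fin n → F))
  have : LocallyCompactSpace (G F n) := (isOpenEmbedding_val F n).locallyCompactSpace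
  rw [continuous_iff_continuousAt]
  intro g₀
  obtain ⟨V, hV, hVg⟩ := exists_compact_mem_nhds g₀
  obtain ⟨C, hC, hfC⟩ := f.2.2.2
  obtain ⟨M, hM⟩ := φ.2 (C * V⁻¹) (hC.mul hV.inv)
  have hg₀ : g₀ ∈ V := mem_of_mem_nhds hVg
  rw [ContinuousAt, Metric.tendsto_nhds]
  intro ε hε
  obtain ⟨δ, hδ, hδε⟩ : ∃ δ : ℝ, 0 < δ ∧ M * δ < ε := by
    refine ⟨ε / (2 * (|M| + 1)), by positivity, ?_⟩
    have h1 : M * (ε / (2 * (|M| + 1))) ≤ (|M| + 1) * (ε / (2 * (|M| + 1))) :=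
      mul_le_mul_of_nonneg_right ((le_abs_self M).trans (by linarith)) (by positivity)
    have h2 : (|M| + 1) * (ε / (2 * (|M| + 1))) = ε / 2 := by
      field_simp
    linarith
  have key : ∀ᶠ g in nhds g₀, ∀ x ∈ C * V⁻¹, ‖f.1 (x * g) - f.1 (x * g₀)‖ < δ := by
    refine (hC.mul hV.inv).eventually_forall_of_forall_eventually fun x _ => ?_
    have hc : Continuous fun z : G F n × G F n => ‖f.1 (z.2 * z.1) - f.1 (z.2 * g₀)‖ :=
      ((f.2.1.comp (continuous_snd.mul continuous_fst)).sub
        (f.2.1.comp (continuous_snd.mul continuous_const))).norm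
    have h0 := hc.tendsto (g₀, x)
    simp only [sub_self, norm_zero] at h0
    exact h0.eventually (gt_mem_nhds hδ)
  filter_upwards [key, hVg] with g hg hgV
  rw [dist_eq_norm, ← map_sub]
  refine lt_of_le_of_lt (hM _ ?_ δ hδ.le ?_) hδε
  · intro x hx
    change f.1 (x * g) - f.1 (x * g₀) ≠ 0 at hx
    by_cases h : f.1 (x * g) = 0
    · exact hfC.translate hg₀ x fun h' => hx (by simp [h, h'])
    · exact hfC.translate hgV x h
  · intro x
    change ‖f.1 (x * g) - f.1 (x * g₀)‖ ≤ δ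
    by_cases hx : f.1 (x * g) - f.1 (x * g₀) = 0
    · rw [hx, norm_zero]
      exact hδ.le
    · obtain ⟨u, hu, c, hc, rfl⟩ : ∃ u ∈ N F n, ∃ c ∈ C * V⁻¹, x = u * c := by
        by_cases h : f.1 (x * g) = 0
        · exact hfC.translate hg₀ x fun h' => hx (by simp [h, h'])
        · exact hfC.translate hgV x h
      rw [mul_assoc, mul_assoc, f.2.2.1 u hu, f.2.2.1 u hu, ← mul_sub, norm_mul, norm_inv,
        norm_psiN, inv_one, one_mul]
      exact (hg c hc).le

lemma integrable_conv (μ : Measure (G F n)) [μ.IsHaarMeasure] (h : Hecke F n) (φ : WMeas ψ n)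
    (f : Sec ψ n) : Integrable (fun g => h.1 g * (WMeas.translate g φ).1 f) μ :=
  ((Hecke.continuous h).mul (continuous_translate φ f)).integrable_of_hasCompactSupport
    h.2.2.mul_right

/-- The convolution `h ⋆ φ (x) = ∫ h(g) φ(x g⁻¹) dg` of a Whittaker measure with an element of the
Hecke algebra, with respect to the Haar measure `μ` on `G`. -/
def WMeas.conv (μ : Measure (G F n)) [μ.IsHaarMeasure] (h : Hecke F n) (φ : WMeas ψ n) :
    WMeas ψ n :=
  ⟨{  toFun := fun f => ∫ g, h.1 g * (WMeas.translate g φ).1 f ∂μ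
      map_add' := fun f f' => by
        rw [← integral_add (integrable_conv μ h φ f) (integrable_conv μ h φ f')]
        simp only [map_add, mul_add]
      map_smul' := fun c f => by
        rw [RingHom.id_apply, smul_eq_mul, ← integral_const_mul]
        simp only [map_smul, smul_eq_mul]
        congr 1
        ext g
        ring }, fun C hC => by
      obtain ⟨M, hM⟩ := φ.2 (C * (tsupport h.1)⁻¹) (hC.mul h.2.2.isCompact.inv)
      have hh : Integrable h.1 μ :=
        (Hecke.continuous h).integrable_of_hasCompactSupport h.2.2
      refine ⟨(∫ g, ‖h.1 g‖ ∂μ) * M, fun f hf B hB0 hB => ?_⟩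
      have h1 : ∀ g, ‖h.1 g * (WMeas.translate g φ).1 f‖ ≤ ‖h.1 g‖ * (M * B) := fun g => by
        rw [norm_mul]
        by_cases hg : h.1 g = 0
        · simp [hg]
        · exact mul_le_mul_of_nonneg_left
            (hM _ (hf.translate (subset_tsupport _ hg)) B hB0 fun x => hB _) (norm_nonneg _)
      calc ‖∫ g, h.1 g * (WMeas.translate g φ).1 f ∂μ‖
          ≤ ∫ g, ‖h.1 g‖ * (M * B) ∂μ :=
            norm_integral_le_of_norm_le (hh.norm.mul_const _) (Filter.Eventually.of_forall h1)
        _ = (∫ g, ‖h.1 g‖ ∂μ) * M * B := by rw [integral_mul_const, mul_assoc]⟩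

/-! ### Push-forward of Schwartz measures on `Mat_n` -/

variable (F n) in
/-- `𝓕(Mat_n)`: locally constant, compactly supported functions. For an additive Haar measure `ρ`,
the Schwartz measures on `Mat_n` are the measures `Φ ρ` with `Φ` in this space. -/
def Schwartz : Submodule ℂ (Mat F n → ℂ) where
  carrier := {Φ | IsLocallyConstant Φ ∧ HasCompactSupport Φ}
  add_mem' := fun ⟨ha, ha'⟩ ⟨hb, hb'⟩ => ⟨ha.add hb, ha'.add hb'⟩
  zero_mem' := ⟨IsLocallyConstant.const 0, HasCompactSupport.zero⟩
  smul_mem' := fun c _ ⟨ha, ha'⟩ => ⟨ha.comp (c • ·), ha'.smul_left (f := fun _ => c)⟩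

variable (F n) in
lemma isCompact_integral : IsCompact {X : Mat F n | ∀ i j, X i j ∈ 𝒪[F]} := by
  have h : IsCompact {x : F | x ∈ 𝒪[F]} :=
    IsNonarchimedeanLocalField.isCompact_closedBall F 1
  have h2 := isCompact_pi_infinite (ι := Fin n) (X := fun _ => Fin n → F)
    (s := fun _ => {y | ∀ j, y j ∈ 𝒪[F]})
    fun _ => isCompact_pi_infinite (ι := Fin n) (X := fun _ => F) fun _ => h
  exact h2

variable (F n) in
lemma isOpen_integral : IsOpen {X : Mat F n | ∀ i j, X i j ∈ 𝒪[F]} := by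
  simp only [Set.ofPred_forall]
  exact isOpen_iInter_of_finite fun i => isOpen_iInter_of_finite fun j =>
    (isOpen_integers F).preimage (continuous_id.matrix_elem i j)

variable (F n) in
lemma isClosed_integral : IsClosed {X : Mat F n | ∀ i j, X i j ∈ 𝒪[F]} := by
  have h : IsClosed {x : F | x ∈ 𝒪[F]} :=
    AddSubgroup.isClosed_of_isOpen (𝒪[F]).toAddSubgroup (isOpen_integers F)
  simp only [Set.ofPred_forall]
  exact isClosed_iInter fun i => isClosed_iInter fun j =>
    h.preimage (continuous_id.matrix_elem i j)

open Classical in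
variable (F n) in
/-- The characteristic function of `Mat_n(𝒪)`. -/
def charMat : Schwartz F n :=
  ⟨fun X => if ∀ i j, X i j ∈ 𝒪[F] then 1 else 0, by
    have hcl : IsClopen {X : Mat F n | ∀ i j, X i j ∈ 𝒪[F]} :=
      ⟨isClosed_integral F n, isOpen_integral F n⟩
    refine (IsLocallyConstant.iff_exists_open _).2 fun X => ?_
    by_cases hX : ∀ i j, X i j ∈ 𝒪[F]
    · exact ⟨_, hcl.2, hX, fun Y hY => by rw [if_pos hX]; exact if_pos hY⟩
    · exact ⟨_, hcl.compl.2, hX, fun Y hY => by rw [if_neg hX]; exact if_neg hY⟩, by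
    refine HasCompactSupport.intro (isCompact_integral F n) fun X hX => if_neg hX⟩

/-- The restriction to `G ⊆ Mat_n` of a measure on `Mat_n`. -/
def onG (ρ : Measure (Mat F n)) : Measure (G F n) := ρ.comap Units.val

lemma integrable_onG (ρ : Measure (Mat F n)) [ρ.IsAddHaarMeasure] (Φ : Schwartz F n) :
    Integrable (fun g : G F n => Φ.1 g.val) (onG ρ) :=
  ((isOpenEmbedding_val F n).measurableEmbedding.integrableOn_range_iff_comap).1
    (Φ.2.1.continuous.integrable_of_hasCompactSupport Φ.2.2).integrableOn

lemma integrable_onG_mul (ρ : Measure (Mat F n)) [ρ.IsAddHaarMeasure] (Φ : Schwartz F n)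
    (f : Sec ψ n) : Integrable (fun g : G F n => Φ.1 g.val * f.1 g) (onG ρ) := by
  obtain ⟨B, -, hB⟩ := Sec.bounded f
  exact (integrable_onG ρ Φ).mul_bdd (c := B) f.2.1.aestronglyMeasurable
    (Filter.Eventually.of_forall hB)

/-- The twisted push-forward `𝓢(Mat_n) → 𝓜(N,ψ \ G)`, dual to the pull-back of sections of the
dual line bundle: the measure `Φ ρ` is sent to the functional `f ↦ ∫_G f Φ ρ`. -/
def pushforward (ψ : AddChar F Circle) (ρ : Measure (Mat F n)) [ρ.IsAddHaarMeasure] :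
    Schwartz F n →ₗ[ℂ] WMeas ψ n where
  toFun := fun Φ => ⟨{
    toFun := fun f => ∫ g, Φ.1 g.val * f.1 g ∂(onG ρ)
    map_add' := fun f f' => by
      rw [← integral_add (integrable_onG_mul ρ Φ f) (integrable_onG_mul ρ Φ f')]
      simp only [Submodule.coe_add, Pi.add_apply, mul_add]
    map_smul' := fun c f => by
      rw [RingHom.id_apply, smul_eq_mul, ← integral_const_mul]
      congr 1
      ext g
      change Φ.1 g.val * (c * f.1 g) = c * (Φ.1 g.val * f.1 g)
      ring }, fun C _ => by
    refine ⟨∫ g, ‖Φ.1 g.val‖ ∂(onG ρ), fun f _ B _ hB => ?_⟩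
    calc ‖∫ g, Φ.1 g.val * f.1 g ∂(onG ρ)‖
        ≤ ∫ g, ‖Φ.1 g.val‖ * B ∂(onG ρ) := by
          refine norm_integral_le_of_norm_le ((integrable_onG ρ Φ).norm.mul_const _)
            (Filter.Eventually.of_forall fun g => ?_)
          rw [norm_mul]
          exact mul_le_mul_of_nonneg_left (hB g) (norm_nonneg _)
      _ = (∫ g, ‖Φ.1 g.val‖ ∂(onG ρ)) * B := by rw [integral_mul_const]⟩
  map_add' := fun Φ Φ' => by
    ext f
    change ∫ g, (Φ.1 g.val + Φ'.1 g.val) * f.1 g ∂(onG ρ) =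
      ∫ g, Φ.1 g.val * f.1 g ∂(onG ρ) + ∫ g, Φ'.1 g.val * f.1 g ∂(onG ρ)
    rw [← integral_add (integrable_onG_mul ρ Φ f) (integrable_onG_mul ρ Φ' f)]
    simp only [add_mul]
  map_smul' := fun c Φ => by
    ext f
    change ∫ g, c * Φ.1 g.val * f.1 g ∂(onG ρ) = c * ∫ g, Φ.1 g.val * f.1 g ∂(onG ρ)
    rw [← integral_const_mul]
    simp only [mul_assoc]

/-! ### The basic Whittaker measure -/

open Classical in
/-- The Whittaker function (`W (u g) = ψ(u) W(g)` for `u ∈ N`) which is `1` on `K` and zero off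
`N K`, i.e. `W (u k) = ψ(u)`. -/
def basicW (ψ : AddChar F Circle) (g : G F n) : ℂ :=
  if h : ∃ u, u ∈ N F n ∧ u⁻¹ * g ∈ K F n then psiN ψ h.choose.val else 0

lemma basicW_mul (hψ : HasIntegralConductor ψ) {u k : G F n} (hu : u ∈ N F n) (hk : k ∈ K F n) :
    basicW ψ (u * k) = psiN ψ u.val := by
  have h : ∃ v, v ∈ N F n ∧ v⁻¹ * (u * k) ∈ K F n := ⟨u, hu, by simpa using hk⟩
  unfold basicW
  rw [dif_pos h]
  obtain ⟨hv, hvk⟩ := h.choose_spec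
  set v := h.choose
  have hw : v⁻¹ * u ∈ K F n := by
    have := mul_mem hvk (inv_mem hk)
    simpa [mul_assoc] using this
  have h1 := psiN_mul ψ hv (mul_mem (inv_mem hv) hu)
  rw [mul_inv_cancel_left, psiN_of_integral hψ hw.1, mul_one] at h1
  exact h1.symm

lemma basicW_eq_zero {g : G F n} (hg : ¬ ∃ u ∈ N F n, u⁻¹ * g ∈ K F n) : basicW ψ g = 0 := by
  unfold basicW
  rw [dif_neg hg]

lemma basicW_equivariant (hψ : HasIntegralConductor ψ) {u : G F n} (hu : u ∈ N F n) (g : G F n) :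
    basicW ψ (u * g) = psiN ψ u.val * basicW ψ g := by
  by_cases h : ∃ v ∈ N F n, v⁻¹ * g ∈ K F n
  · obtain ⟨v, hv, hk⟩ := h
    have h1 : u * g = (u * v) * (v⁻¹ * g) := by group
    have h2 : g = v * (v⁻¹ * g) := by group
    rw [h1, basicW_mul hψ (mul_mem hu hv) hk, psiN_mul ψ hu hv]
    conv_rhs => rw [h2, basicW_mul hψ hv hk]
  · rw [basicW_eq_zero h, basicW_eq_zero, mul_zero]
    rintro ⟨v, hv, hk⟩
    exact h ⟨u⁻¹ * v, mul_mem (inv_mem hu) hv, by simpa [mul_assoc] using hk⟩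

lemma basicW_K (hψ : HasIntegralConductor ψ) (g : G F n) {k : G F n} (hk : k ∈ K F n) :
    basicW ψ (g * k) = basicW ψ g := by
  by_cases h : ∃ v ∈ N F n, v⁻¹ * g ∈ K F n
  · obtain ⟨v, hv, hg⟩ := h
    have h1 : g * k = v * (v⁻¹ * g * k) := by group
    have h2 : g = v * (v⁻¹ * g) := by group
    rw [h1, basicW_mul hψ hv (mul_mem hg hk)]
    conv_rhs => rw [h2, basicW_mul hψ hv hg]
  · rw [basicW_eq_zero h, basicW_eq_zero]
    rintro ⟨v, hv, hg⟩
    refine h ⟨v, hv, ?_⟩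
    have := mul_mem hg (inv_mem hk)
    simpa [mul_assoc] using this

lemma basicW_norm_le (g : G F n) : ‖basicW ψ g‖ ≤ 1 := by
  unfold basicW
  split_ifs
  · exact (norm_psiN ψ _).le
  · simp

/-- For a section `f` of `𝓛_{ψ⁻¹}`, the function `W f` on `N \ G`, with `W = basicW ψ`. -/
def basicWMul (hψ : HasIntegralConductor ψ) (f : Sec ψ n) : NQuot F n → ℂ :=
  Quotient.lift (fun g => basicW ψ g * f.1 g) fun a b hab => by
    have h : b * a⁻¹ ∈ N F n := QuotientGroup.rightRel_apply.1 hab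
    have hb : b = (b * a⁻¹) * a := by group
    rw [hb, basicW_equivariant hψ h, f.2.2.1 _ h]
    field_simp [psiN_ne_zero]

lemma support_basicWMul (hψ : HasIntegralConductor ψ) {C : Set (G F n)} {f : Sec ψ n}
    (hf : SupportedMod C f.1) : Function.support (basicWMul hψ f) ⊆ NQuot.mk '' C := by
  intro x hx
  induction x using Quotient.inductionOn with
  | h g =>
    obtain ⟨u, hu, c, hc, rfl⟩ := hf g fun h => hx (by
      change basicW ψ g * f.1 g = 0
      rw [h, mul_zero])
    exact ⟨c, hc, Quotient.sound (QuotientGroup.rightRel_apply.2 (by simpa using hu))⟩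

lemma norm_basicWMul_le (hψ : HasIntegralConductor ψ) {f : Sec ψ n} {B : ℝ}
    (hB : ∀ g, ‖f.1 g‖ ≤ B) (x : NQuot F n) : ‖basicWMul hψ f x‖ ≤ B := by
  induction x using Quotient.inductionOn with
  | h g =>
    change ‖basicW ψ g * f.1 g‖ ≤ B
    rw [norm_mul]
    calc _ ≤ 1 * ‖f.1 g‖ := mul_le_mul_of_nonneg_right (basicW_norm_le g) (norm_nonneg _)
      _ ≤ B := by rw [one_mul]; exact hB g

lemma continuous_mk : Continuous (NQuot.mk : G F n → NQuot F n) := continuous_quotient_mk'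

lemma integrable_basicWMul (hψ : HasIntegralConductor ψ) (ν : Measure (NQuot F n))
    [IsFiniteMeasureOnCompacts ν] (f : Sec ψ n) : Integrable (basicWMul hψ f) ν := by
  obtain ⟨C, hC, hfC⟩ := f.2.2.2
  obtain ⟨B, -, hB⟩ := Sec.bounded f
  have hc : Continuous (basicWMul hψ f) := Continuous.quotient_lift
    ((continuous_of_K_invariant fun g k hk => basicW_K hψ g hk).mul f.2.1) _
  refine (integrableOn_iff_integrable_of_support_subset (support_basicWMul hψ hfC)).1 ?_
  exact Measure.integrableOn_of_bounded (M := B) (hC.image continuous_mk).measure_lt_top.ne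
    hc.aestronglyMeasurable (Filter.Eventually.of_forall (norm_basicWMul_le hψ hB))

/-- The Whittaker measure `φ₀ = W ν`, the product of the Whittaker function `W = basicW ψ` by the
measure `ν` on `N \ G`: the functional `f ↦ ∫_{N \ G} W f dν`. -/
def basicMeasure (hψ : HasIntegralConductor ψ) (ν : Measure (NQuot F n))
    [IsFiniteMeasureOnCompacts ν] : WMeas ψ n :=
  ⟨{  toFun := fun f => ∫ x, basicWMul hψ f x ∂ν
      map_add' := fun f f' => by
        rw [← integral_add (integrable_basicWMul hψ ν f) (integrable_basicWMul hψ ν f')]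
        congr 1
        ext x
        induction x using Quotient.inductionOn with
        | h g => exact mul_add _ _ _
      map_smul' := fun c f => by
        rw [RingHom.id_apply, smul_eq_mul, ← integral_const_mul]
        congr 1
        ext x
        induction x using Quotient.inductionOn with
        | h g => exact mul_left_comm _ _ _ }, fun C hC => by
    refine ⟨ν.real (NQuot.mk '' C), fun f hf B _ hB => ?_⟩
    change ‖∫ x, basicWMul hψ f x ∂ν‖ ≤ _
    rw [← setIntegral_eq_integral_of_forall_compl_eq_zero (s := NQuot.mk '' C)
      fun x hx => by_contra fun h => hx (support_basicWMul hψ hf h), mul_comm]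
    exact norm_setIntegral_le_of_norm_le_const (hC.image continuous_mk).measure_lt_top
      fun x _ => norm_basicWMul_le hψ hB x⟩

end Whittaker

/-! ### Unramified principal series, Satake transform and zeta integrals -/

section PrincipalSeries

variable {F : Type*} [Field F] [ValuativeRel F] [TopologicalSpace F]
  [IsNonarchimedeanLocalField F] {n : ℕ}

/-- The unramified character `χ` of the Borel subgroup with Satake parameter
`χ̌ = diag(z_1, …, z_n)`: `χ(b) = ∏ z_j ^ val(b_jj)`. -/
def unramifiedChar (z : Fin n → ℂˣ) (b : G F n) : ℂ :=
  ∏ j, ((z j ^ val (b.val j j) : ℂˣ) : ℂ)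

/-- The modular character `δ(b) = ∏_{i < j} |b_ii / b_jj|` of the Borel subgroup. -/
def modulus (b : G F n) : ℝ :=
  ∏ i, ∏ j ∈ Finset.Ioi i, absF (b.val i i) / absF (b.val j j)

open Classical in
/-- The unramified vector `v_{K,χ}` of the normalized induction of `χ` from the Borel subgroup,
`v(b k) = χ(b) δ(b)^{1/2}` for `b` upper triangular and `k ∈ K`. -/
def sphericalVector (z : Fin n → ℂˣ) (g : G F n) : ℂ :=
  if h : ∃ b : G F n, IsUpper b.val ∧ b⁻¹ * g ∈ K F n then
    unramifiedChar z h.choose * (√(modulus h.choose) : ℝ) else 0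

lemma sphericalVector_mul (z : Fin n → ℂˣ) {b k : G F n} (hb : IsUpper b.val) (hk : k ∈ K F n) :
    sphericalVector z (b * k) = unramifiedChar z b * (√(modulus b) : ℝ) := by
  have h : ∃ c : G F n, IsUpper c.val ∧ c⁻¹ * (b * k) ∈ K F n := ⟨b, hb, by simpa using hk⟩
  unfold sphericalVector
  rw [dif_pos h]
  obtain ⟨hc, hck⟩ := h.choose_spec
  set c := h.choose
  have hw : c⁻¹ * b ∈ K F n := by
    have := mul_mem hck (inv_mem hk)
    simpa [mul_assoc] using this
  have hwu : IsUpper (c⁻¹ * b).val := by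
    rw [Units.val_mul]
    exact hc.inv.mul hb
  have hinv : ∀ {a : G F n}, IsUpper a.val → ∀ j, a.val j j * a⁻¹.val j j = 1 := by
    intro a ha j
    rw [← ha.mul_diag ha.inv, ← Units.val_mul, mul_inv_cancel]
    simp
  have h0 : ∀ {a : G F n}, IsUpper a.val → ∀ j, a.val j j ≠ 0 := fun ha j =>
    left_ne_zero_of_mul_eq_one (hinv ha j)
  have hval : ∀ j, val (b.val j j) = val (c.val j j) := by
    intro j
    have h1 : b.val j j = c.val j j * (c⁻¹ * b).val j j := by
      rw [← hc.mul_diag hwu, ← Units.val_mul, mul_inv_cancel_left]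
    rw [h1, val_mul (h0 hc j) (h0 hwu j),
      val_eq_zero (hw.1 j j) (hw.2 j j) (hinv hwu j), add_zero]
  have habs : ∀ j, absF (b.val j j) = absF (c.val j j) := by
    intro j
    unfold absF
    rw [if_neg (h0 hb j), if_neg (h0 hc j), hval]
  simp only [unramifiedChar, modulus, hval, habs]

/-- `p`, as a function of the Satake parameter `χ̌ = diag(z)`, is the Satake transform of `h`: the
operator `π_χ(h) = ∫ h(g) π_χ(g) dg` acts on the unramified vector of the principal series `π_χ`
by the scalar `p(χ̌)`, for every unramified `χ`. -/
def IsSatakeTransform (μ : Measure (G F n)) (h : Hecke F n) (p : (Fin n → ℂˣ) → ℂ) : Prop :=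
  ∀ (z : Fin n → ℂˣ) (x : G F n),
    ∫ g, h.1 g * sphericalVector z (x * g) ∂μ = p z * sphericalVector z x

/-- The matrix `diag(z_1, …, z_n)`, the Satake parameter `χ̌` in the dual group `GL_n(ℂ)`. -/
def satakeParam (z : Fin n → ℂˣ) : Matrix (Fin n) (Fin n) ℂ := Matrix.diagonal fun j => (z j : ℂ)

/-- The action of a matrix on `Sym^i` of the standard representation `ℂ^n`, realized as the space
of homogeneous polynomials of degree `i` in the basis vectors `e_1, …, e_n`. -/
def symPow (i : ℕ) (A : Matrix (Fin n) (Fin n) ℂ) :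
    MvPolynomial.homogeneousSubmodule (Fin n) ℂ i →ₗ[ℂ]
      MvPolynomial.homogeneousSubmodule (Fin n) ℂ i :=
  (MvPolynomial.aeval fun j => ∑ k, MvPolynomial.C (A k j) * MvPolynomial.X k).toLinearMap.restrict
    fun p hp => by
      have h := MvPolynomial.IsHomogeneous.aeval
        ((MvPolynomial.mem_homogeneousSubmodule i p).1 hp)
        (fun j => ∑ k, MvPolynomial.C (A k j) * (MvPolynomial.X k : MvPolynomial (Fin n) ℂ))
        (n := 1) fun j => MvPolynomial.IsHomogeneous.sum _ _ _ fun k _ =>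
          MvPolynomial.isHomogeneous_C_mul_X _ _
      rw [one_mul] at h
      exact h

/-- The trace of the `i`-th symmetric power of the standard representation. -/
def symPowTrace (i : ℕ) (A : Matrix (Fin n) (Fin n) ℂ) : ℂ :=
  LinearMap.trace ℂ (MvPolynomial.homogeneousSubmodule (Fin n) ℂ i) (symPow i A)

variable (F) in
/-- `L(π_χ, Std, s) = det (1 - q^{-s} χ̌)⁻¹`. -/
def LStd (z : Fin n → ℂˣ) (s : ℂ) : ℂ :=
  (Matrix.det (1 - (resCard F : ℂ) ^ (-s) • satakeParam z))⁻¹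

/-- The unramified matrix coefficient `M_χ(g) = ⟨π_χ(g) v_{K,χ}, v_{K,χ⁻¹}⟩`, for the pairing given
by integration over `K`, normalized to have `M_χ(1) = 1`. -/
def matrixCoeff (μ : Measure (G F n)) (z : Fin n → ℂˣ) (g : G F n) : ℂ :=
  (μ.real (K F n : Set (G F n)) : ℂ)⁻¹ *
    ∫ k in (K F n : Set (G F n)), sphericalVector z (k * g) * sphericalVector z⁻¹ k ∂μ

/-- The integrand of the zeta integral of `π_χ`: the product of the characteristic function of
`Mat_n(𝒪)`, the matrix coefficient `M_χ`, and `|det|^s`. -/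
def zetaIntegrand (μ : Measure (G F n)) (z : Fin n → ℂˣ) (s : ℂ) (g : G F n) : ℂ :=
  (charMat F n).1 g.val * matrixCoeff μ z g * (absF g.val.det : ℂ) ^ s

end PrincipalSeries

end

end WhittakerStd

open WhittakerStd

/-! Everything rests on one count. Let `X_i` be the set of integral matrices whose determinant has
valuation `i` (`intDet`). Hermite normal form writes `X_i` as a finite disjoint union of cosets `gK`
with `g` upper triangular, diagonal `ϖ^{a_1}, …, ϖ^{a_n}`, `∑ a_r = i`, and the entries of row `r`
above the diagonal running through the integers modulo `ϖ^{a_r}` (`intDet_eq_biUnion`,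
`hermite_unique`). For fixed `a` there are `∏_{r<c} q^{a_r}` such `g`, and on each of them `v_χ` is
`z^a ∏_{r<c} q^{(a_c - a_r)/2}`. The product of the two is `z^a ∏_{r<c} q^{(a_r + a_c)/2} =
q^{i(n-1)/2} z^a`, since every index lies in `n - 1` pairs. Summing over `a` gives `q^{i(n-1)/2}`
times the complete homogeneous polynomial of degree `i` in `z`, which is the trace of `Sym^i` on
`diag(z)`. So `h_{Sym^i}` is the characteristic function of `X_i` divided by `vol(K) q^{i(n-1)/2}`
(`isSatakeTransform_symHecke`).

Uniqueness is the injectivity of the Satake transform (`Hecke.eq_zero_of_integral`). The transform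
is a Laurent polynomial in `z` whose coefficients are, up to nonzero factors, the integrals of `h`
over the sets of fixed Iwasawa exponents. For an extremal exponent `a` occurring in the support, `h`
takes there the single nonzero value `h(ϖ^a)`, so that coefficient does not vanish.

For the Whittaker measure, `φ₀` is up to a constant the twisted push-forward of `1_K dg`, whence `h
⋆ φ₀` is, up to the same constant and `vol(K)`, the push-forward of `h dg`
(`conv_basicMeasure_apply`). On the other side, the additive measure restricted to `G` is a multiple
of `|det g|^n dg` (`distribHaarChar_eq`, `restrict_onG_intDet`), so `φ` on determinant valuation `i`
is the push-forward of `q^{-ni} 1_{X_i} dg`. The exponents match because `-ni + i(n-1)/2 =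
-i(n+1)/2`.

For the zeta integral, the same count on each `X_i` yields the complete homogeneous polynomial in
the variables `q^{-(s+(n+1)/2)} z_j`. Summing over `i` is a product of geometric series, which is
the `L`-factor. Absolute convergence follows by domination, because `|v_χ|` is again a spherical
vector, with parameters `|z_j|`. -/

namespace WhittakerStd

/-! ### Valuation, fractional ideals and representatives modulo them -/

section FieldAPI

variable {F : Type*} [Field F] [ValuativeRel F] [TopologicalSpace F]
  [IsNonarchimedeanLocalField F]

variable (F) in
-- A rank-one valuation makes `F` a locally compact normed field, hence a proper metric space.
-- Second countability serves to compare left-invariant measures on `G` up to a scalar and to detect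
-- null sets of `N \ G` locally.
theorem secondCountable_field : SecondCountableTopology F := by
  let := IsTopologicalAddGroup.rightUniformSpace F
  have := isUniformAddGroup_of_addCommGroup (G := F)
  let : (Valued.v (R := F)).RankOne :=
  { hom' := IsRankLeOne.nonempty.some.emb (R := F).comp MonoidWithZeroHom.ValueGroup₀.embedding
    strictMono' := IsRankLeOne.nonempty.some.strictMono.comp
        MonoidWithZeroHom.ValueGroup₀.embedding_strictMono }
  open scoped Valued in
  have : ProperSpace F := .of_nontriviallyNormedField_of_weaklyLocallyCompactSpace F
  open scoped Valued in
  exact (inferInstance : SecondCountableTopology F)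

theorem mem_integers_iff_val {x : F} (hx : x ≠ 0) : x ∈ 𝒪[F] ↔ 0 ≤ val x := by
  set e := IsNonarchimedeanLocalField.valueGroupWithZeroIsoInt F
  have h0 : e (valuation F x) ≠ 0 := by simpa using hx
  have h1 : x ∈ 𝒪[F] ↔ e (valuation F x) ≤ e 1 :=
    (map_le_map_iff e (a := valuation F x) (b := 1)).symm
  rw [h1, map_one, ← WithZero.log_le_log h0 one_ne_zero, WithZero.log_one]
  exact neg_nonneg.symm

@[simp] theorem val_one : val (1 : F) = 0 := val_eq_zero (one_mem _) (one_mem _) (one_mul 1)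

theorem val_inv {x : F} (hx : x ≠ 0) : val x⁻¹ = -val x := by
  have h := val_mul hx (inv_ne_zero hx)
  rw [mul_inv_cancel₀ hx, val_one] at h
  omega

theorem val_div {x y : F} (hx : x ≠ 0) (hy : y ≠ 0) : val (x / y) = val x - val y := by
  rw [div_eq_mul_inv, val_mul hx (inv_ne_zero hy), val_inv hy]
  ring

theorem val_pow {x : F} (hx : x ≠ 0) (k : ℕ) : val (x ^ k) = k * val x := by
  induction k with
  | zero => simp
  | succ k ih => rw [pow_succ, val_mul (pow_ne_zero k hx) hx, ih]; push_cast; ring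

theorem val_zpow {x : F} (hx : x ≠ 0) (k : ℤ) : val (x ^ k) = k * val x := by
  cases k with
  | ofNat k => simpa using val_pow hx k
  | negSucc k => rw [zpow_negSucc, val_inv (pow_ne_zero _ hx), val_pow hx, Int.negSucc_eq]
                 push_cast; ring

theorem val_prod {ι : Type*} (s : Finset ι) (f : ι → F) (hf : ∀ i ∈ s, f i ≠ 0) :
    val (∏ i ∈ s, f i) = ∑ i ∈ s, val (f i) := by
  classical
  induction s using Finset.induction_on with
  | empty => simp
  | insert a s ha ih =>
    rw [Finset.prod_insert ha, Finset.sum_insert ha, val_mul (hf a (by simp))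
      (Finset.prod_ne_zero_iff.2 fun i hi => hf i (by simp [hi])), ih fun i hi => hf i (by simp [hi])]

variable (F) in
theorem exists_val_eq_one : ∃ x : F, x ≠ 0 ∧ val x = 1 := by
  set e := IsNonarchimedeanLocalField.valueGroupWithZeroIsoInt F
  obtain ⟨x, hx⟩ := valuation_surjective (K := F) (e.symm (WithZero.exp (-1)))
  refine ⟨x, ?_, ?_⟩
  · rintro rfl
    rw [map_zero] at hx
    simpa using congrArg e hx.symm
  · unfold val
    change -WithZero.log (e _) = 1
    rw [hx]
    simp

variable (F) in
/-- A uniformizer of `F`. -/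
noncomputable def unif : F := (exists_val_eq_one F).choose

theorem unif_ne_zero : unif F ≠ 0 := (exists_val_eq_one F).choose_spec.1

@[simp] theorem val_unif : val (unif F) = 1 := (exists_val_eq_one F).choose_spec.2

theorem unif_zpow_ne_zero (e : ℤ) : unif F ^ e ≠ 0 := zpow_ne_zero e unif_ne_zero

@[simp] theorem val_unif_zpow (e : ℤ) : val (unif F ^ e) = e := by
  rw [val_zpow unif_ne_zero, val_unif, mul_one]

theorem mem_integers_of_val {x : F} (h : x ≠ 0 → 0 ≤ val x) : x ∈ 𝒪[F] := by
  by_cases hx : x = 0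
  · rw [hx]; exact zero_mem _
  · exact (mem_integers_iff_val hx).2 (h hx)

theorem div_mem_integers {x y : F} (hy : y ≠ 0) (h : x ≠ 0 → val y ≤ val x) : x / y ∈ 𝒪[F] := by
  refine mem_integers_of_val fun h0 => ?_
  have hx : x ≠ 0 := fun hx => h0 (by simp [hx])
  rw [val_div hx hy]
  have := h hx
  omega

variable (F) in
/-- The fractional ideal of the elements of valuation at least `e`. -/
noncomputable def ball (e : ℤ) : AddSubgroup F where
  carrier := {x | x / unif F ^ e ∈ 𝒪[F]}
  zero_mem' := by simp
  add_mem' := by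
    intro a b ha hb
    change (a + b) / unif F ^ e ∈ 𝒪[F]
    rw [add_div]
    exact add_mem ha hb
  neg_mem' := by
    intro a ha
    change (-a) / unif F ^ e ∈ 𝒪[F]
    rw [neg_div]
    exact neg_mem ha

theorem mem_ball {e : ℤ} {x : F} : x ∈ ball F e ↔ x / unif F ^ e ∈ 𝒪[F] := Iff.rfl

theorem ball_le_integers {e : ℤ} (he : 0 ≤ e) {x : F} (hx : x ∈ ball F e) : x ∈ 𝒪[F] := by
  have h : x = x / unif F ^ e * unif F ^ e := (div_mul_cancel₀ _ (unif_zpow_ne_zero e)).symm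
  rw [h]
  refine mul_mem hx ((mem_integers_iff_val (unif_zpow_ne_zero e)).2 ?_)
  simpa using he

/-- A fixed system of representatives of `F` modulo `ball F e`. -/
noncomputable def sec (e : ℤ) (x : F) : F := (QuotientAddGroup.mk x : F ⧸ ball F e).out

theorem sec_sub_mem (e : ℤ) (x : F) : x - sec e x ∈ ball F e := by
  have h : (QuotientAddGroup.mk (sec e x) : F ⧸ ball F e) = QuotientAddGroup.mk x :=
    Quotient.out_eq' _
  have := QuotientAddGroup.eq.1 h
  rwa [neg_add_eq_sub] at this

theorem sec_eq_sec_iff {e : ℤ} {x y : F} : sec e x = sec e y ↔ y - x ∈ ball F e := by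
  unfold sec
  rw [Quotient.out_inj, QuotientAddGroup.eq, neg_add_eq_sub]

theorem sec_sec (e : ℤ) (x : F) : sec e (sec e x) = sec e x :=
  sec_eq_sec_iff.2 (sec_sub_mem e x)

theorem sec_mem_integers {e : ℤ} (he : 0 ≤ e) {x : F} (hx : x ∈ 𝒪[F]) : sec e x ∈ 𝒪[F] := by
  have := sub_mem hx (ball_le_integers he (sec_sub_mem e x))
  simpa using this

theorem val_nonneg_of_mem {x : F} (hx : x ≠ 0) (h : x ∈ 𝒪[F]) : 0 ≤ val x :=
  (mem_integers_iff_val hx).1 h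

theorem maximalIdeal_eq_span :
    𝓂[F] = Ideal.span {(⟨unif F, (mem_integers_iff_val unif_ne_zero).2 (by simp)⟩ : 𝒪[F])} := by
  ext x
  rw [Ideal.mem_span_singleton, IsLocalRing.mem_maximalIdeal, mem_nonunits_iff]
  constructor
  · intro hx
    by_cases h0 : x.1 = 0
    · rw [show x = 0 from Subtype.ext h0]
      exact dvd_zero _
    have h1 : 1 ≤ val x.1 := by
      by_contra h1
      have h2 : val x.1 = 0 := le_antisymm (by omega) (val_nonneg_of_mem h0 x.2)
      refine hx (IsUnit.of_mul_eq_one ⟨x.1⁻¹, ?_⟩ (Subtype.ext (mul_inv_cancel₀ h0)))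
      rw [mem_integers_iff_val (inv_ne_zero h0), val_inv h0, h2, neg_zero]
    refine ⟨⟨x.1 / unif F, div_mem_integers unif_ne_zero fun _ => by simpa using h1⟩,
      Subtype.ext ?_⟩
    exact (mul_div_cancel₀ _ unif_ne_zero).symm
  · rintro ⟨y, rfl⟩ hu
    obtain ⟨z, hz⟩ := hu.exists_right_inv
    have h1 := congrArg Subtype.val hz
    have h2 : unif F * (y.1 * z.1) = 1 := by rw [← mul_assoc]; exact h1
    have := val_eq_zero ((mem_integers_iff_val (unif_ne_zero (F := F))).2 (by simp))
      (mul_mem y.2 z.2) h2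
    simp at this

theorem mem_maximalIdeal_pow_iff (e : ℕ) (x : 𝒪[F]) : x ∈ 𝓂[F] ^ e ↔ x.1 ∈ ball F e := by
  rw [maximalIdeal_eq_span, Ideal.span_singleton_pow, Ideal.mem_span_singleton, mem_ball]
  constructor
  · rintro ⟨y, rfl⟩
    have h : unif F ^ e * y.1 / unif F ^ (e : ℤ) = y.1 := by
      rw [zpow_natCast, mul_div_cancel_left₀ _ (pow_ne_zero e unif_ne_zero)]
    change unif F ^ e * y.1 / unif F ^ (e : ℤ) ∈ _
    rw [h]
    exact y.2
  · intro h
    refine ⟨⟨_, h⟩, Subtype.ext ?_⟩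
    change x.1 = unif F ^ e * (x.1 / unif F ^ (e : ℤ))
    rw [zpow_natCast, mul_div_cancel₀ _ (pow_ne_zero e unif_ne_zero)]

/-- The representatives of integers are in bijection with `𝒪[F] ⧸ 𝓂[F] ^ e`, whose order is the
`e`-th power of that of the residue field because `𝒪[F]` is a discrete valuation ring. -/
theorem ncard_sec_image (e : ℕ) : (sec (e : ℤ) '' {x : F | x ∈ 𝒪[F]}).ncard = resCard F ^ e := by
  have h1 : Submodule.cardQuot (𝓂[F] ^ e) = resCard F ^ e := by
    rw [cardQuot_pow_of_prime (IsDiscreteValuationRing.not_a_field _)]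
    rfl
  rw [← h1, ← Nat.card_coe_set_eq]
  change _ = Nat.card (𝒪[F] ⧸ (𝓂[F] ^ e).toAddSubgroup)
  symm
  have key : ∀ x y : 𝒪[F], -x + y ∈ (𝓂[F] ^ e).toAddSubgroup ↔
      sec (e : ℤ) x.1 = sec (e : ℤ) y.1 := fun x y => by
    rw [sec_eq_sec_iff, neg_add_eq_sub]
    exact mem_maximalIdeal_pow_iff e (y - x)
  refine Nat.card_congr (Equiv.ofBijective (Quotient.lift
    (fun x : 𝒪[F] => (⟨sec (e : ℤ) x.1, x.1, x.2, rfl⟩ : sec (e : ℤ) '' {x : F | x ∈ 𝒪[F]}))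
    fun x y h => Subtype.ext ((key x y).1 (QuotientAddGroup.leftRel_apply.1 h))) ⟨?_, ?_⟩)
  · intro x y
    induction x using Quotient.inductionOn
    induction y using Quotient.inductionOn
    intro h
    exact Quotient.sound (QuotientAddGroup.leftRel_apply.2 ((key _ _).2 (congrArg Subtype.val h)))
  · rintro ⟨_, x, hx, rfl⟩
    exact ⟨Quotient.mk _ ⟨x, hx⟩, rfl⟩

variable (F) in
theorem one_lt_resCard : 1 < resCard F := Finite.one_lt_card

variable (F) in
theorem finite_sec_image (e : ℕ) : (sec (e : ℤ) '' {x : F | x ∈ 𝒪[F]}).Finite :=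
  Set.finite_of_ncard_ne_zero (by
    rw [ncard_sec_image]
    exact pow_ne_zero _ (by have := one_lt_resCard F; omega))

variable (F) in
/-- Representatives of the integers modulo `ball F e`. -/
noncomputable def reps (e : ℕ) : Finset F := (finite_sec_image F e).toFinset

theorem card_reps (e : ℕ) : (reps F e).card = resCard F ^ e := by
  rw [reps, ← Set.ncard_eq_toFinset_card _ (finite_sec_image F e), ncard_sec_image]

theorem mem_reps_iff {e : ℕ} {x : F} : x ∈ reps F e ↔ x ∈ 𝒪[F] ∧ sec (e : ℤ) x = x := by
  rw [reps, Set.Finite.mem_toFinset]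
  constructor
  · rintro ⟨y, hy, rfl⟩
    exact ⟨sec_mem_integers (by simp) hy, sec_sec _ _⟩
  · rintro ⟨h1, h2⟩
    exact ⟨x, h1, h2⟩

end FieldAPI

/-! ### Column operations over the integers, Hermite normal form and Iwasawa decomposition -/

section MatrixAPI

variable {F : Type*} [Field F] [ValuativeRel F] [TopologicalSpace F]
  [IsNonarchimedeanLocalField F] {n : ℕ}

/-- Cramer's rule: the inverse is the adjugate, which is integral, divided by a determinant that is
a unit. -/
theorem mem_K_of_integral {g : G F n} (h : ∀ i j, g.val i j ∈ 𝒪[F]) (hd : valDet g = 0) :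
    g ∈ K F n := by
  refine ⟨h, fun i j => ?_⟩
  rw [Matrix.coe_units_inv, Matrix.inv_def, Ring.inverse_eq_inv', Matrix.smul_apply, smul_eq_mul]
  refine mul_mem ((mem_integers_iff_val (inv_ne_zero (det_ne_zero g))).2 ?_) ?_
  · rw [val_inv (det_ne_zero g)]
    exact (neg_eq_zero.2 hd).ge
  · rw [Matrix.adjugate_apply]
    refine det_mem_integers fun r c => ?_
    rw [Matrix.updateRow_apply]
    split_ifs
    · rw [Pi.single_apply]
      split_ifs
      exacts [one_mem _, zero_mem _]
    · exact h r c

/-- The permutation matrix with `(g * permG σ) r c = g r (σ c)`. -/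
def permG (σ : Equiv.Perm (Fin n)) : G F n where
  val := (1 : Mat F n).submatrix id σ
  inv := (1 : Mat F n).submatrix σ id
  val_inv := by
    rw [Matrix.submatrix_mul_equiv, Matrix.mul_one, Matrix.submatrix_id_id]
  inv_val := by
    rw [← Matrix.submatrix_mul _ _ _ _ _ Function.bijective_id, Matrix.mul_one,
      Matrix.submatrix_one_equiv]

theorem mul_permG_apply (A : Mat F n) (σ : Equiv.Perm (Fin n)) (r c : Fin n) :
    (A * (permG σ : G F n).val) r c = A r (σ c) := by
  simp [permG, Matrix.mul_apply, Matrix.one_apply]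

theorem permG_inv_mul_apply (A : Mat F n) (σ : Equiv.Perm (Fin n)) (r c : Fin n) :
    ((permG σ : G F n)⁻¹.val * A) r c = A (σ r) c := by
  change ((1 : Mat F n).submatrix σ id * A) r c = _
  simp [Matrix.mul_apply, Matrix.one_apply]

theorem permG_mem_K (σ : Equiv.Perm (Fin n)) : (permG σ : G F n) ∈ K F n := by
  have h : ∀ i j, (1 : Mat F n) i j ∈ 𝒪[F] := by
    intro i j
    rw [Matrix.one_apply]
    split_ifs
    exacts [one_mem _, zero_mem _]
  exact ⟨fun i j => h _ _, fun i j => h _ _⟩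

theorem mul_updateRow_one_apply (A : Mat F n) (i : Fin n) (c : Fin n → F) (r j : Fin n) :
    (A * (1 : Mat F n).updateRow i c) r j = A r i * c j + if j = i then 0 else A r j := by
  rw [Matrix.mul_apply, ← Finset.add_sum_erase _ _ (Finset.mem_univ i), Matrix.updateRow_self]
  congr 1
  split_ifs with h
  · subst h
    refine Finset.sum_eq_zero fun x hx => ?_
    rw [Matrix.updateRow_ne (Finset.ne_of_mem_erase hx),
      Matrix.one_apply_ne (Finset.ne_of_mem_erase hx), mul_zero]
  · rw [Finset.sum_eq_single_of_mem j (Finset.mem_erase.2 ⟨h, Finset.mem_univ _⟩)]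
    · rw [Matrix.updateRow_ne h, Matrix.one_apply_eq, mul_one]
    · intro x hx hxj
      rw [Matrix.updateRow_ne (Finset.ne_of_mem_erase hx), Matrix.one_apply_ne hxj, mul_zero]

/-- The inverse of the row `c` for `rowG`. -/
def rowInv (i : Fin n) (c : Fin n → F) (j : Fin n) : F :=
  if j = i then (c i)⁻¹ else -((c i)⁻¹ * c j)

theorem updateRow_mul_rowInv (i : Fin n) (c : Fin n → F) (hc : c i ≠ 0) :
    (1 : Mat F n).updateRow i c * (1 : Mat F n).updateRow i (rowInv i c) = 1 := by
  ext r j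
  rw [mul_updateRow_one_apply]
  unfold rowInv
  by_cases hr : r = i
  · subst hr
    by_cases hj : j = r
    · subst hj
      simp [hc]
    · simp [hj, Matrix.one_apply_ne (Ne.symm hj), hc]
  · by_cases hj : j = i
    · subst hj
      simp [hr]
    · simp [hj, hr]

/-- The identity matrix with the `i`-th row replaced by `c`. -/
def rowG (i : Fin n) (c : Fin n → F) (hc : c i ≠ 0) : G F n where
  val := (1 : Mat F n).updateRow i c
  inv := (1 : Mat F n).updateRow i (rowInv i c)
  val_inv := updateRow_mul_rowInv i c hc
  inv_val := mul_eq_one_comm.1 (updateRow_mul_rowInv i c hc)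

theorem mul_rowG_apply (A : Mat F n) (i : Fin n) (c : Fin n → F) (hc : c i ≠ 0) (r j : Fin n) :
    (A * (rowG i c hc).val) r j = A r i * c j + if j = i then 0 else A r j :=
  mul_updateRow_one_apply A i c r j

theorem updateRow_one_mem_integers {i : Fin n} {c : Fin n → F} (h : ∀ j, c j ∈ 𝒪[F])
    (r j : Fin n) : (1 : Mat F n).updateRow i c r j ∈ 𝒪[F] := by
  rw [Matrix.updateRow_apply]
  split_ifs
  · exact h j
  · rw [Matrix.one_apply]
    split_ifs
    exacts [one_mem _, zero_mem _]

theorem rowG_mem_K {i : Fin n} {c : Fin n → F} (hc : c i ≠ 0) (h : ∀ j, c j ∈ 𝒪[F])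
    (h' : (c i)⁻¹ ∈ 𝒪[F]) : rowG i c hc ∈ K F n := by
  refine ⟨updateRow_one_mem_integers h, updateRow_one_mem_integers fun j => ?_⟩
  unfold rowInv
  split_ifs
  exacts [h', neg_mem (mul_mem h' (h j))]

/-- The transpose of an element of `G`. -/
def transposeG (g : G F n) : G F n where
  val := g.val.transpose
  inv := g⁻¹.val.transpose
  val_inv := by
    rw [← Matrix.transpose_mul, ← Units.val_mul, inv_mul_cancel, Units.val_one,
      Matrix.transpose_one]
  inv_val := by
    rw [← Matrix.transpose_mul, ← Units.val_mul, mul_inv_cancel, Units.val_one,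
      Matrix.transpose_one]

theorem transposeG_mem_K {g : G F n} (hg : g ∈ K F n) : transposeG g ∈ K F n :=
  ⟨fun i j => hg.1 j i, fun i j => hg.2 j i⟩

theorem transposeG_rowG_mul_apply (A : Mat F n) (i : Fin n) (c : Fin n → F) (hc : c i ≠ 0)
    (r j : Fin n) :
    ((transposeG (rowG i c hc)).val * A) r j = c r * A i j + if r = i then 0 else A r j := by
  have h : (transposeG (rowG i c hc)).val * A =
      (A.transpose * (rowG i c hc).val).transpose := by
    rw [Matrix.transpose_mul, Matrix.transpose_transpose]
    rfl
  rw [h, Matrix.transpose_apply, mul_rowG_apply, Matrix.transpose_apply, Matrix.transpose_apply,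
    mul_comm]

/-- The `i`-th row of `A` is in Hermite normal form. -/
def HermiteRow (A : Mat F n) (i : Fin n) : Prop :=
  (∀ j < i, A i j = 0) ∧ (A i i ≠ 0 → A i i = unif F ^ val (A i i) ∧
    ∀ j, i < j → sec (val (A i i)) (A i j) = A i j)

/-- One step of the reduction, by integral column operations. The rows below vanish in columns up to
`i`, so neither permuting those columns nor adding multiples of column `i` to the others disturbs
them. The last clause records that the new diagonal entry has the least valuation among the old
entries in columns up to `i`; the injectivity of the Satake transform needs it. -/
theorem exists_hermiteRow (A : G F n) (i : Fin n) (hA : ∀ r, i < r → ∀ j < r, A.val r j = 0) :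
    ∃ k ∈ K F n, (∀ r, i < r → ∀ j, (A * k).val r j = A.val r j) ∧
      HermiteRow (A * k).val i ∧ ∀ j ≤ i, A.val i j ≠ 0 →
        (A * k).val i i ≠ 0 ∧ val ((A * k).val i i) ≤ val (A.val i j) := by
  classical
  -- Invertibility rules this case out, but there is no need to say so: `HermiteRow` asks nothing of
  -- the tail of a row with zero diagonal entry, and the identity works.
  by_cases h0 : ∀ j ≤ i, A.val i j = 0
  · refine ⟨1, one_mem _, fun r _ j => by rw [mul_one], ⟨fun j hj => ?_, fun h => ?_⟩,
      fun j hj h => absurd (h0 j hj) h⟩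
    · rw [mul_one]; exact h0 j hj.le
    · rw [mul_one] at h; exact absurd (h0 i le_rfl) h
  push Not at h0
  obtain ⟨j₁, hj₁, hj₁0⟩ := h0
  -- The pivot has least valuation, so it divides every entry to be cleared.
  obtain ⟨j₀, hj₀, hmin⟩ := Finset.exists_min_image
    (Finset.univ.filter fun j => j ≤ i ∧ A.val i j ≠ 0) (fun j => val (A.val i j))
    ⟨j₁, by simp [hj₁, hj₁0]⟩
  simp only [Finset.mem_filter, Finset.mem_univ, true_and, and_imp] at hj₀ hmin
  obtain ⟨hj₀i, hx⟩ := hj₀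
  set x := A.val i j₀
  set B := A * permG (Equiv.swap j₀ i) with hB
  have hBapp : ∀ r c, B.val r c = A.val r (Equiv.swap j₀ i c) := fun r c => by
    rw [hB, Units.val_mul, mul_permG_apply]
  have hBi : B.val i i = x := by rw [hBapp, Equiv.swap_apply_right]
  have hswap : ∀ j ≤ i, Equiv.swap j₀ i j ≤ i := fun j hj => by
    rw [Equiv.swap_apply_def]; split_ifs <;> first | assumption | exact le_rfl
  have hswap' : ∀ j, i < j → Equiv.swap j₀ i j = j := fun j hj =>
    Equiv.swap_apply_of_ne_of_ne (hj₀i.trans_lt hj).ne' hj.ne'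
  have hBr : ∀ r, i < r → ∀ j, B.val r j = A.val r j := fun r hr j => by
    rw [hBapp]
    rcases le_or_gt j i with h | h
    · rw [hA r hr _ ((hswap j h).trans_lt hr), hA r hr _ (h.trans_lt hr)]
    · rw [hswap' j h]
  have hBmin : ∀ j ≤ i, B.val i j ≠ 0 → val x ≤ val (B.val i j) := fun j hj h => by
    rw [hBapp] at h ⊢
    exact hmin _ (hswap j hj) h
  set e := val x
  -- `t` is the wanted row `i`, and `c` below solves the equation that carries row `i` of `B` to
  -- `t`. A single operation thus clears the left part, normalises the pivot and reduces the right
  -- part. Integrality of `c` comes from minimality of the pivot on the left and from `sec_sub_mem`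
  -- on the right.
  set t : Fin n → F := fun j => if j < i then 0 else if j = i then unif F ^ e else
    sec e (B.val i j) with ht
  set c : Fin n → F := fun j => (t j - if j = i then 0 else B.val i j) / x with hc
  have hci : c i = unif F ^ e / x := by simp [hc, ht]
  have hci0 : c i ≠ 0 := by rw [hci]; exact div_ne_zero (unif_zpow_ne_zero e) hx
  have hvc : val (c i) = 0 := by
    rw [hci, val_div (unif_zpow_ne_zero e) hx, val_unif_zpow, sub_self]
  have hcO : ∀ j, c j ∈ 𝒪[F] := by
    intro j
    rcases lt_trichotomy j i with h | h | h
    · have : c j = -(B.val i j / x) := by simp [hc, ht, h, h.ne, neg_div]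
      rw [this]
      exact neg_mem (div_mem_integers hx (hBmin j h.le))
    · rw [h, mem_integers_iff_val hci0, hvc]
    · have : c j = -((B.val i j - sec e (B.val i j)) / unif F ^ e * (unif F ^ e / x)) := by
        rw [div_mul_div_cancel₀ (unif_zpow_ne_zero e)]
        simp only [hc, ht, h.not_gt, h.ne', if_false]
        ring
      rw [this]
      refine neg_mem (mul_mem (sec_sub_mem e _) ?_)
      rw [← hci, mem_integers_iff_val hci0, hvc]
  have hC : ∀ r j, (B * rowG i c hci0).val r j = B.val r i * c j + if j = i then 0 else B.val r j :=
    fun r j => by rw [Units.val_mul, mul_rowG_apply]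
  have hCi : ∀ j, (B * rowG i c hci0).val i j = t j := fun j => by
    rw [hC, hBi, hc]
    field_simp
    ring
  have hCii : (B * rowG i c hci0).val i i = unif F ^ e := by rw [hCi]; simp [ht]
  refine ⟨permG (Equiv.swap j₀ i) * rowG i c hci0,
    mul_mem (permG_mem_K _) (rowG_mem_K hci0 hcO ?_), ?_⟩
  · rw [mem_integers_iff_val (inv_ne_zero hci0), val_inv hci0, hvc, neg_zero]
  rw [← mul_assoc, ← hB]
  refine ⟨fun r hr j => ?_, ⟨fun j hj => ?_, fun _ => ⟨?_, fun j hj => ?_⟩⟩, fun j hj h => ⟨?_, ?_⟩⟩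
  · rw [hC, hBr r hr, hBr r hr, hA r hr i hr, zero_mul, zero_add]
    split_ifs with h
    · rw [h, hA r hr i hr]
    · rfl
  · rw [hCi]; simp [ht, hj]
  · rw [hCii, val_unif_zpow]
  · rw [hCii, val_unif_zpow, hCi]
    simp only [ht, hj.not_gt, hj.ne', if_false, sec_sec]
  · rw [hCii]; exact unif_zpow_ne_zero e
  · rw [hCii, val_unif_zpow]
    exact hmin j hj h

/-- Rows are treated from the bottom upwards, since the step for one row needs the rows below to be
triangular and leaves them unchanged. -/
theorem exists_hermiteRows (m : ℕ) (hm : m ≤ n) (A : G F n)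
    (hA : ∀ r : Fin n, m ≤ r → ∀ j < r, A.val r j = 0) :
    ∃ k ∈ K F n, (∀ r : Fin n, m ≤ r → ∀ j, (A * k).val r j = A.val r j) ∧
      ∀ r : Fin n, (r : ℕ) < m → HermiteRow (A * k).val r := by
  induction m generalizing A with
  | zero => exact ⟨1, one_mem _, fun r _ j => by rw [mul_one], fun r hr => by omega⟩
  | succ m ih =>
    set i : Fin n := ⟨m, hm⟩
    obtain ⟨k, hk, h1, h2, -⟩ := exists_hermiteRow A i fun r hr => hA r hr
    obtain ⟨k', hk', h3, h4⟩ := ih (by omega) (A * k) fun r hr j hj => by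
      rcases eq_or_lt_of_le hr with h | h
      · have hri : r = i := Fin.ext h.symm
        rw [hri] at hj ⊢
        exact h2.1 j hj
      · rw [h1 r h]
        exact hA r h j hj
    refine ⟨k * k', mul_mem hk hk', ?_⟩
    rw [← mul_assoc]
    refine ⟨fun r hr j => ?_, fun r hr => ?_⟩
    · rw [h3 r (by omega), h1 r hr]
    · rcases eq_or_lt_of_le (Nat.le_of_lt_succ hr) with h | h
      · have hri : r = i := Fin.ext h
        have h5 : ∀ j, (A * k * k').val i j = (A * k).val i j := h3 i le_rfl
        rw [hri]
        unfold HermiteRow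
        simp only [h5]
        exact h2
      · exact h4 r h

theorem IsUpper.diag_ne_zero {b : G F n} (hb : IsUpper b.val) (i : Fin n) : b.val i i ≠ 0 := by
  have h := hb.mul_diag hb.inv i
  rw [← Units.val_mul, mul_inv_cancel, Units.val_one, Matrix.one_apply_eq] at h
  exact left_ne_zero_of_mul_eq_one h.symm

theorem IsUpper.diag_inv {b : G F n} (hb : IsUpper b.val) (i : Fin n) :
    b⁻¹.val i i = (b.val i i)⁻¹ := by
  have h := hb.mul_diag hb.inv i
  rw [← Units.val_mul, mul_inv_cancel, Units.val_one, Matrix.one_apply_eq] at h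
  exact eq_inv_of_mul_eq_one_right h.symm

theorem IsUpper.val_diag_of_mem_K {b : G F n} (hb : IsUpper b.val) (hk : b ∈ K F n) (i : Fin n) :
    val (b.val i i) = 0 :=
  val_eq_zero (hk.1 i i) (hk.2 i i) (by rw [hb.diag_inv, mul_inv_cancel₀ (hb.diag_ne_zero i)])

theorem IsUpper.valDet {b : G F n} (hb : IsUpper b.val) :
    valDet b = ∑ i, val (b.val i i) := by
  unfold WhittakerStd.valDet
  rw [Matrix.det_of_isUpperTriangular (fun i j hij => hb i j hij),
    val_prod _ _ fun i _ => hb.diag_ne_zero i]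

/-- The upper triangular matrix with diagonal entries `ϖ ^ a i` and entries `r i j` above the
diagonal. -/
noncomputable def hermMat (a : Fin n → ℤ) (r : Fin n → Fin n → F) : Mat F n :=
  Matrix.of fun i j => if i < j then r i j else if i = j then unif F ^ a i else 0

theorem hermMat_diag (a : Fin n → ℤ) (r : Fin n → Fin n → F) (i : Fin n) :
    hermMat a r i i = unif F ^ a i := by
  simp [hermMat]

theorem hermMat_of_lt (a : Fin n → ℤ) (r : Fin n → Fin n → F) {i j : Fin n} (h : i < j) :
    hermMat a r i j = r i j := by
  simp [hermMat, h]

theorem isUpper_hermMat (a : Fin n → ℤ) (r : Fin n → Fin n → F) : IsUpper (hermMat a r) := by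
  intro i j hij
  simp [hermMat, hij.not_gt, hij.ne']

theorem det_hermMat (a : Fin n → ℤ) (r : Fin n → Fin n → F) :
    (hermMat a r).det = ∏ i, unif F ^ a i := by
  rw [Matrix.det_of_isUpperTriangular (fun i j hij => isUpper_hermMat a r i j hij)]
  simp only [hermMat_diag]

/-- `hermMat` as an element of `G`. -/
noncomputable def hermG (a : Fin n → ℤ) (r : Fin n → Fin n → F) : G F n :=
  Matrix.GeneralLinearGroup.mkOfDetNeZero (hermMat a r) (by
    rw [det_hermMat]
    exact Finset.prod_ne_zero_iff.2 fun i _ => unif_zpow_ne_zero _)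

@[simp] theorem hermG_val (a : Fin n → ℤ) (r : Fin n → Fin n → F) :
    (hermG a r).val = hermMat a r := rfl

/-- The entries above the diagonal are reduced modulo the diagonal entry of their row. -/
def IsReduced (a : Fin n → ℤ) (r : Fin n → Fin n → F) : Prop :=
  (∀ i j, i < j → sec (a i) (r i j) = r i j) ∧ ∀ i j, ¬ i < j → r i j = 0

theorem exists_hermite (g : G F n) :
    ∃ a r, IsReduced a r ∧ ∃ k ∈ K F n, g * k = hermG a r := by
  obtain ⟨k, hk, -, h⟩ := exists_hermiteRows n le_rfl g fun r hr => absurd r.2 (by omega)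
  have hU : IsUpper (g * k).val := fun i j hij => (h i i.2).1 j hij
  have h0 : ∀ i, (g * k).val i i ≠ 0 := hU.diag_ne_zero
  refine ⟨fun i => val ((g * k).val i i), fun i j => if i < j then (g * k).val i j else 0,
    ⟨fun i j hij => ?_, fun i j hij => if_neg hij⟩, k, hk, Units.ext ?_⟩
  · simp only [hij, if_true]
    exact ((h i i.2).2 (h0 i)).2 j hij
  · ext i j
    rw [hermG_val]
    rcases lt_trichotomy i j with hij | hij | hij
    · rw [hermMat_of_lt _ _ hij, if_pos hij]
    · rw [hij, hermMat_diag]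
      exact ((h j j.2).2 (h0 j)).1
    · rw [hU i j hij, isUpper_hermMat _ _ i j hij]

theorem exists_iwasawa (g : G F n) : ∃ b k : G F n, IsUpper b.val ∧ k ∈ K F n ∧ g = b * k := by
  obtain ⟨a, r, -, k, hk, h⟩ := exists_hermite g
  exact ⟨hermG a r, k⁻¹, isUpper_hermMat a r, inv_mem hk, by rw [← h, mul_inv_cancel_right]⟩

/-- The element `k` is upper triangular with unit diagonal entries, which forces `a = a'` and then
diagonal `1`. Off the diagonal one inducts on `j - i`: once the entries of `k` closer to the
diagonal vanish, the `(i, j)` entry reads `r' i j = ϖ ^ a i * k i j + r i j`. Two reduced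
representatives of one class are equal, so `k i j = 0`. -/
theorem hermite_unique {a a' : Fin n → ℤ} {r r' : Fin n → Fin n → F} (hr : IsReduced a r)
    (hr' : IsReduced a' r') {k : G F n} (hk : k ∈ K F n) (h : hermG a r * k = hermG a' r') :
    a = a' ∧ r = r' := by
  have hkU : IsUpper k.val := by
    have : k = (hermG a r)⁻¹ * hermG a' r' := by rw [← h, inv_mul_cancel_left]
    rw [this, Units.val_mul]
    exact (IsUpper.inv (isUpper_hermMat a r)).mul (isUpper_hermMat a' r')
  have hmul : ∀ i j, hermMat a' r' i j = ∑ l, hermMat a r i l * k.val l j := fun i j => by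
    rw [← hermG_val, ← h, Units.val_mul, Matrix.mul_apply, hermG_val]
  have hdiag : ∀ i, unif F ^ a' i = unif F ^ a i * k.val i i := fun i => by
    rw [← hermMat_diag a' r', ← hermMat_diag a r, ← IsUpper.mul_diag (isUpper_hermMat a r) hkU,
      ← hermG_val, ← hermG_val, ← Units.val_mul, h]
  have ha : a = a' := by
    ext i
    have h1 := congrArg val (hdiag i)
    rw [val_mul (unif_zpow_ne_zero _) (hkU.diag_ne_zero i), hkU.val_diag_of_mem_K hk,
      val_unif_zpow, val_unif_zpow, add_zero] at h1
    exact h1.symm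
  subst ha
  have key : ∀ m : ℕ, ∀ i j : Fin n, i < j → (j : ℕ) - i = m → k.val i j = 0 ∧ r i j = r' i j := by
    intro m
    induction m using Nat.strong_induction_on with
    | _ m ih =>
      intro i j hij hm
      have hij' : (i : ℕ) < j := hij
      have hkjj : k.val j j = 1 := by
        have := hdiag j
        exact (mul_eq_left₀ (unif_zpow_ne_zero _)).1 this.symm
      have h1 : r' i j = unif F ^ a i * k.val i j + r i j := by
        rw [← hermMat_of_lt a r' hij, hmul, Fintype.sum_eq_add i j hij.ne]
        · rw [hermMat_diag, hermMat_of_lt a r hij, hkjj, mul_one]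
        · rintro l ⟨hli, hlj⟩
          rcases lt_or_gt_of_ne hli with h2 | h2
          · rw [isUpper_hermMat a r i l h2, zero_mul]
          rcases lt_or_gt_of_ne hlj with h3 | h3
          · have h2' : (i : ℕ) < l := h2
            have h3' : (l : ℕ) < j := h3
            rw [(ih (j - l) (by omega) l j h3 rfl).1, mul_zero]
          · rw [hkU l j h3, mul_zero]
      have h2 : r' i j - r i j ∈ ball F (a i) := by
        rw [h1, mem_ball, add_sub_cancel_right, mul_div_cancel_left₀ _ (unif_zpow_ne_zero _)]
        exact hk.1 i j
      have h3 := sec_eq_sec_iff.2 h2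
      rw [hr.1 i j hij, hr'.1 i j hij] at h3
      refine ⟨?_, h3⟩
      rw [h3, right_eq_add] at h1
      exact (mul_eq_zero.1 h1).resolve_left (unif_zpow_ne_zero _)
  refine ⟨rfl, ?_⟩
  ext i j
  by_cases hij : i < j
  · exact (key _ i j hij rfl).2
  · rw [hr.2 i j hij, hr'.2 i j hij]

end MatrixAPI

/-! ### Compactness of `K` and decomposition of integral matrices into cosets of `K` -/

section Topology

variable {F : Type*} [Field F] [ValuativeRel F] [TopologicalSpace F]
  [IsNonarchimedeanLocalField F] {n : ℕ}

variable (F) in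
theorem t2Space_field : T2Space F := by
  have h : IsClosed ({0} : Set F) := by
    rw [← isOpen_compl_iff]
    exact isOpen_ne_zero F
  have : T1Space F := IsTopologicalAddGroup.t1Space F h
  infer_instance

instance : T2Space (Mat F n) :=
  have := t2Space_field F
  inferInstanceAs (T2Space (Fin n → Fin n → F))

instance : SecondCountableTopology (Mat F n) :=
  have := secondCountable_field F
  inferInstanceAs (SecondCountableTopology (Fin n → Fin n → F))

instance : LocallyCompactSpace (Mat F n) :=
  inferInstanceAs (LocallyCompactSpace (Fin n → Fin n → F))

instance : SecondCountableTopology (G F n) :=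
  (isOpenEmbedding_val F n).isEmbedding.secondCountableTopology

variable (F n) in
theorem isCompact_K : IsCompact (K F n : Set (G F n)) := by
  let S : Submonoid (Mat F n) :=
    { carrier := {X | ∀ i j, X i j ∈ 𝒪[F]}
      mul_mem' := by
        intro a b ha hb i j
        rw [Matrix.mul_apply]
        exact sum_mem fun k _ => mul_mem (ha i k) (hb k j)
      one_mem' := by
        intro i j
        rw [Matrix.one_apply]
        split_ifs
        exacts [one_mem _, zero_mem _] }
  exact Submonoid.units_isCompact (S := S) (isCompact_integral F n)

theorem isOpen_coset (g : G F n) : IsOpen (g • (K F n : Set (G F n))) := (isOpen_K F n).smul g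

theorem isCompact_coset (g : G F n) : IsCompact (g • (K F n : Set (G F n))) :=
  (isCompact_K F n).smul g

theorem mem_coset_iff {g x : G F n} : x ∈ g • (K F n : Set (G F n)) ↔ g⁻¹ * x ∈ K F n := by
  rw [Set.mem_smul_set_iff_inv_smul_mem]
  rfl

theorem eqOn_coset {E : Type*} {f : G F n → E} (hf : ∀ g, ∀ k ∈ K F n, f (g * k) = f g)
    (g : G F n) : Set.EqOn f (fun _ => f g) (g • (K F n : Set (G F n))) := by
  rintro _ ⟨k, hk, rfl⟩
  exact hf g k hk

variable {E : Type*} [NormedAddCommGroup E] [NormedSpace ℝ E] [CompleteSpace E]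

theorem integrableOn_coset (μ : Measure (G F n)) [IsFiniteMeasureOnCompacts μ] {f : G F n → E}
    (hf : ∀ g, ∀ k ∈ K F n, f (g * k) = f g) (g : G F n) :
    IntegrableOn f (g • (K F n : Set (G F n))) μ :=
  (continuous_of_K_invariant hf).continuousOn.integrableOn_compact (isCompact_coset g)

theorem setIntegral_coset (μ : Measure (G F n)) [μ.IsHaarMeasure] {f : G F n → E}
    (hf : ∀ g, ∀ k ∈ K F n, f (g * k) = f g) (g : G F n) :
    ∫ x in g • (K F n : Set (G F n)), f x ∂μ = μ.real (K F n : Set (G F n)) • f g := by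
  rw [setIntegral_congr_fun (isOpen_coset g).measurableSet (eqOn_coset hf g), setIntegral_const]
  simp only [Measure.real, measure_smul]

theorem measureReal_K_pos (μ : Measure (G F n)) [μ.IsHaarMeasure] :
    0 < μ.real (K F n : Set (G F n)) :=
  ENNReal.toReal_pos ((isOpen_K F n).measure_pos μ ⟨1, one_mem _⟩).ne'
    (isCompact_K F n).measure_lt_top.ne

variable (F n) in
/-- The integral matrices in `G` whose determinant has valuation `i`. -/
def intDet (i : ℤ) : Set (G F n) := {g | (∀ r c, g.val r c ∈ 𝒪[F]) ∧ valDet g = i}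

theorem integral_mul_right {g k : G F n} (hk : k ∈ K F n) :
    (∀ r c, (g * k).val r c ∈ 𝒪[F]) ↔ ∀ r c, g.val r c ∈ 𝒪[F] := by
  have h : ∀ {g k : G F n}, k ∈ K F n → (∀ r c, g.val r c ∈ 𝒪[F]) →
      ∀ r c, (g * k).val r c ∈ 𝒪[F] := fun hk hg r c => by
    rw [Units.val_mul, Matrix.mul_apply]
    exact sum_mem fun l _ => mul_mem (hg r l) (hk.1 l c)
  exact ⟨fun hg => by simpa using h (inv_mem hk) hg, h hk⟩

theorem integral_mul_left {g k : G F n} (hk : k ∈ K F n) :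
    (∀ r c, (k * g).val r c ∈ 𝒪[F]) ↔ ∀ r c, g.val r c ∈ 𝒪[F] := by
  have h : ∀ {g k : G F n}, k ∈ K F n → (∀ r c, g.val r c ∈ 𝒪[F]) →
      ∀ r c, (k * g).val r c ∈ 𝒪[F] := fun hk hg r c => by
    rw [Units.val_mul, Matrix.mul_apply]
    exact sum_mem fun l _ => mul_mem (hk.1 r l) (hg l c)
  exact ⟨fun hg => by simpa using h (inv_mem hk) hg, h hk⟩

theorem mul_mem_intDet_right {g k : G F n} (hk : k ∈ K F n) (i : ℤ) :
    g * k ∈ intDet F n i ↔ g ∈ intDet F n i := by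
  change _ ∧ _ ↔ _ ∧ _
  rw [integral_mul_right hk, valDet_mul, valDet_of_mem_K hk, add_zero]

theorem mul_mem_intDet_left {g k : G F n} (hk : k ∈ K F n) (i : ℤ) :
    k * g ∈ intDet F n i ↔ g ∈ intDet F n i := by
  change _ ∧ _ ↔ _ ∧ _
  rw [integral_mul_left hk, valDet_mul, valDet_of_mem_K hk, zero_add]

variable (F n) in
open Classical in
/-- The indices of the Hermite normal forms of the integral matrices whose determinant has
valuation `i`. -/
noncomputable def hermIdx (i : ℕ) : Finset (Σ _ : Fin n → ℕ, Fin n → Fin n → F) :=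
  (Finset.piAntidiag Finset.univ i).sigma fun a =>
    Fintype.piFinset fun r => Fintype.piFinset fun c =>
    if r < c then reps F (a r) else {0}

/-- The Hermite normal form with a given index. -/
noncomputable def hermOf (p : Σ _ : Fin n → ℕ, Fin n → Fin n → F) : G F n :=
  hermG (fun r => (p.1 r : ℤ)) p.2

theorem mem_hermIdx_iff {i : ℕ} {p : Σ _ : Fin n → ℕ, Fin n → Fin n → F} :
    p ∈ hermIdx F n i ↔ ∑ r, p.1 r = i ∧ IsReduced (fun r => (p.1 r : ℤ)) p.2 ∧
      ∀ r c, p.2 r c ∈ 𝒪[F] := by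
  rw [hermIdx, Finset.mem_sigma, Finset.mem_piAntidiag]
  simp only [Finset.mem_univ, implies_true, and_true, Fintype.mem_piFinset]
  refine and_congr_right fun _ => ⟨fun h => ⟨⟨fun r c hrc => ?_, fun r c hrc => ?_⟩, fun r c => ?_⟩,
    fun h r c => ?_⟩
  · have := h r c
    rw [if_pos hrc] at this
    exact (mem_reps_iff.1 this).2
  · have := h r c
    rw [if_neg hrc] at this
    exact Finset.mem_singleton.1 this
  · have := h r c
    split_ifs at this
    · exact (mem_reps_iff.1 this).1
    · rw [Finset.mem_singleton.1 this]
      exact zero_mem _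
  · split_ifs with hrc
    · exact mem_reps_iff.2 ⟨h.2 r c, h.1.1 r c hrc⟩
    · exact Finset.mem_singleton.2 (h.1.2 r c hrc)

theorem valDet_hermG (a : Fin n → ℤ) (r : Fin n → Fin n → F) : valDet (hermG a r) = ∑ i, a i := by
  rw [IsUpper.valDet (isUpper_hermMat a r)]
  simp only [hermG_val, hermMat_diag, val_unif_zpow]

/-- Right multiplication by `K` preserves integrality and the valuation of the determinant, so the
Hermite form of an integral matrix is integral with nonnegative diagonal exponents of sum `i`. The
union is finite, which also makes `intDet` compact and open. -/
theorem intDet_eq_biUnion (i : ℕ) :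
    intDet F n i = ⋃ p ∈ hermIdx F n i, hermOf p • (K F n : Set (G F n)) := by
  ext g
  simp only [Set.mem_iUnion, exists_prop, mem_coset_iff]
  constructor
  · rintro ⟨hg, hd⟩
    obtain ⟨a, r, hr, k, hk, h⟩ := exists_hermite g
    have hint := (integral_mul_right hk).2 hg
    rw [h] at hint
    have ha : ∀ j, 0 ≤ a j := fun j => by
      have := hint j j
      rwa [hermG_val, hermMat_diag, mem_integers_iff_val (unif_zpow_ne_zero _),
        val_unif_zpow] at this
    have haa : (fun j => ((a j).toNat : ℤ)) = a := funext fun j => Int.toNat_of_nonneg (ha j)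
    have hk' : hermOf ⟨fun j => (a j).toNat, r⟩ = g * k := by rw [h, hermOf, haa]
    refine ⟨⟨fun j => (a j).toNat, r⟩, mem_hermIdx_iff.2 ⟨?_, ?_, fun x y => ?_⟩, ?_⟩
    · have h1 := valDet_hermG a r
      rw [← h, valDet_mul, valDet_of_mem_K hk, add_zero, hd] at h1
      have h2 : (∑ j, (a j).toNat : ℤ) = ∑ j, a j := Finset.sum_congr rfl fun j _ => congrFun haa j
      rw [← h2] at h1
      exact_mod_cast h1.symm
    · simpa only [haa] using hr
    · rcases lt_or_ge x y with hxy | hxy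
      · have := hint x y
        rwa [hermG_val, hermMat_of_lt _ _ hxy] at this
      · change r x y ∈ _
        rw [hr.2 x y hxy.not_gt]
        exact zero_mem _
    · rw [hk', mul_inv_rev, inv_mul_cancel_right]
      exact inv_mem hk
  · rintro ⟨p, hp, hpg⟩
    obtain ⟨h1, h2, h3⟩ := mem_hermIdx_iff.1 hp
    have hg : g = hermOf p * ((hermOf p)⁻¹ * g) := by group
    rw [hg, mul_mem_intDet_right hpg]
    refine ⟨fun x y => ?_, ?_⟩
    · rw [hermOf, hermG_val]
      unfold hermMat
      rw [Matrix.of_apply]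
      split_ifs
      · exact h3 x y
      · rw [mem_integers_iff_val (unif_zpow_ne_zero _), val_unif_zpow]
        simp
      · exact zero_mem _
    · rw [hermOf, valDet_hermG]
      exact_mod_cast h1

theorem intDet_of_neg {i : ℤ} (hi : i < 0) : intDet F n i = ∅ := by
  rw [Set.eq_empty_iff_forall_notMem]
  rintro g ⟨h1, h2⟩
  have := val_nonneg_of_mem (det_ne_zero g) (det_mem_integers h1)
  rw [valDet] at h2
  omega

theorem pairwise_disjoint_hermOf (i : ℕ) : ((hermIdx F n i : Finset _) :
    Set (Σ _ : Fin n → ℕ, Fin n → Fin n → F)).Pairwise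
    (Function.onFun Disjoint fun p => hermOf p • (K F n : Set (G F n))) := by
  intro p hp p' hp' hne
  rw [Function.onFun, Set.disjoint_left]
  intro g hg hg'
  rw [mem_coset_iff] at hg hg'
  refine hne ?_
  have hk := mul_mem hg (inv_mem hg')
  obtain ⟨h1, h2⟩ := hermite_unique (mem_hermIdx_iff.1 hp).2.1 (mem_hermIdx_iff.1 hp').2.1
    (k := (hermOf p)⁻¹ * g * ((hermOf p')⁻¹ * g)⁻¹) hk
    (by change hermOf p * _ = hermOf p'; group)
  obtain ⟨a, r⟩ := p
  obtain ⟨a', r'⟩ := p'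
  have h3 : a = a' := funext fun j => by exact_mod_cast congrFun h1 j
  simp only at h2
  rw [h3, h2]

theorem isCompact_intDet (i : ℤ) : IsCompact (intDet F n i) := by
  rcases lt_or_ge i 0 with hi | hi
  · rw [intDet_of_neg hi]
    exact isCompact_empty
  · lift i to ℕ using hi
    rw [intDet_eq_biUnion]
    exact (hermIdx F n i).isCompact_biUnion fun p _ => isCompact_coset _

theorem isOpen_intDet (i : ℤ) : IsOpen (intDet F n i) := by
  rcases lt_or_ge i 0 with hi | hi
  · rw [intDet_of_neg hi]
    exact isOpen_empty
  · lift i to ℕ using hi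
    rw [intDet_eq_biUnion]
    exact isOpen_biUnion fun p _ => isOpen_coset _

/-- A right `K`-invariant function is constant on each coset, and all cosets have the volume of `K`.
This turns the integrals below into finite sums over Hermite forms. -/
theorem setIntegral_intDet (μ : Measure (G F n)) [μ.IsHaarMeasure] {f : G F n → E}
    (hf : ∀ g, ∀ k ∈ K F n, f (g * k) = f g) (i : ℕ) :
    ∫ g in intDet F n i, f g ∂μ =
      μ.real (K F n : Set (G F n)) • ∑ p ∈ hermIdx F n i, f (hermOf p) := by
  rw [intDet_eq_biUnion, integral_biUnion_finset _ (fun p _ => (isOpen_coset _).measurableSet)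
    (pairwise_disjoint_hermOf i) (fun p _ => integrableOn_coset μ hf _), Finset.smul_sum]
  exact Finset.sum_congr rfl fun p _ => setIntegral_coset μ hf _

end Topology

/-! ### The spherical vector summed over Hermite normal forms -/

section Spherical

variable {F : Type*} [Field F] [ValuativeRel F] [TopologicalSpace F]
  [IsNonarchimedeanLocalField F] {n : ℕ}

/-- The factor `χ(b) δ(b)^{1/2}` in terms of the valuations `a` of the diagonal entries of `b`. -/
noncomputable def borelWeight (F : Type*) [Field F] [ValuativeRel F] [TopologicalSpace F]
    [IsNonarchimedeanLocalField F] {n : ℕ} (z : Fin n → ℂˣ) (a : Fin n → ℤ) : ℂ :=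
  (∏ j, ((z j ^ a j : ℂˣ) : ℂ)) *
    (√(∏ i, ∏ j ∈ Finset.Ioi i, (resCard F : ℝ) ^ (a j - a i)) : ℝ)

theorem resCard_pos : (0 : ℝ) < resCard F := by
  exact_mod_cast (one_lt_resCard F).trans' zero_lt_one

theorem absF_of_ne_zero {x : F} (hx : x ≠ 0) : absF x = (resCard F : ℝ) ^ (-val x) := by
  rw [absF, if_neg hx]

theorem modulus_eq {b : G F n} (hb : IsUpper b.val) : modulus b =
    ∏ i, ∏ j ∈ Finset.Ioi i, (resCard F : ℝ) ^ (val (b.val j j) - val (b.val i i)) := by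
  unfold modulus
  refine Finset.prod_congr rfl fun i _ => Finset.prod_congr rfl fun j _ => ?_
  rw [absF_of_ne_zero (hb.diag_ne_zero i), absF_of_ne_zero (hb.diag_ne_zero j),
    ← zpow_sub₀ resCard_pos.ne']
  congr 1
  ring

theorem sphericalVector_mul_K (z : Fin n → ℂˣ) {b k : G F n} (hb : IsUpper b.val)
    (hk : k ∈ K F n) : sphericalVector z (b * k) = borelWeight F z fun j => val (b.val j j) := by
  rw [sphericalVector_mul z hb hk, modulus_eq hb]
  rfl

theorem borelWeight_add (z : Fin n → ℂˣ) (a a' : Fin n → ℤ) :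
    borelWeight F z (a + a') = borelWeight F z a * borelWeight F z a' := by
  have hpos : ∀ a : Fin n → ℤ,
      0 ≤ ∏ i, ∏ j ∈ Finset.Ioi i, (resCard F : ℝ) ^ (a j - a i) := fun a =>
    Finset.prod_nonneg fun i _ => Finset.prod_nonneg fun j _ => zpow_nonneg resCard_pos.le _
  have h : ∏ i, ∏ j ∈ Finset.Ioi i, (resCard F : ℝ) ^ ((a + a') j - (a + a') i) =
      (∏ i, ∏ j ∈ Finset.Ioi i, (resCard F : ℝ) ^ (a j - a i)) *
        ∏ i, ∏ j ∈ Finset.Ioi i, (resCard F : ℝ) ^ (a' j - a' i) := by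
    simp only [← Finset.prod_mul_distrib, ← zpow_add₀ resCard_pos.ne', Pi.add_apply]
    refine Finset.prod_congr rfl fun i _ => Finset.prod_congr rfl fun j _ => ?_
    congr 1
    ring
  unfold borelWeight
  rw [h, Real.sqrt_mul (hpos a)]
  simp only [Pi.add_apply, zpow_add, Units.val_mul, Finset.prod_mul_distrib]
  push_cast
  ring

theorem borelWeight_zero (z : Fin n → ℂˣ) : borelWeight F z 0 = 1 := by
  simp [borelWeight]

theorem sphericalVector_upper_mul (z : Fin n → ℂˣ) {b : G F n} (hb : IsUpper b.val) (g : G F n) :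
    sphericalVector z (b * g) =
      borelWeight F z (fun j => val (b.val j j)) * sphericalVector z g := by
  obtain ⟨c, k, hc, hk, rfl⟩ := exists_iwasawa g
  have hbc : IsUpper (b * c).val := by rw [Units.val_mul]; exact hb.mul hc
  rw [← mul_assoc, sphericalVector_mul_K z hbc hk, sphericalVector_mul_K z hc hk,
    ← borelWeight_add]
  congr 1
  ext j
  rw [Units.val_mul, hb.mul_diag hc, val_mul (hb.diag_ne_zero j) (hc.diag_ne_zero j)]
  rfl

theorem sphericalVector_K (z : Fin n → ℂˣ) {k : G F n} (hk : k ∈ K F n) :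
    sphericalVector z k = 1 := by
  have h := sphericalVector_mul_K (F := F) z (b := 1) (fun i j hij => by simp [hij.ne']) hk
  rw [one_mul] at h
  rw [h, ← borelWeight_zero (F := F) z]
  congr 1
  ext j
  simp

theorem sphericalVector_mul_right (z : Fin n → ℂˣ) (g k : G F n) (hk : k ∈ K F n) :
    sphericalVector z (g * k) = sphericalVector z g := by
  obtain ⟨b, k', hb, hk', rfl⟩ := exists_iwasawa g
  rw [mul_assoc, sphericalVector_mul_K z hb (mul_mem hk' hk), sphericalVector_mul_K z hb hk']

/-- The complete homogeneous symmetric polynomial of degree `i`. -/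
noncomputable def hsum {R : Type*} [CommSemiring R] (w : Fin n → R) (i : ℕ) : R :=
  ∑ a ∈ Finset.piAntidiag Finset.univ i, ∏ j, w j ^ a j

variable (F) in
/-- The factor `q ^ (i (n - 1) / 2)`. -/
noncomputable def satakeFactor (n i : ℕ) : ℝ := √((resCard F : ℝ) ^ ((n - 1) * i))

/-- Each index belongs to `n - 1` pairs: those above it and those below it. For `n = 0` both sides
are zero, so the truncated subtraction is harmless. -/
theorem sum_pairs (a : Fin n → ℕ) :
    ∑ i, ∑ j ∈ Finset.Ioi i, (a i + a j) = (n - 1) * ∑ i, a i := by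
  simp only [Finset.sum_add_distrib]
  have h : ∑ i : Fin n, ∑ j ∈ Finset.Ioi i, a j = ∑ j : Fin n, ∑ i ∈ Finset.Iio j, a j :=
    Finset.sum_comm' fun i j => by simp
  rw [h, ← Finset.sum_add_distrib, Finset.mul_sum]
  refine Finset.sum_congr rfl fun i _ => ?_
  rw [Finset.sum_const, Finset.sum_const, Fin.card_Ioi, Fin.card_Iio, smul_eq_mul, smul_eq_mul,
    ← add_mul]
  congr 1
  have := i.2
  omega

theorem card_hermIdx_fiber (a : Fin n → ℕ) :
    (Fintype.piFinset fun r : Fin n => Fintype.piFinset fun c : Fin n =>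
      if r < c then reps F (a r) else {0}).card =
      ∏ i, ∏ _j ∈ Finset.Ioi i, resCard F ^ a i := by
  rw [Fintype.card_piFinset]
  refine Finset.prod_congr rfl fun i _ => ?_
  rw [Fintype.card_piFinset, ← Finset.prod_subset (Finset.subset_univ (Finset.Ioi i))]
  · refine Finset.prod_congr rfl fun j hj => ?_
    rw [if_pos (Finset.mem_Ioi.1 hj), card_reps]
  · intro j _ hj
    rw [if_neg fun h => hj (Finset.mem_Ioi.2 h), Finset.card_singleton]

/-- The heart of the count: the number of Hermite forms with diagonal `ϖ ^ a` symmetrises the factor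
`δ^{1/2}`, and what remains depends on `a` only through its sum. -/
theorem card_mul_borelWeight (z : Fin n → ℂˣ) (a : Fin n → ℕ) :
    ((∏ i, ∏ _j ∈ Finset.Ioi i, resCard F ^ a i : ℕ) : ℂ) * borelWeight F z (fun j => (a j : ℤ)) =
      satakeFactor F n (∑ i, a i) * ∏ j, (z j : ℂ) ^ a j := by
  have hq := resCard_pos (F := F)
  have h : ((∏ i, ∏ _j ∈ Finset.Ioi i, resCard F ^ a i : ℕ) : ℝ) *
      √(∏ i, ∏ j ∈ Finset.Ioi i, (resCard F : ℝ) ^ ((a j : ℤ) - (a i : ℤ))) =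
      satakeFactor F n (∑ i, a i) := by
    set c : ℝ := ((∏ i, ∏ _j ∈ Finset.Ioi i, resCard F ^ a i : ℕ) : ℝ) with hc
    have hc0 : 0 ≤ c := Nat.cast_nonneg _
    -- The cardinality enters the root as its square, so a pair `i < j` contributes the exponent `2
    -- a i + (a j - a i) = a i + a j`.
    rw [satakeFactor, ← Real.sqrt_sq hc0, ← Real.sqrt_mul (sq_nonneg c), ← sum_pairs, hc]
    congr 1
    push_cast
    rw [← Finset.prod_pow, ← Finset.prod_mul_distrib, ← Finset.prod_pow_eq_pow_sum]
    refine Finset.prod_congr rfl fun i _ => ?_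
    rw [← Finset.prod_pow, ← Finset.prod_mul_distrib, ← Finset.prod_pow_eq_pow_sum]
    refine Finset.prod_congr rfl fun j _ => ?_
    rw [← zpow_natCast, ← zpow_natCast, ← zpow_natCast, ← zpow_mul, ← zpow_add₀ hq.ne']
    congr 1
    push_cast
    ring
  unfold borelWeight
  rw [← h]
  simp only [zpow_natCast, Units.val_pow_eq_pow_val]
  push_cast
  ring

theorem sum_sphericalVector (z : Fin n → ℂˣ) (i : ℕ) :
    ∑ p ∈ hermIdx F n i, sphericalVector z (hermOf p) =
      satakeFactor F n i * hsum (fun j => (z j : ℂ)) i := by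
  have hv : ∀ p : Σ _ : Fin n → ℕ, Fin n → Fin n → F,
      sphericalVector z (hermOf p) = borelWeight F z fun j => (p.1 j : ℤ) := fun p => by
    have := sphericalVector_mul_K z (b := hermOf p) (isUpper_hermMat _ _) (one_mem (K F n))
    rw [mul_one] at this
    rw [this]
    simp only [hermOf, hermG_val, hermMat_diag, val_unif_zpow]
  simp only [hv]
  rw [hermIdx, Finset.sum_sigma, hsum, Finset.mul_sum]
  refine Finset.sum_congr rfl fun a ha => ?_
  rw [Finset.mem_piAntidiag] at ha
  simp only
  rw [Finset.sum_const, nsmul_eq_mul, ← ha.1, ← card_mul_borelWeight, ← card_hermIdx_fiber]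

/-- Write `x = b k`. The factor `b` comes out by equivariance of the spherical vector, and `k` is
absorbed by left `K`-invariance of `intDet` and of the Haar measure; what is left is the finite sum
over Hermite forms. -/
theorem integral_indicator_sphericalVector (μ : Measure (G F n)) [μ.IsHaarMeasure]
    (z : Fin n → ℂˣ) (i : ℕ) (x : G F n) :
    ∫ g in intDet F n i, sphericalVector z (x * g) ∂μ =
      (μ.real (K F n : Set (G F n)) * (satakeFactor F n i * hsum (fun j => (z j : ℂ)) i)) *
        sphericalVector z x := by
  obtain ⟨b, k, hb, hk, rfl⟩ := exists_iwasawa x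
  have h1 : ∫ g in intDet F n i, sphericalVector z (k * g) ∂μ =
      ∫ g in intDet F n i, sphericalVector z g ∂μ := by
    rw [← integral_indicator (isOpen_intDet _).measurableSet,
      ← integral_indicator (isOpen_intDet _).measurableSet,
      ← integral_mul_left_eq_self ((intDet F n i).indicator (sphericalVector z)) k]
    congr 1
    ext g
    by_cases hg : g ∈ intDet F n i
    · rw [Set.indicator_of_mem hg, Set.indicator_of_mem ((mul_mem_intDet_left hk _).2 hg)]
    · rw [Set.indicator_of_notMem hg, Set.indicator_of_notMem
        fun h => hg ((mul_mem_intDet_left hk _).1 h)]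
  simp only [mul_assoc, sphericalVector_upper_mul z hb]
  rw [integral_const_mul, h1, setIntegral_intDet μ (sphericalVector_mul_right z),
    sum_sphericalVector, sphericalVector_K z hk, Complex.real_smul]
  ring

end Spherical

/-! ### Injectivity of the Satake transform and the element attached to `Sym^i` -/

section SatakeInjective

variable {F : Type*} [Field F] [ValuativeRel F] [TopologicalSpace F]
  [IsNonarchimedeanLocalField F] {n : ℕ}

/-- The valuations of the diagonal entries of the upper triangular part in the Iwasawa
decomposition of `g`. -/
noncomputable def exps (g : G F n) (j : Fin n) : ℤ := val ((exists_iwasawa g).choose.val j j)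

/-- Two Iwasawa decompositions differ by an upper triangular element of `K`, whose diagonal entries
are units; the choice made in `exps` is therefore immaterial. -/
theorem exps_mul {b k : G F n} (hb : IsUpper b.val) (hk : k ∈ K F n) :
    exps (b * k) = fun j => val (b.val j j) := by
  obtain ⟨k', hc, hk', h⟩ := (exists_iwasawa (b * k)).choose_spec
  ext j
  unfold exps
  set c := (exists_iwasawa (b * k)).choose
  have hw : c⁻¹ * b ∈ K F n := by
    have h1 : c⁻¹ * b = k' * k⁻¹ := by
      rw [inv_mul_eq_iff_eq_mul, ← mul_assoc, ← h, mul_inv_cancel_right]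
    rw [h1]
    exact mul_mem hk' (inv_mem hk)
  have hwu : IsUpper (c⁻¹ * b).val := by
    rw [Units.val_mul]
    exact hc.inv.mul hb
  have h1 : b.val j j = c.val j j * (c⁻¹ * b).val j j := by
    rw [← hc.mul_diag hwu, ← Units.val_mul, mul_inv_cancel_left]
  rw [h1, val_mul (hc.diag_ne_zero j) (hwu.diag_ne_zero j), hwu.val_diag_of_mem_K hw, add_zero]

theorem exps_mul_right (g k : G F n) (hk : k ∈ K F n) : exps (g * k) = exps g := by
  obtain ⟨b, k', hb, hk', rfl⟩ := exists_iwasawa g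
  rw [mul_assoc, exps_mul hb (mul_mem hk' hk), exps_mul hb hk']

theorem sphericalVector_eq (z : Fin n → ℂˣ) (g : G F n) :
    sphericalVector z g = borelWeight F z (exps g) := by
  obtain ⟨b, k, hb, hk, rfl⟩ := exists_iwasawa g
  rw [sphericalVector_mul_K z hb hk, exps_mul hb hk]

/-- The character `z ↦ ∏ z_j ^ a_j`. -/
def torusChar (a : Fin n → ℤ) : (Fin n → ℂˣ) →* ℂ where
  toFun z := ∏ j, ((z j ^ a j : ℂˣ) : ℂ)
  map_one' := by simp
  map_mul' z z' := by simp [mul_zpow, Finset.prod_mul_distrib]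

/-- The exponent at `j` is read off at the point with coordinate `2` in place `j` and `1` elsewhere.
Injectivity lets Dedekind's independence of characters apply to the family `torusChar`. -/
theorem torusChar_injective : Function.Injective (torusChar (n := n)) := by
  intro a b hab
  ext j
  set t : Fin n → ℂˣ := Function.update (1 : Fin n → ℂˣ) j (Units.mk0 (2 : ℂ) two_ne_zero)
  have ht : ∀ l, l ≠ j → t l = 1 := fun l hl => Function.update_of_ne hl _ _
  have h : ∏ l, ((t l ^ a l : ℂˣ) : ℂ) = ∏ l, ((t l ^ b l : ℂˣ) : ℂ) := DFunLike.congr_fun hab t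
  rw [Finset.prod_eq_single j, Finset.prod_eq_single j] at h
  · have htj : t j = Units.mk0 (2 : ℂ) two_ne_zero := Function.update_self _ _ _
    rw [htj] at h
    rw [Units.val_zpow_eq_zpow_val, Units.val_zpow_eq_zpow_val, Units.val_mk0] at h
    have h2 : ((2 : ℝ) ^ a j) = (2 : ℝ) ^ b j := Complex.ofReal_injective (by push_cast; exact h)
    exact zpow_right_injective₀ two_pos (by norm_num) h2
  · intro l _ hl
    simp [ht l hl]
  · simp
  · intro l _ hl
    simp [ht l hl]
  · simp

variable (F) in
/-- The factor `δ^{1/2}` in terms of the valuations of the diagonal entries. -/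
noncomputable def sqrtModulus (a : Fin n → ℤ) : ℝ :=
  √(∏ i, ∏ j ∈ Finset.Ioi i, (resCard F : ℝ) ^ (a j - a i))

theorem sqrtModulus_pos (a : Fin n → ℤ) : 0 < sqrtModulus F a :=
  Real.sqrt_pos.2 (Finset.prod_pos fun _ _ => Finset.prod_pos fun _ _ => zpow_pos resCard_pos _)

theorem borelWeight_eq (z : Fin n → ℂˣ) (a : Fin n → ℤ) :
    borelWeight F z a = torusChar a z * sqrtModulus F a := rfl

theorem finite_exps_image (h : Hecke F n) : (exps '' tsupport h.1).Finite := by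
  have hc : Continuous (exps : G F n → Fin n → ℤ) := continuous_of_K_invariant exps_mul_right
  exact isCompact_iff_finite.1 (h.2.2.isCompact.image hc)

theorem Hecke.mul_right (h : Hecke F n) (g k : G F n) (hk : k ∈ K F n) : h.1 (g * k) = h.1 g := by
  simpa using h.2.1 g 1 (one_mem _) k hk

theorem Hecke.mul_left (h : Hecke F n) (g k : G F n) (hk : k ∈ K F n) : h.1 (k * g) = h.1 g := by
  simpa using h.2.1 g k hk 1 (one_mem _)

theorem Hecke.integrable_mul (h : Hecke F n) (μ : Measure (G F n)) [IsFiniteMeasureOnCompacts μ]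
    {f : G F n → ℂ} (hf : Continuous f) : Integrable (fun g => h.1 g * f g) μ :=
  ((Hecke.continuous h).mul hf).integrable_of_hasCompactSupport h.2.2.mul_right

/-- Grouping by Iwasawa exponents, the spherical integral becomes a finite combination of the
characters `torusChar a`, with coefficients the positive number `sqrtModulus F a` times the integral
of `h` over `exps = a`. Independence of characters kills each coefficient. -/
theorem setIntegral_exps_eq_zero (μ : Measure (G F n)) [IsFiniteMeasureOnCompacts μ]
    (h : Hecke F n) (h0 : ∀ z : Fin n → ℂˣ, ∫ g, h.1 g * sphericalVector z g ∂μ = 0)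
    (a : Fin n → ℤ) : ∫ g, h.1 g * (if exps g = a then 1 else 0) ∂μ = 0 := by
  classical
  set A := (finite_exps_image h).toFinset
  have hcont : ∀ a : Fin n → ℤ, Continuous fun g : G F n => if exps g = a then (1 : ℂ) else 0 :=
    fun a => continuous_of_K_invariant fun g k hk => by rw [exps_mul_right g k hk]
  have hmem : ∀ g, h.1 g ≠ 0 → exps g ∈ A := fun g hg =>
    (finite_exps_image h).mem_toFinset.2 ⟨g, subset_tsupport _ hg, rfl⟩
  have hsum : ∀ z : Fin n → ℂˣ, ∑ a ∈ A,
      ((sqrtModulus F a : ℂ) * ∫ g, h.1 g * (if exps g = a then 1 else 0) ∂μ) • torusChar a z =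
        0 := by
    intro z
    refine Eq.trans ?_ (h0 z)
    have h1 : ∀ g, h.1 g * sphericalVector z g =
        ∑ a ∈ A, (h.1 g * (if exps g = a then 1 else 0)) * borelWeight F z a := by
      intro g
      by_cases hg : h.1 g = 0
      · simp [hg]
      · rw [Finset.sum_eq_single_of_mem _ (hmem g hg), if_pos rfl, mul_one, sphericalVector_eq]
        intro b _ hb
        rw [if_neg hb.symm, mul_zero, zero_mul]
    simp only [h1]
    rw [integral_finsetSum]
    · refine Finset.sum_congr rfl fun a _ => ?_
      rw [integral_mul_const, borelWeight_eq, smul_eq_mul]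
      ring
    · exact fun a _ => (Hecke.integrable_mul h μ (hcont a)).mul_const _
  by_cases ha : a ∈ A
  · have hli := (linearIndependent_monoidHom (Fin n → ℂˣ) ℂ).comp _
      (torusChar_injective (n := n))
    have := linearIndependent_iff'.1 hli A
      (fun a => (sqrtModulus F a : ℂ) * ∫ g, h.1 g * (if exps g = a then 1 else 0) ∂μ)
      (by
        ext z
        simpa using hsum z) a ha
    exact (mul_eq_zero.1 this).resolve_left (by exact_mod_cast (sqrtModulus_pos a).ne')
  · rw [integral_eq_zero_of_ae]
    refine Filter.Eventually.of_forall fun g => ?_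
    by_cases hg : h.1 g = 0
    · simp [hg]
    · have : exps g ≠ a := fun h => ha (h ▸ hmem g hg)
      simp [this]

/-- The Hermite reduction of row `i` leaves the rows below alone and produces a pivot of least
valuation. Hence the exponents beyond `i` are visible on the diagonal, and the one at `i` is at most
the valuation of the given entry. Rows above `i` are arbitrary. -/
theorem exists_iwasawa_of_rows {c : G F n} (i : Fin n)
    (hc : ∀ r, i < r → ∀ j < r, c.val r j = 0) (hci : c.val i i ≠ 0) :
    (∀ j, i < j → exps c j = val (c.val j j)) ∧ exps c i ≤ val (c.val i i) := by
  obtain ⟨k, hk, h1, h2, h3⟩ := exists_hermiteRow c i hc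
  obtain ⟨k', hk', h4, h5⟩ := exists_hermiteRows (i : ℕ) i.2.le (c * k) fun r hr j hj => by
    rcases eq_or_lt_of_le hr with h | h
    · have hri : r = i := Fin.ext h.symm
      rw [hri] at hj ⊢
      exact h2.1 j hj
    · rw [h1 r h]
      exact hc r h j hj
  have hU : IsUpper (c * k * k').val := fun r j hj => by
    rcases lt_trichotomy r i with h | h | h
    · exact (h5 r h).1 j hj
    · rw [h4 r (by rw [h]), h]
      rw [h] at hj
      exact h2.1 j hj
    · rw [h4 r (Fin.le_def.1 h.le), h1 r h]
      exact hc r h j hj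
  have he : exps c = fun j => val ((c * k * k').val j j) := by
    rw [← exps_mul hU (mul_mem (inv_mem hk') (inv_mem hk))]
    congr 1
    group
  rw [he]
  refine ⟨fun j hj => ?_, ?_⟩
  · simp only
    rw [h4 j (Fin.le_def.1 hj.le), h1 j hj]
  · simp only
    rw [h4 i le_rfl]
    exact (h3 i le_rfl hci).2

/-- If `a` is minimal, for the lexicographic order from the last coordinate, among the exponents
on the support of a bi-invariant function, then the elements of the support with exponents `a` are
in the double coset of `diag (ϖ ^ a)`. -/
theorem Hecke.eq_of_exps_minimal (h : Hecke F n) (a : Fin n → ℤ)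
    (hmin : ∀ g, h.1 g ≠ 0 → ∀ i, (∀ j, i < j → exps g j = a j) → a i ≤ exps g i)
    {g : G F n} (hg : h.1 g ≠ 0) (hga : exps g = a) : h.1 g = h.1 (hermG a 0) := by
  -- Starting from the triangular part of `g`, the columns are cleared above the diagonal from the
  -- last to the first by left multiplication by `K`, which changes neither `h` nor the diagonal.
  have key : ∀ m ≤ n, ∃ b : G F n, h.1 b = h.1 g ∧ IsUpper b.val ∧ (∀ j, val (b.val j j) = a j) ∧
      ∀ j : Fin n, n - m ≤ j → ∀ i < j, b.val i j = 0 := by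
    intro m hm
    induction m with
    | zero =>
      obtain ⟨b, k, hb, hk, rfl⟩ := exists_iwasawa g
      refine ⟨b, (Hecke.mul_right h b k hk).symm, hb, fun j => ?_, fun j hj => by omega⟩
      rw [← hga, exps_mul hb hk]
    | succ m ih =>
      obtain ⟨b, hbg, hbU, hba, hbm⟩ := ih (by omega)
      set i : Fin n := ⟨n - (m + 1), by omega⟩ with hi
      have hbm' : ∀ j, i < j → ∀ l < j, b.val l j = 0 := fun j hj => hbm j (by
        have : n - (m + 1) < (j : ℕ) := hj
        omega)
      -- Minimality of `a` gives the divisibility. Exchanging rows `r` and `i` stays in the support,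
      -- keeps the exponents beyond `i`, and makes the exponent at `i` at most the valuation of `b r
      -- i`.
      have hcol : ∀ r < i, b.val r i ≠ 0 → a i ≤ val (b.val r i) := by
        intro r hr hb0
        set c := (permG (Equiv.swap r i))⁻¹ * b with hc
        have hcapp : ∀ x y, c.val x y = b.val (Equiv.swap r i x) y := fun x y => by
          rw [hc, Units.val_mul, permG_inv_mul_apply]
        have hcrow : ∀ x, i < x → ∀ y, c.val x y = b.val x y := fun x hx y => by
          rw [hcapp, Equiv.swap_apply_of_ne_of_ne (hr.trans hx).ne' hx.ne']
        have hcii : c.val i i = b.val r i := by rw [hcapp, Equiv.swap_apply_right]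
        have hch : h.1 c ≠ 0 := by
          rw [hc, Hecke.mul_left h b _ (inv_mem (permG_mem_K _)), hbg]
          exact hg
        obtain ⟨h1, h2⟩ := exists_iwasawa_of_rows i (c := c)
          (fun x hx j hj => by rw [hcrow x hx, hbU x j hj]) (by rwa [hcii])
        rw [hcii] at h2
        exact (hmin c hch i fun j hj => by rw [h1 j hj, hcrow j hj, hba]).trans h2
      -- The multipliers that subtract multiples of row `i` from the rows above it; `hcol` makes
      -- them integral. The other columns are untouched, since the only nonzero entries of row `i`
      -- off the diagonal would lie in later columns, already cleared.
      set v : Fin n → F := fun r =>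
        if r = i then 1 else if r < i then -(b.val r i / b.val i i) else 0 with hv
      have hvi : v i = 1 := by simp [hv]
      have hvi0 : v i ≠ 0 := by rw [hvi]; exact one_ne_zero
      have hvO : ∀ r, v r ∈ 𝒪[F] := by
        intro r
        simp only [hv]
        split_ifs with h1 h2
        · exact one_mem _
        · exact neg_mem (div_mem_integers (hbU.diag_ne_zero i) fun h3 => by
            rw [hba]
            exact hcol r h2 h3)
        · exact zero_mem _
      set u := transposeG (rowG i v hvi0)
      have hu : u ∈ K F n := transposeG_mem_K (rowG_mem_K hvi0 hvO (by
        rw [hvi, inv_one]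
        exact one_mem _))
      have hub : ∀ r j, (u * b).val r j = if r < i ∧ j = i then 0 else b.val r j := by
        intro r j
        rw [Units.val_mul, transposeG_rowG_mul_apply]
        rcases lt_trichotomy r i with hr | hr | hr
        · rw [if_neg hr.ne]
          simp only [hv, if_neg hr.ne, if_pos hr]
          rcases lt_trichotomy j i with hj | hj | hj
          · rw [hbU i j hj, if_neg fun h => hj.ne h.2, mul_zero, zero_add]
          · rw [if_pos ⟨hr, hj⟩, hj, neg_mul, div_mul_cancel₀ _ (hbU.diag_ne_zero i),
              neg_add_cancel]
          · rw [hbm' j hj i hj, if_neg fun h => hj.ne' h.2, mul_zero, zero_add]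
        · rw [if_pos hr, hr, hvi, one_mul, add_zero, if_neg fun h => lt_irrefl _ h.1]
        · rw [if_neg hr.ne', if_neg fun h => hr.not_gt h.1]
          simp [hv, hr.ne', hr.not_gt]
      refine ⟨u * b, by rw [Hecke.mul_left h b u hu, hbg], fun r j hj => ?_, fun j => ?_,
        fun j hj r hr => ?_⟩
      · rw [hub, hbU r j hj, ite_self]
      · rw [hub, if_neg fun h => h.1.ne h.2, hba]
      · rw [hub]
        split_ifs with h1
        · rfl
        · have hij : i ≤ j := hj
          rcases eq_or_lt_of_le hij with h2 | h2
          · exact absurd ⟨h2 ▸ hr, h2.symm⟩ h1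
          · exact hbm' j h2 r hr
  obtain ⟨b, hbg, hbU, hba, hbd⟩ := key n le_rfl
  have hoff : ∀ r j, r ≠ j → b.val r j = 0 := fun r j hrj => by
    rcases lt_or_gt_of_ne hrj with h1 | h1
    · exact hbd j (by omega) r h1
    · exact hbU r j h1
  -- Now `b` is diagonal with valuations `a`, so it differs from `diag (ϖ ^ a)` by a diagonal matrix
  -- of units.
  obtain ⟨d, hDd⟩ : ∃ d, hermG a 0 * d = b := ⟨_, mul_inv_cancel_left _ _⟩
  have hdapp : ∀ r j, unif F ^ a r * d.val r j = b.val r j := fun r j => by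
    rw [← hDd, Units.val_mul, Matrix.mul_apply, Finset.sum_eq_single r, hermG_val, hermMat_diag]
    · intro l _ hl
      simp [hermMat, hl.symm]
    · simp
  have hdK : d ∈ K F n := by
    refine mem_K_of_integral (fun r j => ?_) ?_
    · by_cases hrj : r = j
      · have h1 : d.val r j ≠ 0 := fun h1 => by
          have := hdapp r j
          rw [h1, mul_zero, hrj] at this
          exact hbU.diag_ne_zero j this.symm
        have h2 := congrArg val (hdapp r j)
        rw [val_mul (unif_zpow_ne_zero _) h1, val_unif_zpow, ← hrj, hba] at h2
        rw [← hrj] at h1 ⊢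
        rw [mem_integers_iff_val h1]
        omega
      · have := hdapp r j
        rw [hoff r j hrj] at this
        rw [(mul_eq_zero.1 this).resolve_left (unif_zpow_ne_zero _)]
        exact zero_mem _
    · have h1 := congrArg valDet hDd
      rw [valDet_mul, valDet_hermG, hbU.valDet] at h1
      simp only [hba] at h1
      omega
  rw [← hbg, ← hDd, Hecke.mul_right h _ d hdK]

/-- If `h ≠ 0`, take the colexicographically least exponent `a` on its support. By
`Hecke.eq_of_exps_minimal`, `h` is constant and nonzero on the nonempty open set of support points
with exponent `a`. Its integral there is thus nonzero, against `setIntegral_exps_eq_zero`. -/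
theorem Hecke.eq_zero_of_integral (μ : Measure (G F n)) [μ.IsHaarMeasure]
    (h : Hecke F n) (h0 : ∀ z : Fin n → ℂˣ, ∫ g, h.1 g * sphericalVector z g ∂μ = 0) : h = 0 := by
  classical
  by_contra hne
  obtain ⟨g₁, hg₁⟩ : ∃ g, h.1 g ≠ 0 := by
    by_contra hall
    push Not at hall
    exact hne (Subtype.ext (funext hall))
  have hfin : (exps '' Function.support h.1).Finite :=
    (finite_exps_image h).subset (Set.image_mono (subset_tsupport _))
  obtain ⟨a, ha, hmin⟩ := Set.exists_min_image _ (fun a : Fin n → ℤ => toColex a) hfin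
    ⟨_, g₁, hg₁, rfl⟩
  obtain ⟨g₀, hg₀, hg₀a⟩ := ha
  have hmin' : ∀ g, h.1 g ≠ 0 → ∀ i, (∀ j, i < j → exps g j = a j) → a i ≤ exps g i := by
    intro g hg i hi
    by_contra hlt
    -- In the colexicographic order the last differing coordinate decides; here that coordinate is
    -- `i`.
    exact (hmin _ ⟨g, hg, rfl⟩).not_gt ⟨i, fun j hj => hi j hj, not_le.1 hlt⟩
  have hval : ∀ g, h.1 g ≠ 0 → exps g = a → h.1 g = h.1 g₀ := fun g hg hga => by
    rw [Hecke.eq_of_exps_minimal h a hmin' hg hga, Hecke.eq_of_exps_minimal h a hmin' hg₀ hg₀a]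
  set S : Set (G F n) := {g | h.1 g ≠ 0 ∧ exps g = a} with hS
  have hSopen : IsOpen S := by
    rw [hS]
    have h2 : IsLocallyConstant fun g : G F n => (h.1 g ≠ 0 ∧ exps g = a : Prop) := by
      refine (IsLocallyConstant.iff_exists_open _).2 fun g => ?_
      refine ⟨g • (K F n : Set (G F n)), isOpen_coset g, ⟨1, one_mem _, mul_one g⟩, ?_⟩
      rintro _ ⟨k, hk, rfl⟩
      simp only [smul_eq_mul, Hecke.mul_right h g k hk, exps_mul_right g k hk]
    have := h2.isOpen_fiber True
    simpa using this
  have hSfin : μ S < ⊤ := (measure_mono fun g hg => subset_tsupport h.1 hg.1).trans_lt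
    h.2.2.isCompact.measure_lt_top
  have hint := setIntegral_exps_eq_zero μ h h0 a
  have heq : (fun g => h.1 g * (if exps g = a then 1 else 0)) = S.indicator fun _ => h.1 g₀ := by
    ext g
    by_cases hg : g ∈ S
    · rw [Set.indicator_of_mem hg, if_pos hg.2, mul_one, hval g hg.1 hg.2]
    · rw [Set.indicator_of_notMem hg]
      by_cases hga : exps g = a
      · have : h.1 g = 0 := by_contra fun h1 => hg ⟨h1, hga⟩
        rw [this, zero_mul]
      · rw [if_neg hga, mul_zero]
  rw [heq, integral_indicator hSopen.measurableSet, setIntegral_const, Complex.real_smul,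
    mul_eq_zero] at hint
  rcases hint with h1 | h1
  · have h2 : μ.real S = 0 := by exact_mod_cast h1
    exact (ENNReal.toReal_pos (hSopen.measure_pos μ ⟨g₀, hg₀, hg₀a⟩).ne' hSfin.ne).ne' h2
  · exact hg₀ h1

theorem IsSatakeTransform.unique (μ : Measure (G F n)) [μ.IsHaarMeasure] {h h' : Hecke F n}
    {p : (Fin n → ℂˣ) → ℂ} (hp : IsSatakeTransform μ h p) (hp' : IsSatakeTransform μ h' p) :
    h = h' := by
  rw [← sub_eq_zero]
  refine Hecke.eq_zero_of_integral μ _ fun z => ?_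
  have hc : Continuous (sphericalVector z : G F n → ℂ) :=
    continuous_of_K_invariant (sphericalVector_mul_right z)
  have h1 := hp z 1
  have h2 := hp' z 1
  simp only [one_mul] at h1 h2
  have h3 : ∀ g, (h - h').1 g * sphericalVector z g =
      h.1 g * sphericalVector z g - h'.1 g * sphericalVector z g := fun g => sub_mul _ _ _
  simp only [h3]
  rw [integral_sub (Hecke.integrable_mul h μ hc) (Hecke.integrable_mul h' μ hc), h1, h2, sub_self]

open Classical in
/-- The characteristic function of the integral matrices whose determinant has valuation `i`. -/
noncomputable def intDetHecke (F : Type*) [Field F] [ValuativeRel F] [TopologicalSpace F]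
    [IsNonarchimedeanLocalField F] (n : ℕ) (i : ℕ) : Hecke F n :=
  ⟨(intDet F n i).indicator 1, fun g k hk k' hk' => by
    have : k * g * k' ∈ intDet F n i ↔ g ∈ intDet F n i := by
      rw [mul_mem_intDet_right hk', mul_mem_intDet_left hk]
    simp only [Set.indicator_apply, this, Pi.one_apply],
    HasCompactSupport.intro (isCompact_intDet (i : ℤ)) fun g hg => Set.indicator_of_notMem hg _⟩

variable (F n) in
theorem satakeFactor_pos (i : ℕ) : 0 < satakeFactor F n i :=
  Real.sqrt_pos.2 (pow_pos resCard_pos _)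

/-- The element of the Hecke algebra whose Satake transform is the complete homogeneous symmetric
polynomial of degree `i`. -/
noncomputable def symHecke (μ : Measure (G F n)) (i : ℕ) : Hecke F n :=
  ((μ.real (K F n : Set (G F n)) * satakeFactor F n i : ℝ) : ℂ)⁻¹ • intDetHecke F n i

theorem symHecke_apply (μ : Measure (G F n)) (i : ℕ) (g : G F n) :
    (symHecke μ i).1 g = ((μ.real (K F n : Set (G F n)) * satakeFactor F n i : ℝ) : ℂ)⁻¹ *
      (intDet F n i).indicator 1 g := rfl

theorem isSatakeTransform_symHecke (μ : Measure (G F n)) [μ.IsHaarMeasure] (i : ℕ) :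
    IsSatakeTransform μ (symHecke μ i) fun z => hsum (fun j => (z j : ℂ)) i := by
  intro z x
  have h1 : ∀ g, (symHecke μ i).1 g * sphericalVector z (x * g) =
      ((μ.real (K F n : Set (G F n)) * satakeFactor F n i : ℝ) : ℂ)⁻¹ *
        (intDet F n i).indicator (fun g => sphericalVector z (x * g)) g := fun g => by
    rw [symHecke_apply, mul_assoc]
    by_cases hg : g ∈ intDet F n i
    · simp [Set.indicator_of_mem hg]
    · simp [Set.indicator_of_notMem hg]
  simp only [h1]
  rw [integral_const_mul, integral_indicator (isOpen_intDet _).measurableSet,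
    integral_indicator_sphericalVector]
  have h2 : (μ.real (K F n : Set (G F n)) : ℂ) ≠ 0 := by
    exact_mod_cast (measureReal_K_pos μ).ne'
  have h3 : (satakeFactor F n i : ℂ) ≠ 0 := by exact_mod_cast (satakeFactor_pos F n i).ne'
  push_cast
  field_simp

end SatakeInjective

/-! ### Additive Haar measure on `Mat_n(F)` compared with Haar measure on `G` -/

section Modulus

variable {F : Type*} [Field F] [ValuativeRel F] [TopologicalSpace F]
  [IsNonarchimedeanLocalField F] {n : ℕ}

variable (F n) in
/-- `Mat_n(𝒪)`. -/
def intMat : Set (Mat F n) := {X | ∀ i j, X i j ∈ 𝒪[F]}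

theorem measure_intMat_ne_zero (ρ : Measure (Mat F n)) [ρ.IsAddHaarMeasure] :
    ρ (intMat F n) ≠ 0 :=
  ((isOpen_integral F n).measure_pos ρ ⟨0, fun _ _ => zero_mem _⟩).ne'

theorem measure_intMat_ne_top (ρ : Measure (Mat F n)) [ρ.IsAddHaarMeasure] :
    ρ (intMat F n) ≠ ⊤ := (isCompact_integral F n).measure_lt_top.ne

theorem mul_mem_intMat {X Y : Mat F n} (hX : X ∈ intMat F n) (hY : Y ∈ intMat F n) :
    X * Y ∈ intMat F n := fun i j => by
  rw [Matrix.mul_apply]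
  exact sum_mem fun l _ => mul_mem (hX i l) (hY l j)

theorem smul_intMat_of_mem_K {k : G F n} (hk : k ∈ K F n) : k • intMat F n = intMat F n := by
  ext X
  rw [Set.mem_smul_set_iff_inv_smul_mem]
  refine ⟨fun h => ?_, fun h => mul_mem_intMat hk.2 h⟩
  have h1 : X = k.val * (k⁻¹ • X) := (smul_inv_smul k X).symm
  rw [h1]
  exact mul_mem_intMat hk.1 h

/-- `distribHaarChar` measures how left multiplication scales additive volume, and `K` preserves
`Mat_n(𝒪)`, of positive finite volume. This is the first of three cases (`K`, diagonal, `N`) joined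
by the Iwasawa decomposition. -/
theorem distribHaarChar_of_mem_K {k : G F n} (hk : k ∈ K F n) :
    distribHaarChar (Mat F n) k = 1 :=
  distribHaarChar_eq_of_measure_smul_eq_mul (measure_intMat_ne_zero Measure.addHaar)
    (measure_intMat_ne_top Measure.addHaar) (by rw [smul_intMat_of_mem_K hk]; simp)

theorem hermG_zero_mul_apply (a : Fin n → ℤ) (X : Mat F n) (r j : Fin n) :
    ((hermG a 0 : G F n).val * X) r j = unif F ^ a r * X r j := by
  rw [Matrix.mul_apply, Finset.sum_eq_single r, hermG_val, hermMat_diag]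
  · intro l _ hl
    simp [hermMat, hl.symm]
  · simp

theorem mul_hermG_zero_apply (a : Fin n → ℤ) (X : Mat F n) (r j : Fin n) :
    (X * (hermG a 0 : G F n).val) r j = X r j * unif F ^ a j := by
  rw [Matrix.mul_apply, Finset.sum_eq_single j, hermG_val, hermMat_diag]
  · intro l _ hl
    simp [hermMat, hl]
  · simp

theorem hermG_zero_add (a b : Fin n → ℤ) :
    (hermG (a + b) 0 : G F n) = hermG a 0 * hermG b 0 := by
  ext r j
  rw [Units.val_mul, hermG_zero_mul_apply, hermG_val, hermG_val]
  by_cases h : r = j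
  · rw [h, hermMat_diag, hermMat_diag, Pi.add_apply, zpow_add₀ unif_ne_zero]
  · simp [hermMat, h]

/-- `Mat_n(𝒪)` is the disjoint union of the translates of `D • Mat_n(𝒪)` by representatives modulo
`ϖ ^ a i` of all `n` entries of each row `i`; there are `q ^ (n ∑ a i)` of them, of equal volume. -/
theorem distribHaarChar_diag_nat (a : Fin n → ℕ) :
    distribHaarChar (Mat F n) (hermG (fun i => (a i : ℤ)) 0 : G F n) =
      ((resCard F : NNReal) ^ (n * ∑ i, a i))⁻¹ := by
  classical
  set D : G F n := hermG (fun i => (a i : ℤ)) 0 with hD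
  let R : Finset (Mat F n) := Fintype.piFinset fun i => Fintype.piFinset fun _ => reps F (a i)
  have hcard : R.card = resCard F ^ (n * ∑ i, a i) := by
    refine (Fintype.card_piFinset _).trans ?_
    simp only [Fintype.card_piFinset, card_reps, Finset.prod_const, Finset.card_univ,
      Fintype.card_fin, ← pow_mul]
    rw [Finset.prod_pow_eq_pow_sum, ← Finset.sum_mul, mul_comm]
  have hmem : ∀ X Y : Mat F n, Y ∈ X +ᵥ (D • intMat F n) ↔
      ∀ i j, Y i j - X i j ∈ ball F (a i : ℤ) := fun X Y => by
    rw [Set.mem_vadd_set_iff_neg_vadd_mem, vadd_eq_add, neg_add_eq_sub]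
    constructor
    · rintro ⟨Z, hZ, h⟩ i j
      have h1 : Y i j - X i j = unif F ^ (a i : ℤ) * Z i j := by
        have h2 : D.val * Z = Y - X := h
        rw [← Matrix.sub_apply, ← h2]
        exact hermG_zero_mul_apply _ Z i j
      rw [mem_ball, h1, mul_div_cancel_left₀ _ (unif_zpow_ne_zero _)]
      exact hZ i j
    · intro h
      let Z : Mat F n := Matrix.of fun i j => (Y i j - X i j) / unif F ^ (a i : ℤ)
      refine ⟨Z, h, ?_⟩
      ext i j
      refine (hermG_zero_mul_apply _ Z i j).trans ?_
      exact mul_div_cancel₀ _ (unif_zpow_ne_zero _)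
  have hR : ∀ X, X ∈ R ↔ ∀ i j, X i j ∈ reps F (a i) := fun X =>
    Fintype.mem_piFinset.trans (forall_congr' fun i => Fintype.mem_piFinset)
  have hunion : intMat F n = ⋃ X ∈ R, X +ᵥ (D • intMat F n) := by
    ext Y
    simp only [Set.mem_iUnion, exists_prop, hmem]
    constructor
    · intro hY
      refine ⟨Matrix.of fun i j => sec (a i : ℤ) (Y i j), (hR _).2 fun i j => ?_,
        fun i j => sec_sub_mem _ _⟩
      exact mem_reps_iff.2 ⟨sec_mem_integers (by simp) (hY i j), sec_sec _ _⟩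
    · rintro ⟨X, hX, h⟩ i j
      have h1 := add_mem (ball_le_integers (by simp) (h i j))
        (mem_reps_iff.1 ((hR X).1 hX i j)).1
      simpa using h1
  have hopen : ∀ X : Mat F n, IsOpen (X +ᵥ (D • intMat F n)) := fun X =>
    ((isOpen_integral F n).smul D).vadd X
  have hdisj : (R : Set (Mat F n)).PairwiseDisjoint
      fun X => X +ᵥ (D • intMat F n) := by
    intro X hX X' hX' hne
    rw [Function.onFun, Set.disjoint_left]
    intro Y hY hY'
    refine hne (Matrix.ext fun i j => ?_)
    have h1 := (hmem X Y).1 hY i j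
    have h2 := (hmem X' Y).1 hY' i j
    have h3 : X' i j - X i j ∈ ball F (a i : ℤ) := by simpa using sub_mem h1 h2
    rw [← (mem_reps_iff.1 ((hR X).1 hX i j)).2, ← (mem_reps_iff.1 ((hR X').1 hX' i j)).2]
    exact sec_eq_sec_iff.2 h3
  set ρ : Measure (Mat F n) := Measure.addHaar
  have hsum : ρ (intMat F n) = (R.card : ENNReal) * ρ (D • intMat F n) := by
    conv_lhs => rw [hunion]
    rw [measure_biUnion_finset hdisj fun X _ => (hopen X).measurableSet]
    simp only [measure_vadd, Finset.sum_const, nsmul_eq_mul]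
  have hq : (R.card : NNReal) ≠ 0 := by
    rw [hcard]
    exact_mod_cast pow_ne_zero _ (one_lt_resCard F).ne_bot
  refine distribHaarChar_eq_of_measure_smul_eq_mul (measure_intMat_ne_zero ρ)
    (measure_intMat_ne_top ρ) ?_
  have hq' : ((resCard F : NNReal) ^ (n * ∑ i, a i)) = (R.card : NNReal) := by
    rw [hcard]
    push_cast
    rfl
  rw [hq', hsum, ENNReal.coe_inv hq, ← mul_assoc, ENNReal.coe_natCast,
    ENNReal.inv_mul_cancel (by exact_mod_cast hq) (ENNReal.natCast_ne_top _), one_mul]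

theorem resCard_nnreal_ne_zero : (resCard F : NNReal) ≠ 0 := by
  exact_mod_cast (one_lt_resCard F).ne_bot

/-- Positive and negative parts of `a` reduce this to nonnegative exponents by multiplicativity. -/
theorem distribHaarChar_diag (a : Fin n → ℤ) :
    distribHaarChar (Mat F n) (hermG a 0 : G F n) = (resCard F : NNReal) ^ (-(n * ∑ i, a i) : ℤ) := by
  have h : (fun i => ((a i).toNat : ℤ)) = a + fun i => ((-a i).toNat : ℤ) := by
    ext i
    simp only [Pi.add_apply]
    omega
  have h1 := distribHaarChar_diag_nat (F := F) fun i => (a i).toNat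
  rw [h, hermG_zero_add, map_mul, distribHaarChar_diag_nat] at h1
  have hq := resCard_nnreal_ne_zero (F := F)
  have h2 : distribHaarChar (Mat F n) (hermG a 0 : G F n) =
      ((resCard F : NNReal) ^ (n * ∑ i, (a i).toNat))⁻¹ *
        (resCard F : NNReal) ^ (n * ∑ i, (-a i).toNat) := by
    rw [← h1, mul_assoc, inv_mul_cancel₀ (pow_ne_zero _ hq), mul_one]
  rw [h2, ← zpow_natCast, ← zpow_natCast, ← zpow_neg, ← zpow_add₀ hq]
  congr 1
  push_cast
  have h3 : ∑ i, ((a i).toNat : ℤ) = ∑ i, a i + ∑ i, ((-a i).toNat : ℤ) := by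
    rw [← Finset.sum_add_distrib]
    exact Finset.sum_congr rfl fun i _ => congrFun h i
  rw [h3]
  ring

/-- A character with commutative values is invariant under conjugation, and a sufficiently
contracting diagonal matrix conjugates `u` into `K`. -/
theorem distribHaarChar_of_mem_N {u : G F n} (hu : u ∈ N F n) :
    distribHaarChar (Mat F n) u = 1 := by
  obtain ⟨M, hM0, hM⟩ : ∃ M : ℤ, 0 ≤ M ∧ ∀ i j, 0 ≤ val (u.val i j) + M := by
    refine ⟨∑ i, ∑ j, |val (u.val i j)|, Finset.sum_nonneg fun _ _ =>
      Finset.sum_nonneg fun _ _ => abs_nonneg _, fun i j => ?_⟩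
    have h1 : |val (u.val i j)| ≤ ∑ j, |val (u.val i j)| :=
      Finset.single_le_sum (f := fun j => |val (u.val i j)|) (fun _ _ => abs_nonneg _)
        (Finset.mem_univ j)
    have h2 : ∑ j, |val (u.val i j)| ≤ ∑ i, ∑ j, |val (u.val i j)| :=
      Finset.single_le_sum (f := fun i => ∑ j, |val (u.val i j)|)
        (fun _ _ => Finset.sum_nonneg fun _ _ => abs_nonneg _) (Finset.mem_univ i)
    have h3 := neg_abs_le (val (u.val i j))
    omega
  -- Conjugation multiplies the `(i, j)` entry by `ϖ ^ (M (j - i))`, at least `ϖ ^ M` in valuation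
  -- above the diagonal, and `M` bounds the denominators of `u`.
  set a : Fin n → ℤ := fun i => -(M * i) with ha
  set t : G F n := hermG a 0
  have htinv : t⁻¹ = hermG (-a) 0 := by
    rw [inv_eq_iff_mul_eq_one, ← hermG_zero_add, add_neg_cancel]
    ext i j
    rw [hermG_val]
    by_cases h : i = j
    · rw [h, hermMat_diag]; simp
    · simp [hermMat, h]
  have happ : ∀ i j, (t * u * t⁻¹).val i j = unif F ^ a i * u.val i j * unif F ^ (-a j) :=
    fun i j => by
      rw [htinv, Units.val_mul, mul_hermG_zero_apply, Units.val_mul, hermG_zero_mul_apply]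
      rfl
  have hK : t * u * t⁻¹ ∈ K F n := by
    refine mem_K_of_integral (fun i j => ?_) ?_
    · rw [happ]
      rcases lt_trichotomy i j with h | h | h
      · refine mem_integers_of_val fun h0 => ?_
        have hu0 : u.val i j ≠ 0 := fun h1 => h0 (by rw [h1, mul_zero, zero_mul])
        rw [val_mul (mul_ne_zero (unif_zpow_ne_zero _) hu0) (unif_zpow_ne_zero _),
          val_mul (unif_zpow_ne_zero _) hu0, val_unif_zpow, val_unif_zpow]
        have h1 := hM i j
        have h2 : (i : ℤ) + 1 ≤ j := by exact_mod_cast Nat.succ_le_of_lt (Fin.lt_def.1 h)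
        simp only [ha]
        nlinarith
      · rw [h, hu.2, mul_one, ← zpow_add₀ unif_ne_zero, add_neg_cancel, zpow_zero]
        exact one_mem _
      · rw [hu.1 i j h, mul_zero, zero_mul]
        exact zero_mem _
    · rw [valDet_mul, valDet_mul, valDet_of_mem_N hu, htinv, valDet_hermG, valDet_hermG]
      simp
  have h := distribHaarChar_of_mem_K hK
  rw [map_mul, map_mul, mul_right_comm, ← map_mul, mul_inv_cancel, map_one, one_mul] at h
  exact h

theorem distribHaarChar_eq (g : G F n) :
    distribHaarChar (Mat F n) g = (resCard F : NNReal) ^ (-(n * valDet g)) := by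
  obtain ⟨a, r, -, k, hk, h⟩ := exists_hermite g
  have hu : hermG a r * (hermG a 0 : G F n)⁻¹ ∈ N F n := by
    have h1 : IsUpper (hermG a 0 : G F n)⁻¹.val := IsUpper.inv (isUpper_hermMat a 0)
    refine ⟨(isUpper_hermMat a r).mul h1, fun i => ?_⟩
    have h2 := IsUpper.diag_inv (b := (hermG a 0 : G F n)) (isUpper_hermMat a 0) i
    rw [Units.val_mul, IsUpper.mul_diag (show IsUpper (hermG a r).val from isUpper_hermMat a r) h1, h2]
    simp only [hermG_val, hermMat_diag]
    exact mul_inv_cancel₀ (unif_zpow_ne_zero _)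
  have hg : g = hermG a r * (hermG a 0 : G F n)⁻¹ * hermG a 0 * k⁻¹ := by
    rw [inv_mul_cancel_right, ← h, mul_inv_cancel_right]
  have hd : valDet g = ∑ i, a i := by
    rw [← valDet_hermG a r, ← h, valDet_mul, valDet_of_mem_K hk, add_zero]
  rw [hd, hg, map_mul, map_mul, distribHaarChar_of_mem_K (inv_mem hk), distribHaarChar_of_mem_N hu,
    one_mul, mul_one, distribHaarChar_diag]

theorem onG_apply (ρ : Measure (Mat F n)) (s : Set (G F n)) :
    onG ρ s = ρ (Units.val '' s) :=
  (isOpenEmbedding_val F n).measurableEmbedding.comap_apply ρ s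

theorem onG_smul (ρ : Measure (Mat F n)) [ρ.IsAddHaarMeasure] (g : G F n) (s : Set (G F n)) :
    onG ρ (g • s) = distribHaarChar (Mat F n) g * onG ρ s := by
  rw [onG_apply, onG_apply, distribHaarChar_mul]
  congr 1
  ext X
  constructor
  · rintro ⟨_, ⟨x, hx, rfl⟩, rfl⟩
    exact ⟨x.val, ⟨x, hx, rfl⟩, rfl⟩
  · rintro ⟨_, ⟨x, hx, rfl⟩, rfl⟩
    exact ⟨g * x, ⟨x, hx, rfl⟩, rfl⟩

theorem onG_isFiniteMeasureOnCompacts (ρ : Measure (Mat F n)) [ρ.IsAddHaarMeasure] :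
    IsFiniteMeasureOnCompacts (onG ρ) :=
  ⟨fun C hC => by
    rw [onG_apply]
    exact (hC.image Units.continuous_val).measure_lt_top⟩

/-- The function `|det g| ^ (-n)`. -/
noncomputable def detWeight (g : G F n) : NNReal := (resCard F : NNReal) ^ (n * valDet g)

theorem detWeight_mul (g h : G F n) : detWeight (g * h) = detWeight g * detWeight h := by
  unfold detWeight
  rw [valDet_mul, mul_add, zpow_add₀ resCard_nnreal_ne_zero]

theorem continuous_detWeight : Continuous (detWeight : G F n → NNReal) :=
  continuous_of_K_invariant fun g k hk => by
    rw [detWeight_mul]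
    unfold detWeight
    rw [valDet_of_mem_K hk]
    simp

/-- The Haar measure `|det g| ^ (-n) dρ(g)` on `G`. -/
noncomputable def haarOfAdd (ρ : Measure (Mat F n)) : Measure (G F n) :=
  (onG ρ).withDensity fun g => (detWeight g : ENNReal)

theorem map_mul_left_onG (ρ : Measure (Mat F n)) [ρ.IsAddHaarMeasure] (g : G F n) :
    (onG ρ).map (g * ·) = (detWeight g : ENNReal) • onG ρ := by
  ext s hs
  have h1 : (g * ·) ⁻¹' s = g⁻¹ • s := by
    ext x
    rw [Set.mem_smul_set_iff_inv_smul_mem, inv_inv]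
    rfl
  rw [Measure.map_apply (measurable_const_mul g) hs, h1, onG_smul, map_inv,
    distribHaarChar_eq, zpow_neg, inv_inv]
  rfl

/-- The push-forward of `onG ρ` under `x ↦ g x` is `detWeight g` times `onG ρ`, and the density also
picks up the factor `detWeight g`; the two cancel. -/
instance (ρ : Measure (Mat F n)) [ρ.IsAddHaarMeasure] : (haarOfAdd ρ).IsMulLeftInvariant := by
  refine ⟨fun g => Measure.ext fun s hs => ?_⟩
  have hw : Measurable fun g : G F n => (detWeight g : ENNReal) :=
    continuous_detWeight.measurable.coe_nnreal_ennreal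
  have hm := measurable_const_mul g
  have hg0 : (detWeight g : ENNReal) ≠ 0 := by
    exact_mod_cast zpow_ne_zero _ resCard_nnreal_ne_zero
  have h1 := setLIntegral_map (μ := onG ρ) (s := s) hs hw hm
  rw [map_mul_left_onG, Measure.restrict_smul, lintegral_smul_measure] at h1
  simp only [detWeight_mul, ENNReal.coe_mul, smul_eq_mul] at h1
  rw [lintegral_const_mul _ hw, ENNReal.mul_right_inj hg0 ENNReal.coe_ne_top] at h1
  rw [Measure.map_apply hm hs, haarOfAdd, withDensity_apply _ hs, withDensity_apply _ (hm hs), h1]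

instance (ρ : Measure (Mat F n)) [ρ.IsAddHaarMeasure] :
    IsFiniteMeasureOnCompacts (haarOfAdd ρ) := by
  refine ⟨fun C hC => ?_⟩
  obtain ⟨B, hB⟩ := hC.bddAbove_image (f := (detWeight : G F n → NNReal))
    continuous_detWeight.continuousOn
  have := onG_isFiniteMeasureOnCompacts ρ
  rw [haarOfAdd, withDensity_apply _ hC.measurableSet]
  calc ∫⁻ g in C, (detWeight g : ENNReal) ∂(onG ρ) ≤ ∫⁻ _ in C, (B : ENNReal) ∂(onG ρ) :=
        setLIntegral_mono measurable_const fun g hg => by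
          exact_mod_cast hB (Set.mem_image_of_mem _ hg)
    _ < ⊤ := by
        rw [setLIntegral_const]
        exact ENNReal.mul_lt_top ENNReal.coe_lt_top hC.measure_lt_top

theorem haarOfAdd_eq (ρ : Measure (Mat F n)) [ρ.IsAddHaarMeasure] (μ : Measure (G F n))
    [μ.IsHaarMeasure] : haarOfAdd ρ = (haarOfAdd ρ).haarScalarFactor μ • μ :=
  have : LocallyCompactSpace (G F n) := (isOpenEmbedding_val F n).locallyCompactSpace
  Measure.isMulLeftInvariant_eq_smul _ _

theorem measurableSet_intDet (i : ℤ) : MeasurableSet (intDet F n i) :=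
  (isOpen_intDet i).measurableSet

/-- The density `|det| ^ (-n)` is constant on `intDet F n i`, equal to `q ^ (n i)`, and Haar
measures on `G` are proportional. -/
theorem restrict_onG_intDet (ρ : Measure (Mat F n)) [ρ.IsAddHaarMeasure] (μ : Measure (G F n))
    [μ.IsHaarMeasure] (i : ℤ) : (onG ρ).restrict (intDet F n i) =
      ((haarOfAdd ρ).haarScalarFactor μ * (resCard F : NNReal) ^ (-(n * i))) •
        μ.restrict (intDet F n i) := by
  set w : NNReal := (resCard F : NNReal) ^ (n * i) with hw
  have hw0 : w ≠ 0 := zpow_ne_zero _ resCard_nnreal_ne_zero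
  have h1 : (haarOfAdd ρ).restrict (intDet F n i) = w • (onG ρ).restrict (intDet F n i) := by
    rw [haarOfAdd, restrict_withDensity (measurableSet_intDet i)]
    rw [withDensity_congr_ae (g := fun _ => (w : ENNReal)), withDensity_const]
    · rfl
    · filter_upwards [ae_restrict_mem (measurableSet_intDet i)] with g hg
      rw [detWeight, hg.2]
  rw [haarOfAdd_eq ρ μ, Measure.restrict_smul] at h1
  rw [zpow_neg, mul_comm, mul_smul, h1, smul_smul, inv_mul_cancel₀ hw0, one_smul]

theorem K_eq_intDet : (K F n : Set (G F n)) = intDet F n 0 := by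
  ext g
  exact ⟨fun h => ⟨h.1, valDet_of_mem_K h⟩, fun h => mem_K_of_integral h.1 h.2⟩

theorem onG_real_K (ρ : Measure (Mat F n)) [ρ.IsAddHaarMeasure] (μ : Measure (G F n))
    [μ.IsHaarMeasure] : (onG ρ).real (K F n : Set (G F n)) =
      (haarOfAdd ρ).haarScalarFactor μ * μ.real (K F n : Set (G F n)) := by
  have h := restrict_onG_intDet ρ μ (n := n) 0
  rw [← K_eq_intDet] at h
  have h1 := congrArg (fun m : Measure (G F n) => m.real Set.univ) h
  simpa [Measure.real] using h1

theorem onG_real_K_pos (ρ : Measure (Mat F n)) [ρ.IsAddHaarMeasure] :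
    0 < (onG ρ).real (K F n : Set (G F n)) := by
  have h1 := onG_isFiniteMeasureOnCompacts ρ
  refine ENNReal.toReal_pos ?_ (isCompact_K F n).measure_lt_top.ne
  rw [onG_apply]
  exact (((isOpenEmbedding_val F n).isOpenMap _ (isOpen_K F n)).measure_pos ρ
    ⟨_, 1, one_mem _, rfl⟩).ne'

theorem haarScalarFactor_pos (ρ : Measure (Mat F n)) [ρ.IsAddHaarMeasure] (μ : Measure (G F n))
    [μ.IsHaarMeasure] : (0 : ℝ) < (haarOfAdd ρ).haarScalarFactor μ :=
  pos_of_mul_pos_left (onG_real_K ρ μ ▸ onG_real_K_pos ρ) (measureReal_K_pos μ).le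

/-- `distribHaarChar` only concerns left multiplication. On the right, `X ↦ X k` is an additive
automorphism, so it scales `ρ` by a constant, which is `1` because `Mat_n(𝒪)` is preserved. -/
theorem map_mul_right_onG (ρ : Measure (Mat F n)) [ρ.IsAddHaarMeasure] {k : G F n}
    (hk : k ∈ K F n) : (onG ρ).map (· * k) = onG ρ := by
  let e : Mat F n ≃+ Mat F n :=
    { toFun := fun X => X * k.val
      invFun := fun X => X * k⁻¹.val
      left_inv := fun X => by
        change X * k.val * k⁻¹.val = X
        rw [Matrix.mul_assoc, ← Units.val_mul, mul_inv_cancel, Units.val_one, Matrix.mul_one]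
      right_inv := fun X => by
        change X * k⁻¹.val * k.val = X
        rw [Matrix.mul_assoc, ← Units.val_mul, inv_mul_cancel, Units.val_one, Matrix.mul_one]
      map_add' := fun X Y => Matrix.add_mul X Y _ }
  have he : Continuous e := continuous_id.matrix_mul continuous_const
  have he' : Continuous e.symm := continuous_id.matrix_mul continuous_const
  have : (ρ.map e).IsAddHaarMeasure := AddEquiv.isAddHaarMeasure_map ρ e he he'
  have h1 := Measure.isAddLeftInvariant_eq_smul (ρ.map e) ρ
  set c := (ρ.map e).addHaarScalarFactor ρ
  have hpre : e ⁻¹' intMat F n = intMat F n := by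
    ext X
    refine ⟨fun h => ?_, fun h => mul_mem_intMat h hk.1⟩
    have h2 : X = e X * k⁻¹.val := (e.symm_apply_apply X).symm
    rw [h2]
    exact mul_mem_intMat h hk.2
  have hc : ρ.map e = ρ := by
    have h2 := congrArg (fun m : Measure (Mat F n) => m (intMat F n)) h1
    simp only [Measure.smul_apply] at h2
    rw [Measure.map_apply he.measurable (s := intMat F n) (isOpen_integral F n).measurableSet, hpre,
      ENNReal.smul_def, smul_eq_mul] at h2
    have h3 : (c : ENNReal) = 1 := by
      refine (ENNReal.mul_left_inj (measure_intMat_ne_zero ρ) (measure_intMat_ne_top ρ)).1 ?_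
      rw [one_mul]
      exact h2.symm
    have h4 : c = 1 := by exact_mod_cast h3
    rw [h1, h4, one_smul]
  ext s hs
  have hmul : Measurable (· * k : G F n → G F n) := measurable_mul_const k
  have hs' : MeasurableSet (Units.val '' s : Set (Mat F n)) :=
    (isOpenEmbedding_val F n).measurableEmbedding.measurableSet_image.2 hs
  rw [Measure.map_apply hmul hs, onG_apply, onG_apply]
  conv_rhs => rw [← hc, Measure.map_apply he.measurable hs']
  congr 1
  ext X
  constructor
  · rintro ⟨x, hx, rfl⟩
    exact ⟨x * k, hx, rfl⟩
  · rintro ⟨x, hx, hxX⟩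
    refine ⟨x * k⁻¹, ?_, ?_⟩
    · change x * k⁻¹ * k ∈ s
      rwa [inv_mul_cancel_right]
    · rw [Units.val_mul, hxX]
      exact e.symm_apply_apply X

end Modulus

/-! ### Complete homogeneous polynomials, their generating series and symmetric powers -/

section SymmetricPowers

theorem sum_piAntidiag_insert {ι : Type*} [DecidableEq ι] {R : Type*} [CommSemiring R] (w : ι → R)
    {s : Finset ι} {j : ι} (hj : j ∉ s) (i : ℕ) :
    ∑ a ∈ (insert j s).piAntidiag i, ∏ l ∈ insert j s, w l ^ a l =
      ∑ p ∈ Finset.HasAntidiagonal.antidiagonal i,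
        w j ^ p.1 * ∑ a ∈ s.piAntidiag p.2, ∏ l ∈ s, w l ^ a l := by
  rw [← Finset.cons_eq_insert j s hj, Finset.piAntidiag_cons, Finset.sum_disjiUnion]
  refine Finset.sum_congr rfl fun p _ => ?_
  rw [Finset.sum_map, Finset.mul_sum]
  refine Finset.sum_congr rfl fun a ha => ?_
  have haj : a j = 0 := by
    by_contra h
    exact hj ((Finset.mem_piAntidiag.1 ha).2 j h)
  rw [Finset.prod_cons]
  congr 1
  · simp [haj]
  · refine Finset.prod_congr rfl fun l hl => ?_
    have : l ≠ j := fun h => hj (h ▸ hl)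
    simp [this]

/-- Adding a variable convolves the sequence with a geometric one (`sum_piAntidiag_insert`), so the
generating series is a Cauchy product of geometric series. -/
theorem hasSum_piAntidiag {ι : Type*} [DecidableEq ι] {𝕜 : Type*} [NormedField 𝕜] [CompleteSpace 𝕜]
    (w : ι → 𝕜) (s : Finset ι) (hw : ∀ j ∈ s, ‖w j‖ < 1) :
    (Summable fun i : ℕ => ‖∑ a ∈ s.piAntidiag i, ∏ l ∈ s, w l ^ a l‖) ∧
      ∑' i : ℕ, ∑ a ∈ s.piAntidiag i, ∏ l ∈ s, w l ^ a l = ∏ l ∈ s, (1 - w l)⁻¹ := by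
  induction s using Finset.induction_on with
  | empty =>
    have h : ∀ i : ℕ, ∑ a ∈ (∅ : Finset ι).piAntidiag i, ∏ l ∈ (∅ : Finset ι), w l ^ a l =
        if i = 0 then 1 else 0 := fun i => by
      rw [Finset.piAntidiag_empty]
      split_ifs <;> simp
    simp only [h]
    refine ⟨summable_of_ne_finset_zero (s := {0}) fun i hi => ?_, ?_⟩
    · rw [if_neg (by simpa using hi), norm_zero]
    · rw [tsum_ite_eq, Finset.prod_empty]
  | insert j s hj ih =>
    obtain ⟨h1, h2⟩ := ih fun l hl => hw l (Finset.mem_insert_of_mem hl)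
    have hwj := hw j (Finset.mem_insert_self j s)
    have h3 : Summable fun i : ℕ => ‖w j ^ i‖ := by
      simp only [norm_pow]
      exact summable_geometric_of_lt_one (norm_nonneg _) hwj
    set g : ℕ → 𝕜 := fun i => ∑ a ∈ s.piAntidiag i, ∏ l ∈ s, w l ^ a l
    have h4 : (fun i : ℕ => ∑ a ∈ (insert j s).piAntidiag i, ∏ l ∈ insert j s, w l ^ a l) =
        fun i => ∑ p ∈ Finset.HasAntidiagonal.antidiagonal i, w j ^ p.1 * g p.2 :=
      funext fun i => sum_piAntidiag_insert w hj i
    simp only [funext_iff] at h4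
    simp only [h4]
    refine ⟨summable_norm_sum_mul_antidiagonal_of_summable_norm h3 h1, ?_⟩
    rw [← tsum_mul_tsum_eq_tsum_sum_antidiagonal_of_summable_norm h3 h1, h2,
      Finset.prod_insert hj, tsum_geometric_of_norm_lt_one hwj]

theorem summable_norm_hsum {n : ℕ} {𝕜 : Type*} [NormedField 𝕜] [CompleteSpace 𝕜] (w : Fin n → 𝕜)
    (hw : ∀ j, ‖w j‖ < 1) : Summable fun i => ‖hsum w i‖ :=
  (hasSum_piAntidiag w Finset.univ fun j _ => hw j).1

theorem hasSum_hsum {n : ℕ} {𝕜 : Type*} [NormedField 𝕜] [CompleteSpace 𝕜] (w : Fin n → 𝕜)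
    (hw : ∀ j, ‖w j‖ < 1) : HasSum (hsum w) (∏ j, (1 - w j)⁻¹) := by
  have h := (summable_norm_hsum w hw).of_norm.hasSum
  rwa [show ∑' i, hsum w i = _ from (hasSum_piAntidiag w Finset.univ fun j _ => hw j).2] at h

theorem hsum_smul {n : ℕ} {R : Type*} [CommSemiring R] (c : R) (w : Fin n → R) (i : ℕ) :
    hsum (fun j => c * w j) i = c ^ i * hsum w i := by
  unfold hsum
  rw [Finset.mul_sum]
  refine Finset.sum_congr rfl fun a ha => ?_
  rw [← (Finset.mem_piAntidiag.1 ha).1, ← Finset.prod_pow_eq_pow_sum, ← Finset.prod_mul_distrib]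
  exact Finset.prod_congr rfl fun j _ => mul_pow _ _ _

theorem hsum_zero_vars {R : Type*} [CommSemiring R] (w : Fin 0 → R) {i : ℕ} (hi : i ≠ 0) :
    hsum w i = 0 := by
  unfold hsum
  rw [Finset.univ_eq_empty, Finset.piAntidiag_empty_of_ne_zero hi, Finset.sum_empty]

open MvPolynomial in
/-- The monomial with coefficient `c` and exponents `a`. -/
noncomputable def homogeneousMonomial {n i : ℕ}
    (a : Finset.piAntidiag (Finset.univ : Finset (Fin n)) i) (c : ℂ) :
    homogeneousSubmodule (Fin n) ℂ i :=
  ⟨monomial (Finsupp.equivFunOnFinite.symm a.1) c, isHomogeneous_monomial _ (by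
    rw [Finsupp.degree_eq_sum]
    exact (Finset.mem_piAntidiag.1 a.2).1)⟩

open MvPolynomial in
theorem coe_sum_homogeneousMonomial {n i : ℕ}
    (c : Finset.piAntidiag (Finset.univ : Finset (Fin n)) i → ℂ) :
    (∑ a, homogeneousMonomial a (c a)).1 =
      ∑ a, monomial (Finsupp.equivFunOnFinite.symm a.1) (c a) :=
  AddSubmonoidClass.coe_finsetSum _ _

open MvPolynomial in
/-- The basis of monomials of the space of homogeneous polynomials. -/
noncomputable def homogeneousBasis (n i : ℕ) :
    Module.Basis (Finset.piAntidiag (Finset.univ : Finset (Fin n)) i) ℂ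
      (homogeneousSubmodule (Fin n) ℂ i) :=
  .ofEquivFun
    { toFun := fun p a => coeff (Finsupp.equivFunOnFinite.symm a.1) p.1
      map_add' := fun p q => funext fun a => coeff_add _ _ _
      map_smul' := fun c p => funext fun a => coeff_smul _ _ _
      invFun := fun c => ∑ a, homogeneousMonomial a (c a)
      left_inv := fun p => by
        ext d
        rw [coe_sum_homogeneousMonomial, coeff_sum]
        simp only [coeff_monomial]
        -- In degrees other than `i` both coefficients vanish, on one side for want of monomials and
        -- on the other by homogeneity.
        by_cases hd : d.degree = i
        · rw [Finset.sum_eq_single ⟨d, Finset.mem_piAntidiag.2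
            ⟨by rw [← hd, Finsupp.degree_eq_sum], fun _ _ => Finset.mem_univ _⟩⟩]
          · rw [if_pos (Finsupp.equivFunOnFinite_symm_coe d)]
            simp
          · intro b _ hb
            rw [if_neg]
            rintro rfl
            exact hb (Subtype.ext rfl)
          · simp
        · rw [Finset.sum_eq_zero]
          · by_contra h
            refine hd ?_
            rw [Finsupp.degree_eq_weight_one]
            exact p.2 (Ne.symm h)
          · intro b _
            rw [if_neg]
            rintro rfl
            refine hd ?_
            rw [Finsupp.degree_eq_sum]
            exact (Finset.mem_piAntidiag.1 b.2).1
      right_inv := fun c => by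
        ext a
        change coeff _ (∑ a, homogeneousMonomial a (c a)).1 = c a
        rw [coe_sum_homogeneousMonomial, coeff_sum]
        simp only [coeff_monomial]
        rw [Finset.sum_eq_single a]
        · rw [if_pos rfl]
        · intro b _ hb
          rw [if_neg]
          intro h
          exact hb (Subtype.ext (Finsupp.equivFunOnFinite.symm.injective h))
        · simp }

open MvPolynomial in
theorem homogeneousBasis_apply (n i : ℕ) (a : Finset.piAntidiag (Finset.univ : Finset (Fin n)) i) :
    (homogeneousBasis n i a).1 = monomial (Finsupp.equivFunOnFinite.symm a.1) 1 := by
  classical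
  rw [homogeneousBasis, Module.Basis.coe_ofEquivFun]
  change (∑ b, homogeneousMonomial b ((Pi.single a 1 : _ → ℂ) b)).1 = _
  rw [coe_sum_homogeneousMonomial]
  rw [Finset.sum_eq_single a]
  · simp
  · intro b _ hb
    simp [hb]
  · simp

open MvPolynomial in
-- A diagonal matrix acts on the monomial with exponents `a` by the scalar `∏ z_j ^ a_j`, so the
-- monomial basis diagonalises `symPow`.
theorem symPowTrace_satakeParam {n : ℕ} (i : ℕ) (z : Fin n → ℂˣ) :
    symPowTrace i (satakeParam z) = hsum (fun j => (z j : ℂ)) i := by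
  classical
  rw [symPowTrace, LinearMap.trace_eq_matrix_trace ℂ (homogeneousBasis n i), Matrix.trace, hsum,
    ← Finset.sum_coe_sort (Finset.piAntidiag Finset.univ i) fun a => ∏ j, (z j : ℂ) ^ a j]
  refine Finset.sum_congr rfl fun a _ => ?_
  rw [Matrix.diag_apply, LinearMap.toMatrix_apply]
  have h1 : symPow i (satakeParam z) (homogeneousBasis n i a) =
      (∏ j, (z j : ℂ) ^ a.1 j) • homogeneousBasis n i a := by
    refine Subtype.ext ?_
    change aeval (fun j => ∑ k, C (satakeParam z k j) * (X k : MvPolynomial (Fin n) ℂ))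
      (homogeneousBasis n i a).1 = (∏ j, (z j : ℂ) ^ a.1 j) • (homogeneousBasis n i a).1
    have h2 : (fun j => ∑ k, C (satakeParam z k j) * (X k : MvPolynomial (Fin n) ℂ)) =
        fun j => C (z j : ℂ) * X j := by
      ext1 j
      rw [Finset.sum_eq_single j]
      · simp [satakeParam]
      · intro k _ hk
        simp [satakeParam, Matrix.diagonal_apply_ne _ hk]
      · simp
    rw [h2, homogeneousBasis_apply, aeval_monomial, map_one, one_mul,
      Finsupp.prod_fintype _ _ fun j => pow_zero _]
    simp only [mul_pow, Finset.prod_mul_distrib, ← C_pow, ← map_prod]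
    rw [← C_mul']
    congr 1
    rw [monomial_eq, C_1, one_mul, Finsupp.prod_fintype _ _ fun j => pow_zero _]
  rw [h1, map_smul, Module.Basis.repr_self, Finsupp.smul_apply, Finsupp.single_eq_same, smul_eq_mul,
    mul_one]

theorem LStd_eq {F : Type*} [Field F] [ValuativeRel F] [TopologicalSpace F]
    [IsNonarchimedeanLocalField F] {n : ℕ} (z : Fin n → ℂˣ) (s : ℂ) :
    LStd F z s = ∏ j, (1 - (resCard F : ℂ) ^ (-s) * z j)⁻¹ := by
  have h : (1 : Matrix (Fin n) (Fin n) ℂ) - (resCard F : ℂ) ^ (-s) • satakeParam z =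
      Matrix.diagonal fun j => 1 - (resCard F : ℂ) ^ (-s) * z j := by
    ext r c
    by_cases hrc : r = c
    · subst hrc
      simp [satakeParam]
    · simp [satakeParam, hrc]
  rw [LStd, h, Matrix.det_diagonal, Finset.prod_inv_distrib]

end SymmetricPowers

/-! ### The basic Whittaker measure as an average over `K` -/

section BasicMeasure

variable {F : Type*} [Field F] [ValuativeRel F] [TopologicalSpace F]
  [IsNonarchimedeanLocalField F] {n : ℕ} {ψ : AddChar F Circle}

theorem NQuot.mk_eq_mk_iff {a b : G F n} : NQuot.mk a = NQuot.mk b ↔ b * a⁻¹ ∈ N F n :=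
  Quotient.eq.trans QuotientGroup.rightRel_apply

theorem isOpenQuotientMap_mk : IsOpenQuotientMap (NQuot.mk : G F n → NQuot F n) := by
  refine ⟨Quotient.mk_surjective, continuous_mk, fun U hU => ?_⟩
  refine isQuotientMap_quotient_mk'.isOpen_preimage.1 ?_
  have h : (NQuot.mk : G F n → NQuot F n) ⁻¹' (NQuot.mk '' U) = ⋃ u ∈ N F n, u • U := by
    ext g
    simp only [Set.mem_preimage, Set.mem_image, Set.mem_iUnion, exists_prop,
      NQuot.mk_eq_mk_iff]
    constructor
    · rintro ⟨x, hx, hu⟩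
      exact ⟨_, hu, x, hx, inv_mul_cancel_right g x⟩
    · rintro ⟨u, hu, x, hx, rfl⟩
      exact ⟨x, hx, by simpa using hu⟩
  change IsOpen ((NQuot.mk : G F n → NQuot F n) ⁻¹' (NQuot.mk '' U))
  rw [h]
  exact isOpen_biUnion fun u _ => hU.smul u

instance : SecondCountableTopology (NQuot F n) :=
  isOpenQuotientMap_mk.isQuotientMap.secondCountableTopology isOpenQuotientMap_mk.isOpenMap

variable (F n) in
/-- The image of `K` in `N \ G`. -/
def baseOrbit : Set (NQuot F n) := NQuot.mk '' (K F n : Set (G F n))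

theorem mk_mem_baseOrbit_iff {g : G F n} :
    NQuot.mk g ∈ baseOrbit F n ↔ ∃ u ∈ N F n, u⁻¹ * g ∈ K F n := by
  constructor
  · rintro ⟨k, hk, h⟩
    have h1 := NQuot.mk_eq_mk_iff.1 h
    exact ⟨_, h1, by simpa using hk⟩
  · rintro ⟨u, hu, hk⟩
    exact ⟨_, hk, NQuot.mk_eq_mk_iff.2 (by simpa using hu)⟩

theorem isOpen_baseOrbit : IsOpen (baseOrbit F n) :=
  isOpenQuotientMap_mk.isOpenMap _ (isOpen_K F n)

theorem isCompact_baseOrbit : IsCompact (baseOrbit F n) := (isCompact_K F n).image continuous_mk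

theorem mk_mul_mem_baseOrbit_iff {g k : G F n} (hk : k ∈ K F n) :
    NQuot.mk (g * k) ∈ baseOrbit F n ↔ NQuot.mk g ∈ baseOrbit F n := by
  simp only [mk_mem_baseOrbit_iff]
  refine exists_congr fun u => and_congr_right fun _ => ?_
  rw [← mul_assoc]
  exact ⟨fun h => by simpa using mul_mem h (inv_mem hk), fun h => mul_mem h hk⟩

theorem isClosed_baseOrbit : IsClosed (baseOrbit F n) := by
  rw [← isOpen_compl_iff]
  refine isOpenQuotientMap_mk.isQuotientMap.isOpen_preimage.1 (isOpen_iff_mem_nhds.2 fun g hg => ?_)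
  refine Filter.mem_of_superset ((isOpen_coset g).mem_nhds ⟨1, one_mem _, mul_one g⟩) ?_
  rintro _ ⟨k, hk, rfl⟩ h
  exact hg ((mk_mul_mem_baseOrbit_iff hk).1 h)

theorem continuous_translate_quot (g : G F n) : Continuous (NQuot.translate g) :=
  isOpenQuotientMap_mk.isQuotientMap.continuous_iff.2 (continuous_mk.comp (continuous_mul_const g))

/-- The translates of the open set `baseOrbit` cover `N \ G`; if one were null, all would be, and
`ν` would vanish by second countability. -/
theorem measure_baseOrbit_ne_zero {ν : Measure (NQuot F n)} (hν : IsInvariantQuot ν) :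
    ν (baseOrbit F n) ≠ 0 := by
  intro h0
  refine hν.1 (Measure.measure_univ_eq_zero.1 (measure_null_of_locally_null _ fun x _ => ?_))
  obtain ⟨g, rfl⟩ := isOpenQuotientMap_mk.surjective x
  refine ⟨NQuot.translate g⁻¹ ⁻¹' baseOrbit F n, ?_, ?_⟩
  · rw [nhdsWithin_univ]
    refine (isOpen_baseOrbit.preimage (continuous_translate_quot _)).mem_nhds ?_
    change NQuot.mk (g * g⁻¹) ∈ baseOrbit F n
    rw [mul_inv_cancel]
    exact ⟨1, one_mem _, rfl⟩
  · rw [← Measure.map_apply (continuous_translate_quot _).measurable isOpen_baseOrbit.measurableSet,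
      hν.2, h0]

theorem continuous_basicWMul (hψ : HasIntegralConductor ψ) (f : Sec ψ n) :
    Continuous (basicWMul hψ f) :=
  Continuous.quotient_lift
    ((continuous_of_K_invariant fun g _ hk => basicW_K hψ g hk).mul f.2.1) _

theorem basicWMul_mk (hψ : HasIntegralConductor ψ) (f : Sec ψ n) (g : G F n) :
    basicWMul hψ f (NQuot.mk g) = basicW ψ g * f.1 g := rfl

theorem basicWMul_of_mem_K (hψ : HasIntegralConductor ψ) (f : Sec ψ n) {k : G F n}
    (hk : k ∈ K F n) : basicWMul hψ f (NQuot.mk k) = f.1 k := by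
  have h := basicW_mul hψ (one_mem (N F n)) hk
  rw [one_mul, psiN_of_integral hψ (one_mem (K F n)).1] at h
  rw [basicWMul_mk, h, one_mul]

theorem basicWMul_of_notMem (hψ : HasIntegralConductor ψ) (f : Sec ψ n) {x : NQuot F n}
    (hx : x ∉ baseOrbit F n) : basicWMul hψ f x = 0 := by
  obtain ⟨g, rfl⟩ := isOpenQuotientMap_mk.surjective x
  rw [basicWMul_mk, basicW_eq_zero fun h => hx (mk_mem_baseOrbit_iff.2 h), zero_mul]

theorem setIntegral_K_mul_left {E : Type*} [NormedAddCommGroup E] [NormedSpace ℝ E]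
    (μ : Measure (G F n)) [μ.IsMulLeftInvariant] (f : G F n → E) {k : G F n} (hk : k ∈ K F n) :
    ∫ x in (K F n : Set (G F n)), f (k * x) ∂μ = ∫ x in (K F n : Set (G F n)), f x ∂μ := by
  rw [← integral_indicator (isOpen_K F n).measurableSet,
    ← integral_indicator (isOpen_K F n).measurableSet,
    ← integral_mul_left_eq_self ((K F n : Set (G F n)).indicator f) k]
  congr 1
  ext g
  by_cases hg : g ∈ (K F n : Set (G F n))
  · rw [Set.indicator_of_mem hg, Set.indicator_of_mem (mul_mem hk hg : k * g ∈ K F n)]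
  · rw [Set.indicator_of_notMem hg, Set.indicator_of_notMem fun h => hg ?_]
    exact ((K F n).mul_mem_cancel_left hk).1 h

open Classical in
/-- The integral of a section against the basic Whittaker measure is a multiple of its integral
over `K`. -/
theorem basicMeasure_apply (hψ : HasIntegralConductor ψ) (ν : Measure (NQuot F n))
    [IsFiniteMeasureOnCompacts ν] (hν : IsInvariantQuot ν) (μ : Measure (G F n)) [μ.IsHaarMeasure]
    (f : Sec ψ n) : (μ.real (K F n : Set (G F n)) : ℂ) * (basicMeasure hψ ν).1 f =
      ν.real (baseOrbit F n) * ∫ k in (K F n : Set (G F n)), f.1 k ∂μ := by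
  set Φ := basicWMul hψ f
  have hΦ : Continuous Φ := continuous_basicWMul hψ f
  set χK : G F n → ℂ := (K F n : Set (G F n)).indicator 1
  have hχ : Continuous χK := continuous_of_K_invariant fun g k hk => by
    have : g * k ∈ (K F n : Set (G F n)) ↔ g ∈ (K F n : Set (G F n)) :=
      (K F n).mul_mem_cancel_right hk
    simp only [χK, Set.indicator_apply, this, Pi.one_apply]
  -- Fubini for `1_K(k) Φ(x k)`. Integrating over `x` first gives the functional, by invariance of
  -- `ν`. Integrating over `k` first gives the integral of `f` over `K` when `x` lies in the image
  -- of `K`, and zero elsewhere. Compact support permits the exchange without finiteness assumptions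
  -- on the measures.
  set H : G F n → NQuot F n → ℂ := fun k x => χK k * Φ (NQuot.translate k x)
  have hH : Continuous (Function.uncurry H) := by
    -- Continuity is tested on `G × G`: a product of open quotient maps is a quotient map.
    refine (((IsOpenQuotientMap.id (X := G F n)).prodMap
      isOpenQuotientMap_mk).isQuotientMap.continuous_iff).2 ?_
    exact (hχ.comp continuous_fst).mul ((hΦ.comp continuous_mk).comp
      (continuous_snd.mul continuous_fst))
  have hHs : HasCompactSupport (Function.uncurry H) := by
    have hK : IsClosed (K F n : Set (G F n)) := (isCompact_K F n).isClosed
    refine ((isCompact_K F n).prod isCompact_baseOrbit).of_isClosed_subset isClosed_closure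
      (closure_minimal ?_ (hK.prod isClosed_baseOrbit))
    rintro ⟨k, x⟩ hkx
    have hk : k ∈ K F n := by
      by_contra h
      exact hkx (by simp [H, χK, Function.uncurry, h])
    refine ⟨hk, ?_⟩
    by_contra h
    refine hkx ?_
    obtain ⟨g, rfl⟩ := isOpenQuotientMap_mk.surjective x
    change χK k * Φ (NQuot.mk (g * k)) = 0
    have h2 : Φ (NQuot.mk (g * k)) = 0 :=
      basicWMul_of_notMem hψ f fun h1 => h ((mk_mul_mem_baseOrbit_iff hk).1 h1)
    rw [h2, mul_zero]
  have hswap := integral_integral_swap_of_hasCompactSupport hH hHs (μ := μ) (ν := ν)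
  have hleft : ∀ k, ∫ x, H k x ∂ν = χK k * (basicMeasure hψ ν).1 f := fun k => by
    have h1 : ∫ x, Φ (NQuot.translate k x) ∂ν = ∫ x, Φ x ∂ν := by
      rw [← integral_map (continuous_translate_quot k).aemeasurable
        hΦ.aestronglyMeasurable, hν.2]
    change ∫ x, χK k * Φ (NQuot.translate k x) ∂ν = _
    rw [integral_const_mul, h1]
    rfl
  have hχint : ∀ φ : G F n → ℂ, ∫ k, χK k * φ k ∂μ = ∫ k in (K F n : Set (G F n)), φ k ∂μ :=
    fun φ => by
      rw [← integral_indicator (isOpen_K F n).measurableSet]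
      congr 1
      ext k
      by_cases hk : k ∈ (K F n : Set (G F n)) <;> simp [χK, hk]
  have hright : ∀ x, ∫ k, H k x ∂μ =
      (baseOrbit F n).indicator (fun _ => ∫ k in (K F n : Set (G F n)), f.1 k ∂μ) x := fun x => by
    change ∫ k, χK k * Φ (NQuot.translate k x) ∂μ = _
    rw [hχint]
    by_cases hx : x ∈ baseOrbit F n
    · rw [Set.indicator_of_mem hx]
      obtain ⟨k₀, hk₀, rfl⟩ := hx
      rw [← setIntegral_K_mul_left μ f.1 hk₀]
      refine setIntegral_congr_fun (isOpen_K F n).measurableSet fun k hk => ?_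
      exact basicWMul_of_mem_K hψ f (mul_mem hk₀ hk)
    · rw [Set.indicator_of_notMem hx]
      obtain ⟨g, rfl⟩ := isOpenQuotientMap_mk.surjective x
      rw [setIntegral_congr_fun (g := fun _ => 0) (isOpen_K F n).measurableSet, integral_zero]
      intro k hk
      exact basicWMul_of_notMem hψ f fun h => hx ((mk_mul_mem_baseOrbit_iff hk).1 h)
  simp only [hleft, hright] at hswap
  rw [hχint, setIntegral_const, integral_indicator isOpen_baseOrbit.measurableSet,
    setIntegral_const, Complex.real_smul, Complex.real_smul] at hswap
  exact hswap

/-- By `basicMeasure_apply`, `φ₀` averages over `K`, so the convolution is a double integral of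
`h(g) f(k g)`. The substitution `g ↦ k⁻¹ g` and left `K`-invariance of `h` remove `k`. -/
theorem conv_basicMeasure_apply (hψ : HasIntegralConductor ψ) (ν : Measure (NQuot F n))
    [IsFiniteMeasureOnCompacts ν] (hν : IsInvariantQuot ν) (μ : Measure (G F n)) [μ.IsHaarMeasure]
    (h : Hecke F n) (f : Sec ψ n) : (WMeas.conv μ h (basicMeasure hψ ν)).1 f =
      ν.real (baseOrbit F n) * ∫ g, h.1 g * f.1 g ∂μ := by
  have hK0 : (μ.real (K F n : Set (G F n)) : ℂ) ≠ 0 := by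
    exact_mod_cast (measureReal_K_pos μ).ne'
  set χK : G F n → ℂ := (K F n : Set (G F n)).indicator 1
  have hχ : Continuous χK := continuous_of_K_invariant fun g k hk => by
    have : g * k ∈ (K F n : Set (G F n)) ↔ g ∈ (K F n : Set (G F n)) :=
      (K F n).mul_mem_cancel_right hk
    classical
    simp only [χK, Set.indicator_apply, this, Pi.one_apply]
  have hχint : ∀ φ : G F n → ℂ, ∫ k, χK k * φ k ∂μ = ∫ k in (K F n : Set (G F n)), φ k ∂μ :=
    fun φ => by
      rw [← integral_indicator (isOpen_K F n).measurableSet]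
      congr 1
      ext k
      by_cases hk : k ∈ (K F n : Set (G F n)) <;> simp [χK, hk]
  set H : G F n → G F n → ℂ := fun g k => h.1 g * (χK k * f.1 (k * g))
  have hH : Continuous (Function.uncurry H) :=
    ((Hecke.continuous h).comp continuous_fst).mul ((hχ.comp continuous_snd).mul
      (f.2.1.comp (continuous_snd.mul continuous_fst)))
  have hHs : HasCompactSupport (Function.uncurry H) := by
    refine HasCompactSupport.intro (h.2.2.isCompact.prod (isCompact_K F n)) ?_
    rintro ⟨g, k⟩ hgk
    change h.1 g * (χK k * f.1 (k * g)) = 0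
    by_cases hg : h.1 g = 0
    · rw [hg, zero_mul]
    · have hk : k ∉ (K F n : Set (G F n)) := fun hk => hgk ⟨subset_tsupport _ hg, hk⟩
      simp [χK, hk]
  have hswap := integral_integral_swap_of_hasCompactSupport hH hHs (μ := μ) (ν := μ)
  have hinner : ∀ k ∈ K F n, ∫ g, h.1 g * f.1 (k * g) ∂μ = ∫ g, h.1 g * f.1 g ∂μ := by
    intro k hk
    rw [← integral_mul_left_eq_self (fun g => h.1 g * f.1 g) k]
    simp only [Hecke.mul_left h _ k hk]
  have h1 : ∫ k, ∫ g, H g k ∂μ ∂μ = μ.real (K F n : Set (G F n)) * ∫ g, h.1 g * f.1 g ∂μ := by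
    have h2 : ∀ k, ∫ g, H g k ∂μ = χK k * ∫ g, h.1 g * f.1 (k * g) ∂μ := fun k => by
      rw [← integral_const_mul]
      congr 1
      ext g
      simp only [H]
      ring
    simp only [h2]
    rw [hχint, setIntegral_congr_fun (g := fun _ => ∫ g, h.1 g * f.1 g ∂μ)
      (isOpen_K F n).measurableSet fun k hk => hinner k hk, setIntegral_const, Complex.real_smul]
  change ∫ g, h.1 g * (basicMeasure hψ ν).1 (Sec.translate g f) ∂μ = _
  have h3 : ∀ g, h.1 g * (basicMeasure hψ ν).1 (Sec.translate g f) =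
      (μ.real (K F n : Set (G F n)) : ℂ)⁻¹ * ν.real (baseOrbit F n) * ∫ k, H g k ∂μ := by
    intro g
    have h4 := basicMeasure_apply hψ ν hν μ (Sec.translate g f)
    have h5 : ∫ k, H g k ∂μ = h.1 g * ∫ k in (K F n : Set (G F n)), f.1 (k * g) ∂μ := by
      rw [← hχint, ← integral_const_mul]
    have h6 : ∫ k in (K F n : Set (G F n)), (Sec.translate g f).1 k ∂μ =
        ∫ k in (K F n : Set (G F n)), f.1 (k * g) ∂μ := rfl
    rw [h5, ← h6]
    field_simp
    linear_combination h.1 g * h4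
  simp only [h3]
  rw [integral_const_mul, hswap, h1]
  field_simp

end BasicMeasure

/-! ### The push-forward of the characteristic function of `Mat_n(𝒪)` -/

section PushForward

variable {F : Type*} [Field F] [ValuativeRel F] [TopologicalSpace F]
  [IsNonarchimedeanLocalField F] {n : ℕ} {ψ : AddChar F Circle}

theorem charMat_eq_one {X : Mat F n} (hX : ∀ i j, X i j ∈ 𝒪[F]) : (charMat F n).1 X = 1 :=
  if_pos hX

theorem charMat_eq_zero {X : Mat F n} (hX : ¬ ∀ i j, X i j ∈ 𝒪[F]) : (charMat F n).1 X = 0 :=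
  if_neg hX

theorem pushforward_apply (ρ : Measure (Mat F n)) [ρ.IsAddHaarMeasure] (c : ℂ) (f : Sec ψ n) :
    (pushforward ψ ρ (c • charMat F n)).1 f =
      c * ∫ g, (charMat F n).1 g.val * f.1 g ∂(onG ρ) := by
  rw [map_smul]
  rfl

theorem translate_pushforward (ρ : Measure (Mat F n)) [ρ.IsAddHaarMeasure] (c : ℂ) {k : G F n}
    (hk : k ∈ K F n) : WMeas.translate k (pushforward ψ ρ (c • charMat F n)) =
      pushforward ψ ρ (c • charMat F n) := by
  refine Subtype.ext (LinearMap.ext fun f => ?_)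
  change (pushforward ψ ρ (c • charMat F n)).1 (Sec.translate k f) = _
  rw [pushforward_apply, pushforward_apply]
  congr 1
  conv_rhs => rw [← map_mul_right_onG ρ hk]
  have hmeas : AEStronglyMeasurable (fun g : G F n => (charMat F n).1 g.val * f.1 g)
      ((onG ρ).map (· * k)) :=
    ((((charMat F n).2.1.continuous).comp Units.continuous_val).mul f.2.1).aestronglyMeasurable
  rw [integral_map (measurable_mul_const k).aemeasurable hmeas]
  congr 1
  ext g
  have h : (charMat F n).1 (g * k).val = (charMat F n).1 g.val := by
    by_cases hg : ∀ i j, g.val i j ∈ 𝒪[F]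
    · rw [charMat_eq_one hg, charMat_eq_one ((integral_mul_right hk).2 hg)]
    · rw [charMat_eq_zero hg, charMat_eq_zero fun h => hg ((integral_mul_right hk).1 h)]
  rw [h]
  rfl

theorem restrict_pushforward_apply (ρ : Measure (Mat F n)) [ρ.IsAddHaarMeasure] (c : ℂ) (i : ℤ)
    (f : Sec ψ n) : (WMeas.restrict i (pushforward ψ ρ (c • charMat F n))).1 f =
      c * ∫ g in intDet F n i, f.1 g ∂(onG ρ) := by
  change (pushforward ψ ρ (c • charMat F n)).1 (Sec.cut i f) = _
  rw [pushforward_apply, ← integral_indicator (measurableSet_intDet i)]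
  congr 2
  ext g
  change (charMat F n).1 g.val * (if valDet g = i then f.1 g else 0) = _
  by_cases hg : g ∈ intDet F n i
  · rw [Set.indicator_of_mem hg, charMat_eq_one hg.1, if_pos hg.2, one_mul]
  · rw [Set.indicator_of_notMem hg]
    by_cases h1 : ∀ r c, g.val r c ∈ 𝒪[F]
    · rw [if_neg fun h2 => hg ⟨h1, h2⟩, mul_zero]
    · rw [charMat_eq_zero h1, zero_mul]

theorem setIntegral_onG_intDet {E : Type*} [NormedAddCommGroup E] [NormedSpace ℝ E]
    (ρ : Measure (Mat F n)) [ρ.IsAddHaarMeasure] (μ : Measure (G F n))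
    [μ.IsHaarMeasure] (i : ℤ) (f : G F n → E) : ∫ g in intDet F n i, f g ∂(onG ρ) =
      (((haarOfAdd ρ).haarScalarFactor μ : ℝ) * (resCard F : ℝ) ^ (-(n * i))) •
        ∫ g in intDet F n i, f g ∂μ := by
  rw [restrict_onG_intDet ρ μ i, integral_smul_nnreal_measure, NNReal.smul_def]
  push_cast
  rfl

theorem intDet_zero_vars (f : G F 0 → ℂ) (μ : Measure (G F 0)) {i : ℤ} (hi : i ≠ 0) :
    ∫ g in intDet F 0 i, f g ∂μ = 0 := by
  have h : intDet F 0 i = ∅ := by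
    rw [Set.eq_empty_iff_forall_notMem]
    rintro g ⟨-, hg⟩
    refine hi ?_
    rw [← hg, valDet, Matrix.det_isEmpty, val_one]
  rw [h, Measure.restrict_empty, integral_zero_measure]

/-- The exponents add up as `-n i + (n - 1) i / 2 = -i (n + 1) / 2`. The hypothesis excludes `n = 0`
with `i ≠ 0`, where the truncated `n - 1` in `satakeFactor` is not the true one. -/
theorem zpow_mul_satakeFactor {i : ℕ} (h : n ≠ 0 ∨ i = 0) :
    (resCard F : ℝ) ^ (-((n : ℤ) * i)) * satakeFactor F n i =
      (resCard F : ℝ) ^ (-((i : ℝ) * ((n : ℝ) + 1) / 2)) := by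
  have hq := resCard_pos (F := F)
  have h1 : (((n - 1) * i : ℕ) : ℝ) = ((n : ℝ) - 1) * i := by
    rcases h with h | h
    · rw [Nat.cast_mul, Nat.cast_sub (Nat.one_le_iff_ne_zero.2 h), Nat.cast_one]
    · simp [h]
  rw [satakeFactor, Real.sqrt_eq_rpow, ← Real.rpow_natCast, h1, ← Real.rpow_mul hq.le,
    ← Real.rpow_intCast, ← Real.rpow_add hq]
  congr 1
  push_cast
  ring

/-- Both sides are multiples of the integral of `f` over `intDet F n i`. The scalar in front of
`charMat` makes the constants agree at `i = 0`, and `zpow_mul_satakeFactor` carries the agreement to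
every `i`. -/
theorem restrict_pushforward_eq_conv (hψ : HasIntegralConductor ψ) (ρ : Measure (Mat F n))
    [ρ.IsAddHaarMeasure] (μ : Measure (G F n)) [μ.IsHaarMeasure] (ν : Measure (NQuot F n))
    [IsFiniteMeasureOnCompacts ν] (hν : IsInvariantQuot ν) (i : ℕ) :
    WMeas.restrict (i : ℤ) (pushforward ψ ρ
      (((ν.real (baseOrbit F n) / ((haarOfAdd ρ).haarScalarFactor μ *
        μ.real (K F n : Set (G F n))) : ℝ) : ℂ) • charMat F n)) =
      (((resCard F : ℝ) ^ (-((i : ℝ) * ((n : ℝ) + 1) / 2)) : ℝ) : ℂ) •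
        WMeas.conv μ (symHecke μ i) (basicMeasure hψ ν) := by
  refine Subtype.ext (LinearMap.ext fun f => ?_)
  change _ = (((resCard F : ℝ) ^ (-((i : ℝ) * ((n : ℝ) + 1) / 2)) : ℝ) : ℂ) *
    (WMeas.conv μ (symHecke μ i) (basicMeasure hψ ν)).1 f
  rw [restrict_pushforward_apply, conv_basicMeasure_apply hψ ν hν, setIntegral_onG_intDet ρ μ]
  have h1 : ∫ g, (symHecke μ i).1 g * f.1 g ∂μ =
      ((μ.real (K F n : Set (G F n)) * satakeFactor F n i : ℝ) : ℂ)⁻¹ *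
        ∫ g in intDet F n i, f.1 g ∂μ := by
    rw [← integral_indicator (measurableSet_intDet _), ← integral_const_mul]
    congr 1
    ext g
    rw [symHecke_apply, mul_assoc]
    by_cases hg : g ∈ intDet F n i <;> simp [hg]
  rw [h1]
  by_cases hi : n ≠ 0 ∨ i = 0
  · rw [← zpow_mul_satakeFactor hi, Complex.real_smul]
    have hK : (μ.real (K F n : Set (G F n)) : ℂ) ≠ 0 := by
      exact_mod_cast (measureReal_K_pos μ).ne'
    have hs : (satakeFactor F n i : ℂ) ≠ 0 := by exact_mod_cast (satakeFactor_pos F n i).ne'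
    have hc : (((haarOfAdd ρ).haarScalarFactor μ : ℝ) : ℂ) ≠ 0 := by
      exact_mod_cast (haarScalarFactor_pos ρ μ).ne'
    push_cast at hc ⊢
    field_simp
  -- For `n = 0` every determinant is `1`, so nothing has valuation `i ≠ 0` and both sides vanish.
  · push Not at hi
    obtain ⟨rfl, hi⟩ := hi
    rw [intDet_zero_vars _ _ (by exact_mod_cast hi)]
    simp

end PushForward

/-! ### The Godement--Jacquet integral -/

section ZetaIntegral

variable {F : Type*} [Field F] [ValuativeRel F] [TopologicalSpace F]
  [IsNonarchimedeanLocalField F] {n : ℕ}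

/-- The absolute values of a Satake parameter. -/
noncomputable def normParam (z : Fin n → ℂˣ) (j : Fin n) : ℂˣ :=
  Units.mk0 (‖(z j : ℂ)‖ : ℂ) (by simp)

/-- The factor `δ^{1/2}` is nonnegative, so absolute values only affect `χ`. Absolute convergence
thereby reduces to an exact evaluation at the parameters `|z_j|`. -/
theorem sphericalVector_normParam (z : Fin n → ℂˣ) (g : G F n) :
    sphericalVector (normParam z) g = ‖sphericalVector z g‖ := by
  unfold sphericalVector
  split_ifs with h
  · simp only [unramifiedChar, norm_mul, norm_prod, Units.val_zpow_eq_zpow_val, norm_zpow,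
      Complex.norm_real, Real.norm_of_nonneg (Real.sqrt_nonneg _), normParam, Units.val_mk0]
    push_cast
    rfl
  · simp

theorem matrixCoeff_eq (μ : Measure (G F n)) (z : Fin n → ℂˣ) (g : G F n) :
    matrixCoeff μ z g = (μ.real (K F n : Set (G F n)) : ℂ)⁻¹ *
      ∫ k in (K F n : Set (G F n)), sphericalVector z (k * g) ∂μ := by
  unfold matrixCoeff
  congr 1
  refine setIntegral_congr_fun (isOpen_K F n).measurableSet fun k hk => ?_
  rw [sphericalVector_K z⁻¹ hk, mul_one]

theorem matrixCoeff_mul_right (μ : Measure (G F n)) (z : Fin n → ℂˣ) (g k : G F n)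
    (hk : k ∈ K F n) : matrixCoeff μ z (g * k) = matrixCoeff μ z g := by
  simp only [matrixCoeff_eq, ← mul_assoc, sphericalVector_mul_right z _ k hk]

theorem matrixCoeff_normParam (μ : Measure (G F n)) (z : Fin n → ℂˣ) (g : G F n) :
    matrixCoeff μ (normParam z) g = (((μ.real (K F n : Set (G F n)))⁻¹ *
      ∫ k in (K F n : Set (G F n)), ‖sphericalVector z (k * g)‖ ∂μ : ℝ) : ℂ) := by
  rw [matrixCoeff_eq]
  simp only [sphericalVector_normParam]
  rw [integral_complex_ofReal]
  push_cast
  rfl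

theorem norm_matrixCoeff_le (μ : Measure (G F n)) (z : Fin n → ℂˣ) (g : G F n) :
    ‖matrixCoeff μ z g‖ ≤ (μ.real (K F n : Set (G F n)))⁻¹ *
      ∫ k in (K F n : Set (G F n)), ‖sphericalVector z (k * g)‖ ∂μ := by
  rw [matrixCoeff_eq, norm_mul, norm_inv, Complex.norm_real, Real.norm_of_nonneg measureReal_nonneg]
  exact mul_le_mul_of_nonneg_left (norm_integral_le_integral_norm _)
    (inv_nonneg.2 measureReal_nonneg)

/-- `M_χ` is the average of `v_χ(k g)` over `k ∈ K`. For each `k` the sum over Hermite forms is the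
same eigenvalue, because `v_χ(k) = 1`, so averaging leaves it unchanged. -/
theorem setIntegral_matrixCoeff (μ : Measure (G F n)) [μ.IsHaarMeasure] (z : Fin n → ℂˣ) (i : ℕ) :
    ∫ g in intDet F n i, matrixCoeff μ z g ∂μ = μ.real (K F n : Set (G F n)) *
      (satakeFactor F n i * hsum (fun j => (z j : ℂ)) i) := by
  have hK : (μ.real (K F n : Set (G F n)) : ℂ) ≠ 0 := by
    exact_mod_cast (measureReal_K_pos μ).ne'
  have hsum_eq : ∀ k ∈ (K F n : Set (G F n)), ∑ p ∈ hermIdx F n i, sphericalVector z (k * hermOf p) =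
      satakeFactor F n i * hsum (fun j => (z j : ℂ)) i := fun k hk => by
    have h := integral_indicator_sphericalVector μ z i k
    rw [setIntegral_intDet μ (f := fun g => sphericalVector z (k * g)) fun g k' hk' => by
      rw [← mul_assoc, sphericalVector_mul_right z _ k' hk'], sphericalVector_K z hk, mul_one,
      Complex.real_smul] at h
    exact mul_left_cancel₀ hK h
  have hint : ∀ g, IntegrableOn (fun k => sphericalVector z (k * g)) (K F n : Set (G F n)) μ :=
    fun g => ((continuous_of_K_invariant (sphericalVector_mul_right z)).comp
      (continuous_mul_const g)).continuousOn.integrableOn_compact (isCompact_K F n)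
  rw [setIntegral_intDet μ (matrixCoeff_mul_right μ z), Complex.real_smul]
  congr 1
  simp only [matrixCoeff_eq]
  rw [← Finset.mul_sum, ← integral_finsetSum _ fun p _ => hint _,
    setIntegral_congr_fun (isOpen_K F n).measurableSet hsum_eq, setIntegral_const,
    Complex.real_smul, inv_mul_cancel_left₀ hK]

theorem zetaIntegrand_eq (μ : Measure (G F n)) (z : Fin n → ℂˣ) (s : ℂ) {i : ℤ} {g : G F n}
    (hg : g ∈ intDet F n i) : zetaIntegrand μ z s g =
      (((resCard F : ℝ) ^ (-i) : ℝ) : ℂ) ^ s * matrixCoeff μ z g := by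
  rw [zetaIntegrand, charMat_eq_one hg.1, one_mul, absF_of_ne_zero (det_ne_zero g), mul_comm]
  have h : val g.val.det = i := hg.2
  rw [h]

theorem zetaIntegrand_eq_zero (μ : Measure (G F n)) (z : Fin n → ℂˣ) (s : ℂ) {g : G F n}
    (hg : g ∉ ⋃ i : ℕ, intDet F n i) : zetaIntegrand μ z s g = 0 := by
  rw [zetaIntegrand, charMat_eq_zero, zero_mul, zero_mul]
  intro h
  have h0 : 0 ≤ valDet g := by
    by_contra h1
    have h2 : g ∈ intDet F n (valDet g) := ⟨h, rfl⟩
    rw [intDet_of_neg (not_le.1 h1)] at h2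
    exact h2
  exact hg (Set.mem_iUnion.2 ⟨(valDet g).toNat, h, (Int.toNat_of_nonneg h0).symm⟩)

theorem norm_zetaIntegrand_le (μ : Measure (G F n)) (z : Fin n → ℂˣ) (s : ℂ) {i : ℤ} {g : G F n}
    (hg : g ∈ intDet F n i) : ‖zetaIntegrand μ z s g‖ ≤
      (zetaIntegrand μ (normParam z) (s.re : ℂ) g).re := by
  have hq : 0 < (resCard F : ℝ) ^ (-i) := zpow_pos resCard_pos _
  rw [zetaIntegrand_eq μ z s hg, zetaIntegrand_eq μ _ _ hg, matrixCoeff_normParam,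
    ← Complex.ofReal_cpow hq.le, ← Complex.ofReal_mul, Complex.ofReal_re, norm_mul,
    Complex.norm_cpow_eq_rpow_re_of_pos hq]
  exact mul_le_mul_of_nonneg_left (norm_matrixCoeff_le μ z g) (Real.rpow_nonneg hq.le _)

theorem integrableOn_zetaIntegrand (ρ : Measure (Mat F n)) [ρ.IsAddHaarMeasure]
    (μ : Measure (G F n)) (z : Fin n → ℂˣ) (s : ℂ) (i : ℤ) :
    IntegrableOn (zetaIntegrand μ z s) (intDet F n i) (onG ρ) := by
  have := onG_isFiniteMeasureOnCompacts ρ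
  refine IntegrableOn.congr_fun ?_ (fun g hg => (zetaIntegrand_eq μ z s hg).symm)
    (measurableSet_intDet i)
  exact (continuous_const.mul (continuous_of_K_invariant
    (matrixCoeff_mul_right μ z))).continuousOn.integrableOn_compact (isCompact_intDet i)

/-- Every base is a positive real, so all complex powers become exponentials of real logarithms and
no branch issue arises. -/
theorem resCard_cpow_identity {i : ℕ} (h : n ≠ 0 ∨ i = 0) (s : ℂ) :
    ((((resCard F : ℝ) ^ (-(i : ℤ)) : ℝ) : ℂ)) ^ s *
        (((resCard F : ℝ) ^ (-((n : ℤ) * i)) * satakeFactor F n i : ℝ) : ℂ) =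
      ((resCard F : ℂ) ^ (-(s + ((n : ℂ) + 1) / 2))) ^ i := by
  have hq := resCard_pos (F := F)
  have hq0 : ((resCard F : ℝ) : ℂ) ≠ 0 := by exact_mod_cast hq.ne'
  rw [zpow_mul_satakeFactor h, Complex.ofReal_cpow hq.le, ← Real.rpow_intCast,
    Complex.ofReal_cpow hq.le, ← Complex.cpow_nat_mul, ← Complex.ofReal_natCast (resCard F),
    Complex.cpow_def_of_ne_zero hq0, Complex.cpow_def_of_ne_zero hq0]
  rw [← Complex.ofReal_log hq.le, ← Complex.ofReal_mul, ← Complex.ofReal_exp,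
    Complex.cpow_def_of_ne_zero (by exact_mod_cast (Real.exp_pos _).ne'),
    ← Complex.ofReal_log (Real.exp_pos _).le, Real.log_exp, ← Complex.exp_add,
    Complex.cpow_def_of_ne_zero hq0, ← Complex.ofReal_log hq.le]
  congr 1
  push_cast
  ring

theorem setIntegral_zetaIntegrand (ρ : Measure (Mat F n)) [ρ.IsAddHaarMeasure]
    (μ : Measure (G F n)) [μ.IsHaarMeasure] (z : Fin n → ℂˣ) (s : ℂ) (i : ℕ) :
    ∫ g in intDet F n i, zetaIntegrand μ z s g ∂(onG ρ) =
      (onG ρ).real (K F n : Set (G F n)) *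
        hsum (fun j => (resCard F : ℂ) ^ (-(s + ((n : ℂ) + 1) / 2)) * z j) i := by
  rw [setIntegral_onG_intDet ρ μ, setIntegral_congr_fun (measurableSet_intDet _)
    fun g hg => zetaIntegrand_eq μ z s hg, integral_const_mul, setIntegral_matrixCoeff,
    Complex.real_smul, hsum_smul, onG_real_K ρ μ]
  by_cases hi : n ≠ 0 ∨ i = 0
  · rw [← resCard_cpow_identity hi]
    push_cast
    ring
  · push Not at hi
    obtain ⟨rfl, hi⟩ := hi
    rw [hsum_zero_vars _ hi]
    simp

/-- The integrand is dominated by the one with parameters `|z_j|` and exponent `Re s`, whose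
integral is known exactly. -/
theorem setIntegral_norm_zetaIntegrand_le (ρ : Measure (Mat F n)) [ρ.IsAddHaarMeasure]
    (μ : Measure (G F n)) [μ.IsHaarMeasure] (z : Fin n → ℂˣ) (s : ℂ) (i : ℕ) :
    ∫ g in intDet F n i, ‖zetaIntegrand μ z s g‖ ∂(onG ρ) ≤
      (onG ρ).real (K F n : Set (G F n)) *
        ‖hsum (fun j => (resCard F : ℂ) ^ (-((s.re : ℂ) + ((n : ℂ) + 1) / 2)) * normParam z j) i‖ := by
  have hint := integrableOn_zetaIntegrand ρ μ (normParam z) (s.re : ℂ) i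
  calc ∫ g in intDet F n i, ‖zetaIntegrand μ z s g‖ ∂(onG ρ)
      ≤ ∫ g in intDet F n i, (zetaIntegrand μ (normParam z) (s.re : ℂ) g).re ∂(onG ρ) :=
        setIntegral_mono_on (integrableOn_zetaIntegrand ρ μ z s i).norm hint.re
          (measurableSet_intDet _) fun g hg => norm_zetaIntegrand_le μ z s hg
    _ = (∫ g in intDet F n i, zetaIntegrand μ (normParam z) (s.re : ℂ) g ∂(onG ρ)).re :=
        integral_re hint
    _ ≤ _ := by
        refine (Complex.re_le_norm _).trans_eq ?_
        rw [setIntegral_zetaIntegrand, norm_mul, Complex.norm_real,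
          Real.norm_of_nonneg measureReal_nonneg]

/-- The integrand lives on the disjoint sets `intDet F n i`, `i ≥ 0`. The hypothesis bounds by `1`
the norms of the variables of the generating series, both for `(z, s)` and for `(|z|, Re s)`: the
second gives integrability, the first the value. -/
theorem zeta_integral (ρ : Measure (Mat F n)) [ρ.IsAddHaarMeasure]
    (μ : Measure (G F n)) [μ.IsHaarMeasure] (z : Fin n → ℂˣ) (s : ℂ)
    (hz : ∀ j, ‖(z j : ℂ)‖ * (resCard F : ℝ) ^ (-(s.re + ((n : ℝ) + 1) / 2)) < 1) :
    Integrable (zetaIntegrand μ z s) (onG ρ) ∧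
      ∫ g, zetaIntegrand μ z s g ∂(onG ρ) =
        ((onG ρ).real (K F n : Set (G F n)) : ℂ) * LStd F z (s + ((n : ℂ) + 1) / 2) := by
  have hq := resCard_pos (F := F)
  have hnorm : ∀ w : ℂ, ‖(resCard F : ℂ) ^ w‖ = (resCard F : ℝ) ^ w.re := fun w => by
    rw [← Complex.ofReal_natCast, Complex.norm_cpow_eq_rpow_re_of_pos hq]
  have hre : ∀ w : ℂ, (-(w + ((n : ℂ) + 1) / 2)).re = -(w.re + ((n : ℝ) + 1) / 2) := fun w => by
    have h : (n : ℂ) + 1 = ((n + 1 : ℝ) : ℂ) := by push_cast; rfl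
    rw [h, Complex.neg_re, Complex.add_re, Complex.div_ofNat_re, Complex.ofReal_re]
  have hw : ∀ j, ‖(resCard F : ℂ) ^ (-(s + ((n : ℂ) + 1) / 2)) * z j‖ < 1 := fun j => by
    rw [norm_mul, hnorm, hre, mul_comm]
    exact hz j
  have hw' : ∀ j, ‖(resCard F : ℂ) ^ (-((s.re : ℂ) + ((n : ℂ) + 1) / 2)) * normParam z j‖ < 1 :=
    fun j => by
      rw [norm_mul, hnorm, hre, mul_comm, normParam, Units.val_mk0, Complex.norm_real, norm_norm,
        Complex.ofReal_re]
      exact hz j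
  have hdisj : Pairwise (Function.onFun Disjoint fun i : ℕ => intDet F n (i : ℤ)) := fun i j hij =>
    Set.disjoint_left.2 fun g hgi hgj => hij (by exact_mod_cast hgi.2.symm.trans hgj.2)
  have hmeas : ∀ i : ℕ, MeasurableSet (intDet F n (i : ℤ)) := fun i => measurableSet_intDet _
  have hon : IntegrableOn (zetaIntegrand μ z s) (⋃ i : ℕ, intDet F n i) (onG ρ) := by
    refine integrableOn_iUnion_of_summable_integral_norm
      (fun i => integrableOn_zetaIntegrand ρ μ z s i) ?_
    exact Summable.of_nonneg_of_le (fun i => integral_nonneg fun g => norm_nonneg _)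
      (fun i => setIntegral_norm_zetaIntegrand_le ρ μ z s i)
      ((summable_norm_hsum _ hw').mul_left _)
  have h := hasSum_integral_iUnion hmeas hdisj hon
  rw [setIntegral_eq_integral_of_forall_compl_eq_zero
    fun g hg => zetaIntegrand_eq_zero μ z s hg] at h
  simp only [setIntegral_zetaIntegrand ρ μ] at h
  refine ⟨(integrableOn_iff_integrable_of_support_subset fun g hg => by_contra fun h' =>
    hg (zetaIntegrand_eq_zero μ z s h')).1 hon, ?_⟩
  rw [LStd_eq]
  exact h.unique ((hasSum_hsum _ hw).mul_left _)

end ZetaIntegral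

end WhittakerStd

/-! ### The Hecke elements, the Whittaker measure and the zeta integral together -/

theorem mainTheorem8 {F : Type*} [Field F] [ValuativeRel F] [TopologicalSpace F]
    [IsNonarchimedeanLocalField F] (n : ℕ)
    (ψ : AddChar F Circle) (hψ_cont : Continuous ψ) (hψ : HasIntegralConductor ψ)
    (ρ : Measure (Mat F n)) [ρ.IsAddHaarMeasure]
    (μ : Measure (G F n)) [μ.IsHaarMeasure]
    (ν : Measure (NQuot F n)) [IsFiniteMeasureOnCompacts ν] (hν : IsInvariantQuot ν) :
    (∀ i : ℕ, ∃! h : Hecke F n,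
      IsSatakeTransform μ h fun z => symPowTrace i (satakeParam z)) ∧
    (∃ φ ∈ LinearMap.range (pushforward ψ ρ),
      (∃ c : ℝ, 0 < c ∧ φ = pushforward ψ ρ ((c : ℂ) • charMat F n)) ∧
      (∀ k ∈ K F n, WMeas.translate k φ = φ) ∧
      (∀ (i : ℕ) (h : Hecke F n),
        (IsSatakeTransform μ h fun z => symPowTrace i (satakeParam z)) →
        WMeas.restrict (i : ℤ) φ =
          (((resCard F : ℝ) ^ (-((i : ℝ) * ((n : ℝ) + 1) / 2)) : ℝ) : ℂ) •
            WMeas.conv μ h (basicMeasure hψ ν)) ∧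
      (∀ i : ℤ, i < 0 → WMeas.restrict i φ = 0)) ∧
    (∀ (z : Fin n → ℂˣ) (s : ℂ),
      (∀ j, ‖(z j : ℂ)‖ * (resCard F : ℝ) ^ (-(s.re + ((n : ℝ) + 1) / 2)) < 1) →
      Integrable (zetaIntegrand μ z s) (onG ρ) ∧
      ∫ g, zetaIntegrand μ z s g ∂(onG ρ) =
        ((onG ρ).real (K F n : Set (G F n)) : ℂ) * LStd F z (s + ((n : ℂ) + 1) / 2)) := by
  have hsat : ∀ i : ℕ,
      IsSatakeTransform μ (symHecke μ i) fun z => symPowTrace i (satakeParam z) := fun i => by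
    simp only [symPowTrace_satakeParam]
    exact isSatakeTransform_symHecke μ i
  have hν0 : 0 < ν.real (baseOrbit F n) :=
    ENNReal.toReal_pos (measure_baseOrbit_ne_zero hν) isCompact_baseOrbit.measure_lt_top.ne
  refine ⟨fun i => ⟨symHecke μ i, hsat i, fun h hh => hh.unique μ (hsat i)⟩,
    -- The scalar normalises the additive measure so that `φ` restricted to determinants of
    -- valuation `0` is `φ₀`.
    ⟨_, ⟨_, rfl⟩, ⟨ν.real (baseOrbit F n) / ((haarOfAdd ρ).haarScalarFactor μ *
      μ.real (K F n : Set (G F n))), div_pos hν0 (mul_pos (haarScalarFactor_pos ρ μ)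
        (measureReal_K_pos μ)), rfl⟩, fun k hk => translate_pushforward ρ _ hk,
      fun i h hh => ?_, fun i hi => ?_⟩, zeta_integral ρ μ⟩
  -- Any `h` with the prescribed transform is the explicit `symHecke μ i`, by injectivity.
  · rw [hh.unique μ (hsat i)]
    exact restrict_pushforward_eq_conv hψ ρ μ ν hν i
  · refine Subtype.ext (LinearMap.ext fun f => ?_)
    rw [restrict_pushforward_apply, intDet_of_neg hi, Measure.restrict_empty,
      integral_zero_measure, mul_zero]
    rfl
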